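/- Let $H$ be a finite-dimensional $\mathbb Q$-vector space of dimension $2h+2$ ($h\ge 0$) with a nondegenerate alternating form $Q$, and $H_{\mathbb C}=\mathbb C\otimes H$. Let $\check D$ be the complex manifold of filtrations $F^3\subset F^2\subset F^1\subset H_{\mathbb C}$ with $\dim F^3=1$, $\dim F^2=h+1$, $\dim F^1=2h+1$ and $F^{4-p}=(F^p)^{\perp_Q}$, let $D\subset\check D$ be the period domain of $Q$-polarized Hodge structures of weight $3$ with $h^{3,0}=1$, $h^{2,1}=h$, and let $I\subset T^*\check D$ be the infinitesimal period relation, i.e. the annihilator of the distribution $dF^p\subset F^{p-1}$. Let $P=\mathbb P(H_{\mathbb C})\cong\mathbb P^{2h+1}$, with the Pfaffian system $C\subset T^*P$ generated by the $1$-forms $Q(dz,z)$, $z$ a local holomorphic section of the tautological line bundle. Put $\pi:\check D\to P$, $\pi(F)=F^3$. For a Pfaffian system $C$ on $P$ let $G_h(C)$ be the variety of its $h$-dimensional integral elements $(x,E)$, $E\subset T_xP$ (all local holomorphic sections $\theta$ of $C$ and their differentials $d\theta$ vanish on $E$). Its first prolongation is the smooth locus of $G_h(C)$ with the restriction of the canonical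 system $J_{(x,E)}=$ pullback of $E^\perp\subset T_x^*P$. An integral manifold of $I$ is a holomorphic immersion $f:N\to\check D$ (in particular, into $D$) with $f^*\theta=0$ for all $\theta\in I$; integral manifolds of $C$ are defined likewise. It is of Calabi–Yau type if for each $n\in N$ the map $T_nN\to \mathrm{Hom}(F^3,F^2/F^3)=\mathrm{Hom}(H^{3,0},H^{2,1})$ induced by the derivative of $F^3$ is an isomorphism. **Proposition 3.17.** (1) $D$ is open in $\check D$; $I$ is a Pfaffian system of rank $h+1$ on $\check D$; and $C$ is a contact system on $P$ (locally generated by a holomorphic $1$-form $\theta$ with $\theta\wedge(d\theta)^h\neq 0$). (2) The canonical map $F\mapsto (F^3,\ \mathrm{Hom}(F^3,F^2/F^3)\subset \mathrm{Hom}(F^3,H_{\mathbb C}/F^3)=T_{F^3}P)$ is a biholomorphism of $\check D$ onto the smooth locus of $G_h(C)$ that identifies $I$ with the canonical system $J$; i.e. $(\check D,I)$ is the first prolongation of the contact system $(P,C)$, and $(D,I)$ is an open part of it. (3) Let $N$ be a complex manifold of dimension $h$. A holomorphic map $f:N\to\check D$ is an integral manifold of $I$ of Calabi–Yau type if and only if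 $\pi\circ f$ is an integral manifold of $C$ and $f$ corresponds under (2) to its canonical lift $n\mapsto(\pi f(n),(\pi f)_*T_nN)$. Moreover $f\mapsto\pi\circ f$ is a bijection from the integral manifolds $N\to\check D$ of $I$ of Calabi–Yau type onto the integral manifolds $N\to P$ of $C$. (4) Locally, integral manifolds of Calabi–Yau type depend on one arbitrary holomorphic function of $h$ variables. Precisely, for linear coordinates $(a,b)$ on $H_{\mathbb C}$, $a,b\in\mathbb C^{h+1}$, in which $Q(v,w)=\sum_{i=0}^h (a_i(v)b_i(w)-b_i(v)a_i(w))$, let $\mathcal U\subset\check D$ be the set of flags for which the coordinates $a$ are independent on $F^2$ and $a_0\ne0$ on $F^3\setminus 0$. These sets are open and, as the coordinates vary, cover $\check D$. For a function $g$ on $\mathbb C^h$, holomorphic near $x$, let $z_g(x)$ be the vector with $a=(1,x)$, $b=(2g-\sum_i x_i\partial_ig,\ \partial_1g,\dots,\partial_hg)$, and let $F_g(x)$ be the flag with $F^3=\mathbb C z_g(x)$, $F^2=\mathrm{span}\{z_g(x),\partial_1z_g(x),\dots,\partial_hz_g(x)\}$. Fix such coordinates. - Every $F\in\mathcal U$ is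 $F_g(x)$ for some $x$ and some entire $g$. - For every open $U\subset\mathbb C^h$ and holomorphic $g$ on $U$, $x\mapsto F_g(x)$ is an integral manifold $U\to\check D$ of $I$ of Calabi–Yau type. - If $N$ is a complex manifold of dimension $h$, $f:N\to\check D$ is an integral manifold of $I$ of Calabi–Yau type and $f(n)\in\mathcal U$, then there are a holomorphic chart $\chi$ of $N$ around $n$ and a holomorphic function $g$ on its image such that $f(m)=F_g(\chi(m))$ for all $m$ in the domain of $\chi$. - If $F_g(x)=F_{g'}(x')$, then $x=x'$ and $g(x)=g'(x')$. -/

import Mathlib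

open Set Filter Topology Module LinearAlgebra.Projectivization
open scoped TensorProduct
open scoped Manifold ContDiff

/-- A holomorphic atlas on a set `X`, given by a family of injective parametrizations
`φ i : E → X` of subsets that cover `X`; near each point of an overlap the change of parameters is
a holomorphic map `τ`. -/
structure HolAtlas (ι E X : Type*) [NormedAddCommGroup E] [NormedSpace ℂ E] where
  φ : ι → E → X
  inj : ∀ i, Function.Injective (φ i)
  cover : ∀ x, ∃ i, x ∈ range (φ i)
  compat : ∀ i j u, φ i u ∈ range (φ j) →
    ∃ τ : E → E, ContDiffAt ℂ ω τ u ∧ ∀ᶠ u' in 𝓝 u, φ j (τ u') = φ i u'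

namespace HolAtlas

variable {ι E X : Type*} [NormedAddCommGroup E] [NormedSpace ℂ E] (A : HolAtlas ι E X)

/-- The chart inverse to the parametrization `φ i`. -/
noncomputable def chart (i : ι) : PartialEquiv X E where
  toFun := Function.extend (A.φ i) id 0
  invFun := A.φ i
  source := range (A.φ i)
  target := univ
  map_source' _ _ := mem_univ _
  map_target' u _ := mem_range_self u
  left_inv' := by
    rintro _ ⟨u, rfl⟩
    rw [(A.inj i).extend_apply, id]
  right_inv' u _ := (A.inj i).extend_apply _ _ _

theorem chart_apply (i : ι) (u : E) : A.chart i (A.φ i u) = u := (A.inj i).extend_apply _ _ _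

theorem eventually_range (i j : ι) (u : E) (hu : A.φ i u ∈ range (A.φ j)) :
    ∀ᶠ u' in 𝓝 u, A.φ i u' ∈ range (A.φ j) := by
  obtain ⟨τ, -, h⟩ := A.compat i j u hu
  exact h.mono fun u' h' => ⟨_, h'⟩

theorem contDiffAt_change (i j : ι) (u : E) (hu : A.φ i u ∈ range (A.φ j)) :
    ContDiffAt ℂ ω (fun u' => A.chart j (A.φ i u')) u := by
  obtain ⟨τ, hτ, h⟩ := A.compat i j u hu
  refine hτ.congr_of_eventuallyEq (h.mono fun u' h' => ?_)
  simp only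
  rw [← h', A.chart_apply]

/-- The topology and the charts determined by the parametrizations. -/
noncomputable def core : ChartedSpaceCore E X where
  atlas := range A.chart
  chartAt x := A.chart (A.cover x).choose
  mem_chart_source x := (A.cover x).choose_spec
  chart_mem_atlas x := mem_range_self _
  open_source := by
    rintro _ _ ⟨i, rfl⟩ ⟨j, rfl⟩
    rw [isOpen_iff_mem_nhds]
    rintro u ⟨-, hu⟩
    exact (A.eventually_range i j u hu).mono fun u' h' => ⟨mem_univ _, h'⟩
  continuousOn_toFun := by
    rintro _ _ ⟨i, rfl⟩ ⟨j, rfl⟩ u ⟨-, hu⟩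
    exact (A.contDiffAt_change i j u hu).continuousAt.continuousWithinAt

theorem isManifold :
    letI := A.core.toTopologicalSpace
    letI := A.core.toChartedSpace
    IsManifold 𝓘(ℂ, E) ω X := by
  let := A.core.toTopologicalSpace
  let := A.core.toChartedSpace
  refine isManifold_of_contDiffOn _ _ _ ?_
  intro e e' he he'
  obtain ⟨_, ⟨_, rfl⟩, _, ⟨⟨i, rfl⟩, rfl⟩, rfl⟩ := he
  obtain ⟨_, ⟨_, rfl⟩, _, ⟨⟨j, rfl⟩, rfl⟩, rfl⟩ := he'
  rintro u ⟨⟨-, hu⟩, -⟩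
  exact (A.contDiffAt_change i j u hu).contDiffWithinAt

end HolAtlas

/-- A nondegenerate alternating form on a complex vector space of dimension `2h + 2`. -/
structure SymplecticForm (V : Type*) [AddCommGroup V] [Module ℂ V] (h : ℕ) where
  form : LinearMap.BilinForm ℂ V
  alt : form.IsAlt
  nondeg : form.Nondegenerate
  dim : Module.finrank ℂ V = 2 * h + 2

section Proj

variable {V : Type*} [AddCommGroup V] [Module ℂ V] {h : ℕ}

theorem SymplecticForm.finiteDimensional (S : SymplecticForm V h) : FiniteDimensional ℂ V :=
  FiniteDimensional.of_finrank_pos (by rw [S.dim]; omega)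

theorem exists_linearEquiv_map_eq {W W' : Type*} [AddCommGroup W] [Module ℂ W]
    [NormedAddCommGroup W'] [NormedSpace ℂ W'] [FiniteDimensional ℂ W] [FiniteDimensional ℂ W']
    (hd : finrank ℂ W = finrank ℂ W') {w : W} (hw : w ≠ 0) {w' : W'} (hw' : w' ≠ 0) :
    ∃ e : W ≃ₗ[ℂ] W', e w = w' := by
  let f := LinearEquiv.ofFinrankEq W W' hd
  obtain ⟨A, hA⟩ := SeparatingDual.exists_continuousLinearEquiv_apply_eq (R := ℂ)
    (x := f w) (y := w') (by simpa using hw) hw'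
  exact ⟨f.trans A.toLinearEquiv, hA⟩

/-- The projective space `ℙ(V)` of lines in a symplectic vector space `V` of dimension `2h + 2`. -/
def SymplecticForm.Proj (_S : SymplecticForm V h) : Type _ := ℙ ℂ V

/-- The affine chart of `ℙ(V)` given by linear coordinates `(z₀, u)` on `V`: the point with
inhomogeneous coordinates `u` is the line through the vector `(1, u)`. -/
noncomputable def SymplecticForm.projParam (S : SymplecticForm V h)
    (e : V ≃ₗ[ℂ] ℂ × (Fin (2 * h + 1) → ℂ)) (u : Fin (2 * h + 1) → ℂ) : S.Proj :=
  Projectivization.mk ℂ (e.symm (1, u)) (by simp)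

theorem SymplecticForm.projParam_eq_iff (S : SymplecticForm V h)
    (e e' : V ≃ₗ[ℂ] ℂ × (Fin (2 * h + 1) → ℂ)) (u u' : Fin (2 * h + 1) → ℂ) :
    S.projParam e' u' = S.projParam e u ↔
      (e' (e.symm (1, u))).1 ≠ 0 ∧
        u' = (e' (e.symm (1, u))).1⁻¹ • (e' (e.symm (1, u))).2 := by
  refine (Projectivization.mk_eq_mk_iff' ℂ _ _ _ _).trans ⟨?_, ?_⟩
  · rintro ⟨a, ha⟩
    have h1 := congrArg e' ha
    rw [map_smul, LinearEquiv.apply_symm_apply] at h1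
    have h2 := congrArg Prod.fst h1
    have h3 := congrArg Prod.snd h1
    simp only [Prod.smul_fst, Prod.smul_snd, smul_eq_mul] at h2 h3
    have h4 : (e' (e.symm (1, u))).1 ≠ 0 := right_ne_zero_of_mul_eq_one h2
    exact ⟨h4, by rw [← h3, eq_inv_of_mul_eq_one_left h2]⟩
  · rintro ⟨h4, h5⟩
    refine ⟨(e' (e.symm (1, u))).1⁻¹, e'.injective ?_⟩
    rw [map_smul, LinearEquiv.apply_symm_apply, h5]
    ext1
    · simp [h4]
    · rfl

/-- The standard holomorphic atlas of `ℙ(V)`. -/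
noncomputable def SymplecticForm.projAtlas (S : SymplecticForm V h) :
    HolAtlas (V ≃ₗ[ℂ] ℂ × (Fin (2 * h + 1) → ℂ)) (Fin (2 * h + 1) → ℂ) S.Proj where
  φ := S.projParam
  inj e u u' huu := by
    have := ((S.projParam_eq_iff e e u' u).1 huu).2
    simpa using this
  cover x := by
    have := S.finiteDimensional
    induction x using Projectivization.ind with
    | h z hz =>
      obtain ⟨e, he⟩ := exists_linearEquiv_map_eq (W := V) (W' := ℂ × (Fin (2 * h + 1) → ℂ))
        (by rw [S.dim]; simp; omega) hz (w' := (1, 0)) (by simp)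
      refine ⟨e, 0, ?_⟩
      refine (Projectivization.mk_eq_mk_iff' ℂ _ _ _ _).2 ⟨1, e.injective ?_⟩
      simp [he]
  compat e e' u := by
    rintro ⟨w, hw⟩
    have hne := ((S.projParam_eq_iff e e' u w).1 hw).1
    let T : ℂ × (Fin (2 * h + 1) → ℂ) →L[ℂ] ℂ × (Fin (2 * h + 1) → ℂ) :=
      LinearMap.toContinuousLinearMap (e'.toLinearMap ∘ₗ e.symm.toLinearMap)
    have hT : ContDiff ℂ ω fun u : Fin (2 * h + 1) → ℂ => T (1, u) := by fun_prop
    have hne' : (T (1, u)).1 ≠ 0 := hne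
    refine ⟨fun u => (T (1, u)).1⁻¹ • (T (1, u)).2, ?_, ?_⟩
    · exact (hT.fst.contDiffAt.inv hne').smul hT.snd.contDiffAt
    · have : ∀ᶠ u' in 𝓝 u, (T (1, u')).1 ≠ 0 :=
        hT.fst.continuous.continuousAt.eventually_ne hne'
      exact this.mono fun u' hu' => (S.projParam_eq_iff e e' u' _).2 ⟨hu', rfl⟩

noncomputable instance (S : SymplecticForm V h) : TopologicalSpace S.Proj :=
  S.projAtlas.core.toTopologicalSpace

noncomputable instance (S : SymplecticForm V h) :
    ChartedSpace (Fin (2 * h + 1) → ℂ) S.Proj :=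
  S.projAtlas.core.toChartedSpace

instance (S : SymplecticForm V h) : IsManifold 𝓘(ℂ, Fin (2 * h + 1) → ℂ) ω S.Proj :=
  S.projAtlas.isManifold

end Proj
section CompactDual

variable {V : Type*} [AddCommGroup V] [Module ℂ V] {h : ℕ}

/-- The compact dual `Ď` for weight 3 and Hodge numbers `h^{3,0} = 1`, `h^{2,1} = h`: filtrations
`F³ ⊆ F² ⊆ F¹ ⊆ V` with `dim Fᵖ = fᵖ` and `F^{4-p} = (Fᵖ)^⊥`. -/
@[ext]
structure SymplecticForm.CompactDual (S : SymplecticForm V h) where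
  F3 : Submodule ℂ V
  F2 : Submodule ℂ V
  F1 : Submodule ℂ V
  F3_le_F2 : F3 ≤ F2
  F2_le_F1 : F2 ≤ F1
  finrank_F3 : finrank ℂ F3 = 1
  finrank_F2 : finrank ℂ F2 = h + 1
  finrank_F1 : finrank ℂ F1 = 2 * h + 1
  F1_eq : F1 = S.form.orthogonal F3
  F2_eq : F2 = S.form.orthogonal F2

/-- Symplectic coordinates `(a, b)` on `V`, with `a, b ∈ ℂ^{h+1}`:
`Q(v, w) = ∑ i, (a_i(v) b_i(w) - b_i(v) a_i(w))`. -/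
structure SymplecticForm.Frame (S : SymplecticForm V h) where
  coord : V ≃ₗ[ℂ] (Fin (h + 1) → ℂ) × (Fin (h + 1) → ℂ)
  form_eq : ∀ v w, S.form v w =
    ∑ i, ((coord v).1 i * (coord w).2 i - (coord v).2 i * (coord w).1 i)

/-- The symmetric matrix with entries `s {i, j}`, as an operator. -/
noncomputable def symOp (n : ℕ) : (Sym2 (Fin n) → ℂ) →ₗ[ℂ] (Fin n → ℂ) →L[ℂ] (Fin n → ℂ) where
  toFun s := LinearMap.toContinuousLinearMap
    { toFun := fun a i => ∑ j, s s(i, j) * a j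
      map_add' := fun a a' => by ext i; simp [mul_add, Finset.sum_add_distrib]
      map_smul' := fun c a => by
        ext i; simp only [Pi.smul_apply, smul_eq_mul, Finset.mul_sum, RingHom.id_apply]
        exact Finset.sum_congr rfl fun j _ => by ring }
  map_add' s t := by ext a i; simp [add_mul, Finset.sum_add_distrib]
  map_smul' c s := by
    ext a i
    simp [Finset.mul_sum, mul_assoc]

theorem symOp_apply (n : ℕ) (s : Sym2 (Fin n) → ℂ) (a : Fin n → ℂ) (i : Fin n) :
    symOp n s a i = ∑ j, s s(i, j) * a j := rfl

theorem symOp_symm (n : ℕ) (s : Sym2 (Fin n) → ℂ) (a b : Fin n → ℂ) :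
    ∑ i, a i * symOp n s b i = ∑ i, symOp n s a i * b i := by
  simp only [symOp_apply, Finset.mul_sum, Finset.sum_mul]
  rw [Finset.sum_comm]
  refine Finset.sum_congr rfl fun i _ => Finset.sum_congr rfl fun j _ => ?_
  rw [Sym2.eq_swap]; ring

/-- Every symmetric operator comes from a function on unordered pairs. -/
theorem symOp_surj (n : ℕ) (R : (Fin n → ℂ) →L[ℂ] (Fin n → ℂ))
    (hR : ∀ a b, ∑ i, a i * R b i = ∑ i, R a i * b i) :
    symOp n (fun q => R (Pi.single (Quot.out q).2 1) (Quot.out q).1) = R := by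
  have hs : ∀ i j, R (Pi.single j 1) i = R (Pi.single i 1) j := fun i j => by
    have := hR (Pi.single i 1) (Pi.single j 1)
    simpa [Pi.single_apply] using this
  have hq : ∀ i j, R (Pi.single (Quot.out s(i, j)).2 1) (Quot.out s(i, j)).1
      = R (Pi.single j 1) i := fun i j => by
    have : Sym2.mk (Quot.out s(i, j)).1 (Quot.out s(i, j)).2 = s(i, j) := Quot.out_eq s(i, j)
    rcases Sym2.eq_iff.1 this with ⟨h1, h2⟩ | ⟨h1, h2⟩
    · rw [h1, h2]
    · rw [h1, h2, hs]
  ext a i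
  have ha : a = ∑ j, a j • Pi.single j (1 : ℂ) := by
    ext k; simp [Finset.sum_apply, Pi.single_apply]
  rw [symOp_apply]
  conv_rhs => rw [ha]
  simp [hq, mul_comm]

namespace SymplecticForm

variable (S : SymplecticForm V h)

/-- The vector of `V` with coordinates `(a, s a)`, for a symmetric matrix `s`. -/
noncomputable def graphVec {S : SymplecticForm V h} (e : S.Frame) (s : Sym2 (Fin (h + 1)) → ℂ) :
    (Fin (h + 1) → ℂ) →ₗ[ℂ] V :=
  e.coord.symm.toLinearMap ∘ₗ LinearMap.prod LinearMap.id (symOp (h + 1) s).toLinearMap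

theorem coord_symm_graphVec {S : SymplecticForm V h} (e : S.Frame) (s : Sym2 (Fin (h + 1)) → ℂ)
    (a : Fin (h + 1) → ℂ) : graphVec e s a = e.coord.symm (a, symOp (h + 1) s a) := rfl

theorem coord_graphVec {S : SymplecticForm V h} (e : S.Frame) (s : Sym2 (Fin (h + 1)) → ℂ)
    (a : Fin (h + 1) → ℂ) : e.coord (graphVec e s a) = (a, symOp (h + 1) s a) := by
  simp [graphVec]

theorem graphVec_injective {S : SymplecticForm V h} (e : S.Frame) (s : Sym2 (Fin (h + 1)) → ℂ) :
    Function.Injective (graphVec e s) := fun a b hab => by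
  have := congrArg e.coord hab
  rw [coord_graphVec, coord_graphVec] at this
  exact congrArg Prod.fst this

theorem form_graphVec {S : SymplecticForm V h} (e : S.Frame) (s : Sym2 (Fin (h + 1)) → ℂ)
    (a : Fin (h + 1) → ℂ) (v : V) : S.form (graphVec e s a) v =
      ∑ i, a i * ((e.coord v).2 i - symOp (h + 1) s (e.coord v).1 i) := by
  rw [e.form_eq, coord_graphVec]
  simp only [mul_sub, Finset.sum_sub_distrib]
  rw [symOp_symm]

/-- The affine chart of `Ď` given by symplectic coordinates: the parameters `(x, s)` correspond to
`F² = {(a, s a)}`, with `s` symmetric, and `F³ = ℂ (a, s a)` for `a = (1, x)`. -/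
noncomputable def dualParam (e : S.Frame) (u : (Fin h → ℂ) × (Sym2 (Fin (h + 1)) → ℂ)) :
    S.CompactDual :=
  have hne : graphVec e u.2 (Fin.cons 1 u.1) ≠ 0 := fun h0 => by
    have := congrFun (graphVec_injective e u.2 (h0.trans (map_zero _).symm)) 0
    simp at this
  have hF2 : LinearMap.range (graphVec e u.2) =
      S.form.orthogonal (LinearMap.range (graphVec e u.2)) := by
    ext v
    rw [LinearMap.BilinForm.mem_orthogonal_iff]
    constructor
    · rintro ⟨b, rfl⟩ _ ⟨a, rfl⟩
      rw [form_graphVec, coord_graphVec]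
      simp
    · intro hv
      refine ⟨(e.coord v).1, e.coord.injective ?_⟩
      rw [coord_graphVec]
      ext i
      · rfl
      · have := hv _ ⟨Pi.single i 1, rfl⟩
        rw [form_graphVec] at this
        simp only [Pi.single_apply, ite_mul, one_mul, zero_mul, Finset.sum_ite_eq',
          Finset.mem_univ, if_true] at this
        exact (sub_eq_zero.1 this).symm
  have hle : Submodule.span ℂ {graphVec e u.2 (Fin.cons 1 u.1)} ≤
      LinearMap.range (graphVec e u.2) := by
    rw [Submodule.span_singleton_le_iff_mem]
    exact LinearMap.mem_range_self _ _
  { F3 := Submodule.span ℂ {graphVec e u.2 (Fin.cons 1 u.1)}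
    F2 := LinearMap.range (graphVec e u.2)
    F1 := S.form.orthogonal (Submodule.span ℂ {graphVec e u.2 (Fin.cons 1 u.1)})
    F3_le_F2 := hle
    F2_le_F1 := hF2.le.trans (LinearMap.BilinForm.orthogonal_le hle)
    finrank_F3 := finrank_span_singleton hne
    finrank_F2 := by
      rw [LinearMap.finrank_range_of_inj (graphVec_injective e u.2)]; simp
    finrank_F1 := by
      have := S.finiteDimensional
      rw [LinearMap.BilinForm.finrank_orthogonal S.nondeg, finrank_span_singleton hne, S.dim]
      omega
    F1_eq := rfl
    F2_eq := hF2 }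

theorem CompactDual.ext' {S : SymplecticForm V h} {F F' : S.CompactDual} (h3 : F.F3 = F'.F3)
    (h2 : F.F2 = F'.F2) : F = F' :=
  CompactDual.ext h3 h2 (by rw [F.F1_eq, F'.F1_eq, h3])

/-- The transition between two charts: `T` is the linear change of symplectic coordinates. -/
theorem dualParam_eq_iff (e e' : S.Frame) (u u' : (Fin h → ℂ) × (Sym2 (Fin (h + 1)) → ℂ)) :
    S.dualParam e' u' = S.dualParam e u ↔
      (∀ a, (e'.coord (graphVec e u.2 a)).2 =
        symOp (h + 1) u'.2 (e'.coord (graphVec e u.2 a)).1) ∧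
      ∃ c : ℂ, c ≠ 0 ∧
        (e'.coord (graphVec e u.2 (Fin.cons 1 u.1))).1 = c • Fin.cons 1 u'.1 := by
  constructor
  · intro he
    have h2 : LinearMap.range (graphVec e' u'.2) = LinearMap.range (graphVec e u.2) :=
      congrArg CompactDual.F2 he
    have h3 : Submodule.span ℂ {graphVec e' u'.2 (Fin.cons 1 u'.1)} =
      Submodule.span ℂ {graphVec e u.2 (Fin.cons 1 u.1)} := congrArg CompactDual.F3 he
    refine ⟨fun a => ?_, ?_⟩
    · obtain ⟨b, hb⟩ := h2.ge ⟨a, rfl⟩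
      rw [← hb, coord_graphVec]
    · obtain ⟨c, hc⟩ := Submodule.mem_span_singleton.1
        (h3.ge (Submodule.mem_span_singleton_self _))
      refine ⟨c, ?_, ?_⟩
      · rintro rfl
        rw [zero_smul] at hc
        have := congrFun (graphVec_injective e u.2 (hc.symm.trans (map_zero _).symm)) 0
        simp at this
      · rw [← hc, map_smul, coord_graphVec]; rfl
  · rintro ⟨hg, c, hc, hx⟩
    have key : ∀ a, graphVec e u.2 a = graphVec e' u'.2 (e'.coord (graphVec e u.2 a)).1 :=
      fun a => e'.coord.injective (by rw [coord_graphVec, ← hg])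
    have := S.finiteDimensional
    refine CompactDual.ext' ?_ ?_
    · change Submodule.span ℂ {graphVec e' u'.2 (Fin.cons 1 u'.1)} =
        Submodule.span ℂ {graphVec e u.2 (Fin.cons 1 u.1)}
      rw [key, hx, map_smul]
      exact (Submodule.span_singleton_smul_eq (IsUnit.mk0 c hc) _).symm
    · symm
      refine Submodule.eq_of_le_of_finrank_eq ?_ ?_
      · rintro _ ⟨a, rfl⟩
        exact ⟨_, (key a).symm⟩
      · rw [CompactDual.finrank_F2, CompactDual.finrank_F2]

/-- Every flag is the origin of one of the charts. -/
theorem exists_frame (F : S.CompactDual) : ∃ e : S.Frame, S.dualParam e 0 = F := by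
  have := S.finiteDimensional
  obtain ⟨z, hz, hz0⟩ : ∃ z ∈ F.F3, z ≠ 0 := by
    refine Submodule.exists_mem_ne_zero_of_ne_bot fun hb => ?_
    have := F.finrank_F3
    rw [hb, finrank_bot] at this
    omega
  have hspan : Submodule.span ℂ {z} = F.F3 := by
    refine Submodule.eq_of_le_of_finrank_eq ?_ ?_
    · rwa [Submodule.span_singleton_le_iff_mem]
    · rw [finrank_span_singleton hz0, F.finrank_F3]
  obtain ⟨ε, hε⟩ := exists_linearEquiv_map_eq (W := F.F2) (W' := Fin (h + 1) → ℂ)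
    (by rw [F.finrank_F2]; simp) (w := ⟨z, F.F3_le_F2 hz⟩) (by simpa using hz0)
    (w' := Fin.cons 1 0) (fun h0 => by simpa using congrFun h0 0)
  let U : (Fin (h + 1) → ℂ) →ₗ[ℂ] V := F.F2.subtype ∘ₗ ε.symm.toLinearMap
  have hUr : LinearMap.range U = F.F2 := by
    simp [U, LinearMap.range_comp]
  have hUi : Function.Injective U := by
    intro a b hab
    exact ε.symm.injective (Subtype.ext hab)
  have hU0 : U (Fin.cons 1 0) = z := by
    have : ε.symm (Fin.cons 1 0) = ⟨z, F.F3_le_F2 hz⟩ := by rw [← hε, ε.symm_apply_apply]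
    simp [U, this]
  have hUU : ∀ a b, S.form (U a) (U b) = 0 := by
    intro a b
    have hb : U b ∈ S.form.orthogonal F.F2 := by
      rw [← F.F2_eq, ← hUr]; exact ⟨b, rfl⟩
    exact (LinearMap.BilinForm.mem_orthogonal_iff.1 hb) (U a) (by rw [← hUr]; exact ⟨a, rfl⟩)
  have hskew : ∀ v w, S.form v w = - S.form w v := fun v w => by
    rw [S.alt.neg_eq]
  -- pairing with `F²`
  let p : V →ₗ[ℂ] (Fin (h + 1) → ℂ) := LinearMap.pi fun i => S.form (U (Pi.single i 1))
  have hp : ∀ a v, S.form (U a) v = ∑ i, a i * p v i := by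
    intro a v
    have ha : a = ∑ j, a j • Pi.single j (1 : ℂ) := by
      ext k; simp [Finset.sum_apply, Pi.single_apply]
    conv_lhs => rw [ha]
    simp [p]
  have hps : Function.Surjective p := by
    rw [← LinearMap.range_eq_top]
    refine Submodule.eq_top_of_finrank_eq ?_
    have h1 := LinearMap.finrank_range_add_finrank_ker p
    have h2 : LinearMap.ker p = F.F2 := by
      ext v
      conv_rhs => rw [F.F2_eq]
      rw [LinearMap.BilinForm.mem_orthogonal_iff, LinearMap.mem_ker]
      constructor
      · intro h0 n hn
        rw [← hUr] at hn
        obtain ⟨a, rfl⟩ := hn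
        rw [hp, h0]
        simp
      · intro hv
        ext i
        exact hv (U (Pi.single i 1)) (by rw [← hUr]; exact ⟨_, rfl⟩)
    rw [h2, F.finrank_F2, S.dim] at h1
    simp
    omega
  obtain ⟨w, hw⟩ := p.exists_rightInverse_of_surjective (LinearMap.range_eq_top.2 hps)
  have hw' : ∀ b, p (w b) = b := fun b => LinearMap.congr_fun hw b
  let K : (Fin (h + 1) → ℂ) →ₗ[ℂ] (Fin (h + 1) → ℂ) :=
    LinearMap.pi fun i => (-(1 / 2 : ℂ)) • (S.form.flip (w (Pi.single i 1)) ∘ₗ w)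
  have hK : ∀ b b', ∑ i, K b i * b' i = -(1 / 2) * S.form (w b) (w b') := by
    intro b b'
    have hb : b' = ∑ j, b' j • Pi.single j (1 : ℂ) := by
      ext k; simp [Finset.sum_apply, Pi.single_apply]
    conv_rhs => rw [hb]
    simp only [K, map_sum, map_smul, LinearMap.pi_apply, LinearMap.smul_apply,
      LinearMap.comp_apply, smul_eq_mul, Finset.mul_sum]
    refine Finset.sum_congr rfl fun i _ => ?_
    change -(1 / 2) * S.form (w b) (w (Pi.single i 1)) * b' i = _
    ring
  let w1 : (Fin (h + 1) → ℂ) →ₗ[ℂ] V := w + U ∘ₗ K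
  have hw1p : ∀ b, p (w1 b) = b := by
    intro b
    have : p (U (K b)) = 0 := by ext i; exact hUU _ _
    simp [w1, hw', this]
  have hw1 : ∀ b b', S.form (w1 b) (w1 b') = 0 := by
    intro b b'
    have h1 : S.form (w b) (U (K b')) = (1 / 2) * S.form (w b') (w b) := by
      rw [hskew, hp, hw', hK]; ring
    have h2 : S.form (U (K b)) (w b') = -(1 / 2) * S.form (w b) (w b') := by
      rw [hp, hw', hK]
    simp only [w1, LinearMap.add_apply, LinearMap.comp_apply, map_add, hUU, h1, h2]
    rw [hskew (w b') (w b)]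
    ring
  let Ψ : (Fin (h + 1) → ℂ) × (Fin (h + 1) → ℂ) →ₗ[ℂ] V := U.coprod w1
  have hΨ : ∀ q q', S.form (Ψ q) (Ψ q') = ∑ i, (q.1 i * q'.2 i - q.2 i * q'.1 i) := by
    intro q q'
    simp only [Ψ, LinearMap.coprod_apply, map_add, LinearMap.add_apply, hUU, hw1, hp, hw1p,
      hskew (w1 q.2) (U q'.1), Finset.sum_sub_distrib]
    simp only [mul_comm]
    ring
  have hinj : Function.Injective Ψ := by
    rw [← LinearMap.ker_eq_bot, LinearMap.ker_eq_bot']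
    intro q hq
    ext i
    · have := hΨ q (0, Pi.single i 1)
      rw [hq] at this
      simpa [Pi.single_apply] using this.symm
    · have := hΨ q (Pi.single i 1, 0)
      rw [hq] at this
      simpa [Pi.single_apply] using this.symm
  let E := LinearEquiv.ofInjectiveOfFinrankEq Ψ hinj (by rw [S.dim]; simp; omega)
  have hE : ∀ q, E q = Ψ q := fun q => rfl
  let e : S.Frame := ⟨E.symm, fun v v' => by
    rw [← hΨ, ← hE, ← hE, E.apply_symm_apply, E.apply_symm_apply]⟩
  have hgr : graphVec e 0 = U := by
    ext a
    simp [graphVec, e, hE, Ψ]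
  refine ⟨e, CompactDual.ext' ?_ ?_⟩
  · change Submodule.span ℂ {graphVec e 0 (Fin.cons 1 0)} = F.F3
    rw [hgr, hU0, hspan]
  · change LinearMap.range (graphVec e 0) = F.F2
    rw [hgr, hUr]

/-- The standard holomorphic atlas of `Ď`. -/
noncomputable def dualAtlas :
    HolAtlas S.Frame ((Fin h → ℂ) × (Sym2 (Fin (h + 1)) → ℂ)) S.CompactDual where
  φ := S.dualParam
  inj e u u' huu := by
    obtain ⟨hg, c, hc, hx⟩ := (S.dualParam_eq_iff e e u' u).1 huu
    simp only [coord_graphVec] at hg hx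
    have h1 : c = 1 := by simpa using (congrFun hx 0).symm
    have h2 : u'.1 = u.1 := by
      rw [h1, one_smul] at hx
      ext i
      simpa using congrFun hx i.succ
    refine Prod.ext h2.symm ?_
    ext q
    induction q using Sym2.ind with
    | _ i j =>
      have := congrFun (hg (Pi.single j 1)) i
      simpa [symOp_apply, Pi.single_apply] using this.symm
  cover F := by
    obtain ⟨e, he⟩ := S.exists_frame F
    exact ⟨e, 0, he⟩
  compat e e' u := by
    rintro ⟨w, hw⟩
    obtain ⟨hg, c, hc, hx⟩ := (S.dualParam_eq_iff e e' u w).1 hw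
    let X := Fin (h + 1) → ℂ
    let T : X × X →L[ℂ] X × X :=
      LinearMap.toContinuousLinearMap (e'.coord.toLinearMap ∘ₗ e.coord.symm.toLinearMap)
    let G : (Sym2 (Fin (h + 1)) → ℂ) →L[ℂ] X →L[ℂ] X :=
      LinearMap.toContinuousLinearMap (symOp (h + 1))
    -- `N` and `C` are the two components of the transformed graph
    let N : (Fin h → ℂ) × (Sym2 (Fin (h + 1)) → ℂ) → X →L[ℂ] X := fun u =>
      (ContinuousLinearMap.fst ℂ X X ∘L T) ∘L (ContinuousLinearMap.inl ℂ X X +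
        ContinuousLinearMap.inr ℂ X X ∘L G u.2)
    let C : (Fin h → ℂ) × (Sym2 (Fin (h + 1)) → ℂ) → X →L[ℂ] X := fun u =>
      (ContinuousLinearMap.snd ℂ X X ∘L T) ∘L (ContinuousLinearMap.inl ℂ X X +
        ContinuousLinearMap.inr ℂ X X ∘L G u.2)
    have hNC : ∀ u a, e'.coord (graphVec e u.2 a) = (N u a, C u a) := by
      intro u a
      have : ((a, symOp (h + 1) u.2 a) : X × X) = (a, 0) + (0, symOp (h + 1) u.2 a) := by simp
      have h1 := congrArg (fun q => e'.coord (e.coord.symm q)) this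
      simp only [map_add] at h1
      simp only [coord_symm_graphVec, h1]
      simp [N, C, T, G]
      rfl
    have hN : ContDiff ℂ ω N := by fun_prop
    have hC : ContDiff ℂ ω C := by fun_prop
    simp only [hNC] at hg hx
    have hNinj : Function.Injective (N u) := by
      intro a b hab
      refine graphVec_injective e u.2 (e'.coord.injective ?_)
      rw [hNC, hNC, hg, hg, hab]
    obtain ⟨Ne, hNe⟩ : ∃ Ne : X ≃L[ℂ] X, (Ne : X →L[ℂ] X) = N u :=
      ⟨(LinearEquiv.ofInjectiveEndo (N u).toLinearMap hNinj).toContinuousLinearEquiv, by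
        ext a; rfl⟩
    let A : (Fin h → ℂ) × (Sym2 (Fin (h + 1)) → ℂ) → X := fun u => N u (Fin.cons 1 u.1)
    have hcons : ContDiff ℂ ω fun u : (Fin h → ℂ) × (Sym2 (Fin (h + 1)) → ℂ) =>
        (Fin.cons 1 u.1 : X) := by
      rw [contDiff_pi]
      intro i
      refine Fin.cases ?_ (fun j => ?_) i
      · simpa using contDiff_const
      · simp only [Fin.cons_succ]; fun_prop
    have hA : ContDiff ℂ ω A := hN.clm_apply hcons
    have hA0 : A u 0 ≠ 0 := by
      have := congrFun hx 0
      simp only [Pi.smul_apply, Fin.cons_zero, smul_eq_mul, mul_one] at this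
      exact this.trans_ne hc
    let R : (Fin h → ℂ) × (Sym2 (Fin (h + 1)) → ℂ) → X →L[ℂ] X := fun u =>
      C u ∘L (N u).inverse
    have hR : ContDiffAt ℂ ω R u := by
      refine hC.contDiffAt.clm_comp ?_
      refine ContDiffAt.comp (g := ContinuousLinearMap.inverse) u ?_ hN.contDiffAt
      rw [← hNe]
      exact contDiffAt_map_inverse Ne
    refine ⟨fun u => (fun i => (A u 0)⁻¹ * A u i.succ,
      fun q => R u (Pi.single (Quot.out q).2 1) (Quot.out q).1), ?_, ?_⟩
    · refine ContDiffAt.prodMk ?_ ?_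
      · rw [contDiffAt_pi]
        intro i
        exact ((contDiff_pi.1 hA 0).contDiffAt.inv hA0).mul (contDiff_pi.1 hA _).contDiffAt
      · rw [contDiffAt_pi]
        intro q
        exact contDiffAt_pi.1 (hR.clm_apply contDiffAt_const) _
    · have ev1 : ∀ᶠ u' in 𝓝 u, A u' 0 ≠ 0 :=
        (contDiff_pi.1 hA 0).continuous.continuousAt.eventually_ne hA0
      have ev2 : ∀ᶠ u' in 𝓝 u, N u' ∈ range ((↑) : (X ≃L[ℂ] X) → X →L[ℂ] X) := by
        refine hN.continuous.continuousAt.eventually ?_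
        rw [← hNe]
        exact ContinuousLinearEquiv.nhds Ne
      filter_upwards [ev1, ev2] with v h1 h2
      obtain ⟨M, hM⟩ := h2
      have hRN : ∀ a, R v (N v a) = C v a := by
        intro a
        simp only [R, ← hM, ContinuousLinearMap.inverse_equiv, ContinuousLinearMap.comp_apply,
          ContinuousLinearEquiv.coe_coe, ContinuousLinearEquiv.symm_apply_apply]
      have hiso : ∀ a b, ∑ i, (N v a i * C v b i - C v a i * N v b i) = 0 := by
        intro a b
        have := e'.form_eq (graphVec e v.2 a) (graphVec e v.2 b)
        rw [hNC, hNC] at this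
        rw [← this, form_graphVec, coord_graphVec]
        simp
      have hsym : ∀ a b, ∑ i, a i * R v b i = ∑ i, R v a i * b i := by
        intro a b
        obtain ⟨a, rfl⟩ : ∃ a', N v a' = a := ⟨M.symm a, by rw [← hM]; simp⟩
        obtain ⟨b, rfl⟩ : ∃ b', N v b' = b := ⟨M.symm b, by rw [← hM]; simp⟩
        rw [hRN, hRN, ← sub_eq_zero, ← Finset.sum_sub_distrib, hiso]
      refine (S.dualParam_eq_iff e e' v _).2 ⟨fun a => ?_, A v 0, h1, ?_⟩
      · rw [hNC, symOp_surj _ _ hsym, hRN]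
      · rw [hNC]
        ext i
        refine Fin.cases ?_ (fun j => ?_) i
        · simp [A]
        · simp [A] at h1 ⊢
          field_simp

noncomputable instance : TopologicalSpace S.CompactDual :=
  S.dualAtlas.core.toTopologicalSpace

noncomputable instance :
    ChartedSpace ((Fin h → ℂ) × (Sym2 (Fin (h + 1)) → ℂ)) S.CompactDual :=
  S.dualAtlas.core.toChartedSpace

instance : IsManifold 𝓘(ℂ, (Fin h → ℂ) × (Sym2 (Fin (h + 1)) → ℂ)) ω S.CompactDual :=
  S.dualAtlas.isManifold

end SymplecticForm

end CompactDual
section Complexification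

/-- The complexification `H_ℂ = ℂ ⊗ H` of a rational vector space. -/
def Complexification (H : Type*) [AddCommGroup H] [Module ℚ H] : Type _ := ℂ ⊗[ℚ] H

variable {H : Type*} [AddCommGroup H] [Module ℚ H]

noncomputable instance : AddCommGroup (Complexification H) :=
  inferInstanceAs (AddCommGroup (ℂ ⊗[ℚ] H))

noncomputable instance : Module ℂ (Complexification H) :=
  inferInstanceAs (Module ℂ (ℂ ⊗[ℚ] H))

theorem rTensor_conj_smul (c : ℂ) (v : ℂ ⊗[ℚ] H) :
    LinearMap.rTensor H (Complex.conjAe.toLinearMap.restrictScalars ℚ) (c • v) =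
      (starRingEnd ℂ) c • LinearMap.rTensor H (Complex.conjAe.toLinearMap.restrictScalars ℚ) v := by
  induction v using TensorProduct.induction_on with
  | zero => simp
  | tmul z v => simp [TensorProduct.smul_tmul']
  | add v w hv hw => rw [smul_add, map_add, hv, hw, map_add, smul_add]

/-- Complex conjugation on `H_ℂ`, namely `z ⊗ v ↦ z̄ ⊗ v`. -/
noncomputable def Complexification.conj :
    Complexification H →ₛₗ[starRingEnd ℂ] Complexification H where
  toFun := LinearMap.rTensor H (Complex.conjAe.toLinearMap.restrictScalars ℚ)
  map_add' := map_add _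
  map_smul' := rTensor_conj_smul

variable [FiniteDimensional ℚ H]

instance : FiniteDimensional ℂ (Complexification H) :=
  inferInstanceAs (FiniteDimensional ℂ (ℂ ⊗[ℚ] H))

/-- A norm on the finite-dimensional space `H_ℂ`, namely the sup norm in some basis; only the
topology that it induces, which is independent of the choice, matters below. -/
noncomputable instance : NormedAddCommGroup (Complexification H) :=
  NormedAddCommGroup.induced (Complexification H) (Fin (finrank ℂ (Complexification H)) → ℂ)
    (finBasis ℂ (Complexification H)).equivFun (LinearEquiv.injective _)

noncomputable instance : NormedSpace ℂ (Complexification H) :=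
  NormedSpace.induced ℂ (Complexification H) (Fin (finrank ℂ (Complexification H)) → ℂ)
    (finBasis ℂ (Complexification H)).equivFun

/-- A nondegenerate alternating rational form on a rational vector space of dimension `2h + 2`. -/
structure PolarizationForm (H : Type*) [AddCommGroup H] [Module ℚ H] (h : ℕ) where
  form : LinearMap.BilinForm ℚ H
  alt : form.IsAlt
  nondeg : form.Nondegenerate
  dim : finrank ℚ H = 2 * h + 2

/-- The complex bilinear extension of the form to `H_ℂ`. -/
noncomputable def PolarizationForm.complexify {h : ℕ} (Q : PolarizationForm H h) :
    SymplecticForm (Complexification H) h where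
  form := LinearMap.BilinForm.baseChange ℂ Q.form
  alt v := by
    have key : ∀ v w : ℂ ⊗[ℚ] H, LinearMap.BilinForm.baseChange ℂ Q.form v w =
        - LinearMap.BilinForm.baseChange ℂ Q.form w v := by
      intro v w
      induction v using TensorProduct.induction_on with
      | zero => simp
      | add v v' h1 h2 => rw [map_add, LinearMap.add_apply, h1, h2, map_add, neg_add]
      | tmul z a =>
        induction w using TensorProduct.induction_on with
        | zero => simp
        | add w w' h1 h2 => rw [map_add, h1, h2, map_add, LinearMap.add_apply, neg_add]
        | tmul z' b =>
          rw [LinearMap.BilinForm.baseChange_tmul, LinearMap.BilinForm.baseChange_tmul,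
            ← Q.alt.neg_eq b a, neg_smul, mul_comm]
    have := key v v
    exact self_eq_neg.1 this
  nondeg := by
    classical
    let b := finBasis ℚ H
    have hb := (LinearMap.BilinForm.nondegenerate_iff_det_ne_zero (B := Q.form) b).1 Q.nondeg
    refine (LinearMap.BilinForm.nondegenerate_iff_det_ne_zero
      (Algebra.TensorProduct.basis ℂ b)).2 ?_
    have : LinearMap.BilinForm.toMatrix (Algebra.TensorProduct.basis ℂ b)
        (LinearMap.BilinForm.baseChange ℂ Q.form) =
        (LinearMap.BilinForm.toMatrix b Q.form).map (algebraMap ℚ ℂ) := by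
      ext i j
      simp [LinearMap.BilinForm.toMatrix_apply, LinearMap.BilinForm.baseChange_tmul]
    erw [this]
    rw [← RingHom.mapMatrix_apply, ← RingHom.map_det]
    simpa using hb
  dim := (finrank_baseChange (R := ℂ) (S := ℚ) (M' := H)).trans Q.dim

variable {h : ℕ} (Q : PolarizationForm H h)

/-- The Hodge filtration `F⁰ = H_ℂ ⊇ F¹ ⊇ F² ⊇ F³ ⊇ F⁴ = 0`. -/
def SymplecticForm.CompactDual.filtration {V : Type*} [AddCommGroup V] [Module ℂ V] {h : ℕ}
    {S : SymplecticForm V h} (F : S.CompactDual) : ℕ → Submodule ℂ V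
  | 0 => ⊤
  | 1 => F.F1
  | 2 => F.F2
  | 3 => F.F3
  | _ => ⊥

/-- `H^{p,q} = Fᵖ ∩ conj F^q`, for `p + q = 3`. -/
noncomputable def PolarizationForm.hodge (F : Q.complexify.CompactDual) (p : ℕ) :
    Submodule ℂ (Complexification H) :=
  F.filtration p ⊓ (F.filtration (3 - p)).comap Complexification.conj

/-- The period domain `D ⊆ Ď`: the flags with `Fᵖ ⊕ conj F^{4-p} = H_ℂ` for which
`Q(C u, conj u) > 0` for all `u ≠ 0`, where the Weil operator `C` acts on `H^{p,q}` as
multiplication by `i^{p-q}`. -/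
def PolarizationForm.periodDomain : Set Q.complexify.CompactDual :=
  {F | (∀ p ≤ 4, IsCompl (F.filtration p)
      ((F.filtration (4 - p)).comap Complexification.conj)) ∧
    ∀ u : Fin 4 → Complexification H, (∀ p : Fin 4, u p ∈ Q.hodge F p) → ∑ p, u p ≠ 0 →
      ∃ r : ℝ, 0 < r ∧ Q.complexify.form 
        (∑ p : Fin 4, Complex.I ^ (2 * ((p : ℕ) : ℤ) - 3) • u p)
        (Complexification.conj (∑ p, u p)) = r}

end Complexification
section EDS

variable {E M E' M' : Type*} [NormedAddCommGroup E] [NormedSpace ℂ E] [TopologicalSpace M]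
  [ChartedSpace E M] [NormedAddCommGroup E'] [NormedSpace ℂ E'] [TopologicalSpace M']
  [ChartedSpace E' M']

variable (E M) in
/-- A differential 1-form of type (1,0), not necessarily continuous. -/
abbrev OneForm : Type _ := ∀ x : M, TangentSpace 𝓘(ℂ, E) x →L[ℂ] ℂ

variable (E M) in
/-- A field of subspaces `I_x ⊆ T_x^* M` of the cotangent spaces. -/
abbrev CotangentField : Type _ := ∀ x : M, Submodule ℂ (TangentSpace 𝓘(ℂ, E) x →L[ℂ] ℂ)

/-- The annihilator `L^⊥ ⊆ T_x^* M` of a subspace `L ⊆ T_x M`. -/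
def annihilator {x : M} (L : Submodule ℂ (TangentSpace 𝓘(ℂ, E) x)) :
    Submodule ℂ (TangentSpace 𝓘(ℂ, E) x →L[ℂ] ℂ) where
  carrier := {α | ∀ v ∈ L, α v = 0}
  zero_mem' _ _ := rfl
  add_mem' {α β} ha hb v hv := by simp [ha v hv, hb v hv]
  smul_mem' c α ha v hv := by simp [ha v hv]

/-- The expression of the 1-form `θ` in the preferred chart at `x`, that is, its pullback to the
model space by the inverse of the chart. -/
noncomputable def OneForm.inChart (θ : OneForm E M) (x : M) (u : E) : E →L[ℂ] ℂ :=
  (θ ((extChartAt 𝓘(ℂ, E) x).symm u)).comp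
    (mfderiv 𝓘(ℂ, E) 𝓘(ℂ, E) (extChartAt 𝓘(ℂ, E) x).symm u)

/-- `θ` is holomorphic in a neighbourhood of `x`. -/
def OneForm.HolomorphicAt (θ : OneForm E M) (x : M) : Prop :=
  AnalyticAt ℂ (θ.inChart x) (extChartAt 𝓘(ℂ, E) x x)

/-- The value at `x` of the exterior derivative `dθ`, computed in the preferred chart at `x`
(through which `T_x M` is identified with the model space `E`). -/
noncomputable def OneForm.d (θ : OneForm E M) (x : M) (v w : TangentSpace 𝓘(ℂ, E) x) : ℂ :=
  extDeriv (fun u => ContinuousAlternatingMap.ofSubsingleton ℂ E ℂ (0 : Fin 1) (θ.inChart x u))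
    (extChartAt 𝓘(ℂ, E) x x) ![(v : E), (w : E)]

/-- `I` is a Pfaffian system of rank `r`, i.e. a holomorphic sub-bundle of `T^* M`. -/
def IsPfaffianSystem (I : CotangentField E M) (r : ℕ) : Prop :=
  ∀ x, ∃ θ : Fin r → OneForm E M, (∀ i, (θ i).HolomorphicAt x) ∧
    ∀ᶠ y in 𝓝 x, LinearIndependent ℂ (fun i => θ i y) ∧
      I y = Submodule.span ℂ (range fun i => θ i y)

/-- `I` is a contact system on the manifold `M` of dimension `2k + 1`: it is locally generated by a
holomorphic 1-form `θ` with `θ ∧ (dθ)^k ≠ 0`, i.e. `θ ≠ 0` and `dθ` is nondegenerate on `ker θ`. -/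
def IsContactSystem (I : CotangentField E M) (k : ℕ) : Prop :=
  finrank ℂ E = 2 * k + 1 ∧ ∀ x, ∃ θ : OneForm E M, θ.HolomorphicAt x ∧
    (∀ᶠ y in 𝓝 x, I y = Submodule.span ℂ {θ y}) ∧ θ x ≠ 0 ∧
    ∀ v, θ x v = 0 → (∀ w, θ x w = 0 → θ.d x v w = 0) → v = 0

variable (E M) in
/-- A point `(x, L)` of the Grassmann bundles of `T M`: a point `x` of `M` and a subspace
`L ⊆ T_x M`. -/
structure TangentPlane where
  base : M
  plane : Submodule ℂ (TangentSpace 𝓘(ℂ, E) base)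

/-- The subspace `L ⊆ T_x M`, in the preferred chart at `x`. -/
def TangentPlane.coordPlane (g : TangentPlane E M) : Submodule ℂ E := g.plane

/-- Local coordinates on the bundle of `p`-planes near `g = (x, L)`, for a complement `K` of `L`:
`(u, A)` corresponds to the point `y` with coordinate `u` in the preferred chart at `x` and to the
subspace of `T_y M` that this chart maps to the graph of `A : L → K`. The point `g` itself has
coordinates `(u, A) = (u(x), 0)`. -/
noncomputable def TangentPlane.param (g : TangentPlane E M) (K : Submodule ℂ E)
    (q : E × (g.coordPlane →L[ℂ] K)) : TangentPlane E M where
  base := (extChartAt 𝓘(ℂ, E) g.base).symm q.1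
  plane := Submodule.map
    (mfderiv 𝓘(ℂ, E) 𝓘(ℂ, E) (extChartAt 𝓘(ℂ, E) g.base).symm q.1).toLinearMap
    (LinearMap.range (g.coordPlane.subtype + K.subtype ∘ₗ q.2.toLinearMap))

/-- The coordinates of `g` in the local coordinates centred at `g`. -/
noncomputable def TangentPlane.center (g : TangentPlane E M) (K : Submodule ℂ E) :
    E × (g.coordPlane →L[ℂ] K) :=
  (extChartAt 𝓘(ℂ, E) g.base g.base, 0)

/-- `L ⊆ T_x M` is an integral element of the differential ideal generated by the local holomorphic
sections `θ` of `I` and their exterior derivatives `dθ`. -/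
def IsIntegralElement (I : CotangentField E M) (g : TangentPlane E M) : Prop :=
  ∀ θ : OneForm E M, θ.HolomorphicAt g.base → (∀ᶠ y in 𝓝 g.base, θ y ∈ I y) →
    (∀ v ∈ g.plane, θ g.base v = 0) ∧ ∀ v ∈ g.plane, ∀ w ∈ g.plane, θ.d g.base v w = 0

/-- The variety `G_p(I)` of `p`-dimensional integral elements of `I`. -/
def integralElements (I : CotangentField E M) (p : ℕ) : Set (TangentPlane E M) :=
  {g | finrank ℂ g.plane = p ∧ IsIntegralElement I g}

/-- Near the point `a`, the subset `X` of the normed space `W` is a complex submanifold: some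
holomorphic change of coordinates maps it to a linear subspace. -/
def IsSubmanifoldAt {W : Type*} [NormedAddCommGroup W] [NormedSpace ℂ W] (X : Set W) (a : W) :
    Prop :=
  ∃ (Ψ : OpenPartialHomeomorph W W) (L : Submodule ℂ W), a ∈ Ψ.source ∧
    ContDiffOn ℂ ω Ψ Ψ.source ∧ ContDiffOn ℂ ω Ψ.symm Ψ.target ∧
    ∀ y ∈ Ψ.source, y ∈ X ↔ Ψ y ∈ L

/-- The smooth locus of a subset `X` of a Grassmann bundle. -/
def smoothLocus (X : Set (TangentPlane E M)) : Set (TangentPlane E M) :=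
  {g | g ∈ X ∧ ∃ K, IsCompl g.coordPlane K ∧ IsSubmanifoldAt (g.param K ⁻¹' X) (g.center K)}

/-- The pullback by `Φ : M' → G_p(TM)` of the canonical Pfaffian system `J` with
`J_{(x, L)} = π^*(L^⊥)`, where `π(x, L) = x`. -/
noncomputable def pullbackCanonical (Φ : M' → TangentPlane E M) : CotangentField E' M' := fun m =>
  Submodule.map
    ({ toFun := fun α => α.comp (mfderiv 𝓘(ℂ, E') 𝓘(ℂ, E) (fun m => (Φ m).base) m)
       map_add' := fun _ _ => rfl
       map_smul' := fun _ _ => rfl } :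
      (TangentSpace 𝓘(ℂ, E) (Φ m).base →L[ℂ] ℂ) →ₗ[ℂ] (TangentSpace 𝓘(ℂ, E') m →L[ℂ] ℂ))
    (annihilator (Φ m).plane)

/-- `Φ : M' → G_p(TM)` identifies `(M', I')` with the first prolongation of `(M, I)`, taken with
respect to `p`-dimensional integral elements: `Φ` is a biholomorphic map of `M'` onto the smooth
locus of `G_p(I)`, and `I'` corresponds to the restriction of the canonical system `J`. -/
structure IsFirstProlongation (p : ℕ) (I : CotangentField E M) (I' : CotangentField E' M')
    (Φ : M' → TangentPlane E M) : Prop where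
  injective : Function.Injective Φ
  range_eq : range Φ = smoothLocus (integralElements I p)
  /-- In local coordinates, `Φ` is a holomorphic immersion `γ` which is open onto `G_p(I)`. -/
  biholomorphic : ∀ m, ∃ K, IsCompl (Φ m).coordPlane K ∧
    ∃ γ : M' → E × ((Φ m).coordPlane →L[ℂ] K),
      γ m = (Φ m).center K ∧ (∀ᶠ m' in 𝓝 m, (Φ m).param K (γ m') = Φ m') ∧
      ContMDiffAt 𝓘(ℂ, E') 𝓘(ℂ, E × ((Φ m).coordPlane →L[ℂ] K)) ω γ m ∧
      Function.Injective (mfderiv 𝓘(ℂ, E') 𝓘(ℂ, E × ((Φ m).coordPlane →L[ℂ] K)) γ m) ∧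
      ∀ N ∈ 𝓝 m, ∀ᶠ q in 𝓝 (γ m), (Φ m).param K q ∈ integralElements I p →
        (Φ m).param K q ∈ Φ '' N
  system_eq : I' = pullbackCanonical Φ

/-- An integral manifold of the Pfaffian system `I`: a holomorphic immersion `f : N → M` with
`f^* θ = 0` for all `θ ∈ I`. -/
def IsIntegralManifold {E N : Type*} {E' M : Type*} [NormedAddCommGroup E] [NormedSpace ℂ E]
    [TopologicalSpace N] [ChartedSpace E N] [NormedAddCommGroup E'] [NormedSpace ℂ E']
    [TopologicalSpace M] [ChartedSpace E' M] (I : CotangentField E' M) (f : N → M) : Prop :=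
  ContMDiff 𝓘(ℂ, E) 𝓘(ℂ, E') ω f ∧
    ∀ n, Function.Injective (mfderiv 𝓘(ℂ, E) 𝓘(ℂ, E') f n) ∧
      ∀ α ∈ I (f n), α.comp (mfderiv 𝓘(ℂ, E) 𝓘(ℂ, E') f n) = 0

/-- The canonical lift `n ↦ (f n, f_* T_n N)` of an immersion `f : N → M`. -/
noncomputable def canonicalLift (f : M' → M) (n : M') : TangentPlane E M where
  base := f n
  plane := LinearMap.range (mfderiv 𝓘(ℂ, E') 𝓘(ℂ, E) f n).toLinearMap

end EDS

section Systems

/-- The model space of `ℙ(V)`, for `dim V = 2h + 2`. -/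
abbrev ProjModel (h : ℕ) : Type := Fin (2 * h + 1) → ℂ

/-- The model space of `Ď`. -/
abbrev DualModel (h : ℕ) : Type := (Fin h → ℂ) × (Sym2 (Fin (h + 1)) → ℂ)

variable {E M V : Type*} [NormedAddCommGroup E] [NormedSpace ℂ E] [TopologicalSpace M]
  [ChartedSpace E M] [NormedAddCommGroup V] [NormedSpace ℂ V] {h : ℕ}

variable (E) in
/-- `σ : M → V` is, near `x`, a holomorphic section of the family of subspaces `W_y ⊆ V`. -/
def IsSectionAt (W : M → Submodule ℂ V) (σ : M → V) (x : M) : Prop :=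
  ContMDiffAt 𝓘(ℂ, E) 𝓘(ℂ, V) ω σ x ∧ ∀ᶠ y in 𝓝 x, σ y ∈ W y

variable (E) in
/-- The differential at `x` of a vector-valued function. -/
noncomputable def vectorDeriv (σ : M → V) (x : M) : TangentSpace 𝓘(ℂ, E) x →L[ℂ] V :=
  mfderiv 𝓘(ℂ, E) 𝓘(ℂ, V) σ x

namespace SymplecticForm

variable (S : SymplecticForm V h)

/-- The line of `V` given by a point of `ℙ(V)`. -/
noncomputable def line (x : S.Proj) : Submodule ℂ V := Projectivization.submodule x

/-- The canonical contact system on `ℙ(V)`, generated by the 1-forms `Q(dz, z)` for the local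
holomorphic sections `z` of the tautological line bundle. -/
noncomputable def contactSystem : CotangentField (ProjModel h) S.Proj := fun x =>
  Submodule.span ℂ {α | ∃ z : S.Proj → V, IsSectionAt (ProjModel h) S.line z x ∧
    ∀ v, α v = S.form (vectorDeriv (ProjModel h) z x v) (z x)}

/-- The horizontal space `W_F ⊆ T_F Ď`, given by `dFᵖ ⊆ F^{p-1}`: for every local holomorphic
section `σ` of the tautological bundle `Fᵖ`, the derivatives `dσ(v)` belong to `F^{p-1}`. -/
noncomputable def horizontal (F : S.CompactDual) : Submodule ℂ (TangentSpace 𝓘(ℂ, DualModel h) F) where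
  carrier := {v | ∀ p, ∀ σ : S.CompactDual → V,
    IsSectionAt (DualModel h) (fun F' : S.CompactDual => F'.filtration (p + 1)) σ F →
      vectorDeriv (DualModel h) σ F v ∈ F.filtration p}
  zero_mem' p σ _ := by rw [map_zero]; exact Submodule.zero_mem _
  add_mem' hv hw p σ hσ := by rw [map_add]; exact Submodule.add_mem _ (hv p σ hσ) (hw p σ hσ)
  smul_mem' c v hv p σ hσ := by rw [map_smul]; exact Submodule.smul_mem _ c (hv p σ hσ)

/-- The infinitesimal period relation `I = W^⊥` on `Ď`. -/
noncomputable def periodRelation : CotangentField (DualModel h) S.CompactDual := fun F =>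
  annihilator (S.horizontal F)

/-- The map `π : Ď → ℙ(V)`, `F ↦ F³`. -/
noncomputable def lineMap (F : S.CompactDual) : S.Proj :=
  Projectivization.mk'' F.F3 F.finrank_F3

/-- The canonical map from `Ď` to the Grassmann bundle of `T ℙ(V)`. It sends `F` to the point
`ℓ = F³` of `ℙ(V)` with the subspace of `T_ℓ ℙ(V) ≅ Hom(ℓ, V / ℓ)` that corresponds to
`Hom(F³, F² / F³)`: the vectors `v` such that `dz(v) ∈ F²` for the local holomorphic sections `z`
of the tautological line bundle. -/
noncomputable def planeMap (F : S.CompactDual) : TangentPlane (ProjModel h) S.Proj where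
  base := S.lineMap F
  plane :=
    { carrier := {v | ∀ z : S.Proj → V, IsSectionAt (ProjModel h) S.line z (S.lineMap F) →
        vectorDeriv (ProjModel h) z (S.lineMap F) v ∈ F.F2}
      zero_mem' := fun z _ => by rw [map_zero]; exact Submodule.zero_mem _
      add_mem' := fun hv hw z hz => by
        rw [map_add]; exact Submodule.add_mem _ (hv z hz) (hw z hz)
      smul_mem' := fun c v hv z hz => by
        rw [map_smul]; exact Submodule.smul_mem _ c (hv z hz) }

/-- `f : N → Ď` is of Calabi–Yau type: at each `n`, the map
`T_n N → Hom(H^{3,0}, H^{2,1}) = Hom(F³, F² / F³)` given by the derivative of `F³` is an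
isomorphism. With a local holomorphic generator `σ` of the line bundle `F³`, this map is
`v ↦ (σ ↦ dσ(f_* v) mod F³)`. -/
def IsCalabiYauType {S : SymplecticForm V h} (f : M → S.CompactDual) : Prop :=
  ∀ n, ∃ σ : S.CompactDual → V,
    IsSectionAt (DualModel h) (fun F : S.CompactDual => F.F3) σ (f n) ∧ σ (f n) ≠ 0 ∧
    let δ : TangentSpace 𝓘(ℂ, E) n →ₗ[ℂ] V ⧸ (f n).F3 := (f n).F3.mkQ ∘ₗ
      (vectorDeriv (DualModel h) σ (f n)).toLinearMap ∘ₗ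
        (mfderiv 𝓘(ℂ, E) 𝓘(ℂ, DualModel h) f n).toLinearMap
    Function.Injective δ ∧ LinearMap.range δ = Submodule.map (f n).F3.mkQ (f n).F2

/-- The flags in general position with respect to symplectic coordinates `(a, b)`: the coordinates
`a` are independent on `F²`, and `a₀` does not vanish on `F³`. -/
def bigCell {S : SymplecticForm V h} (e : S.Frame) : Set S.CompactDual :=
  {F | (∀ v ∈ F.F2, (e.coord v).1 = 0 → v = 0) ∧ ∀ v ∈ F.F3, (e.coord v).1 0 = 0 → v = 0}

/-- The vector `z_g(x)` with symplectic coordinates `a = (1, x)` and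
`b = (2 g - ∑ xᵢ ∂ᵢg, ∂₁g, …, ∂ₕg)`. -/
noncomputable def legendreVector {S : SymplecticForm V h} (e : S.Frame) (g : (Fin h → ℂ) → ℂ)
    (x : Fin h → ℂ) : V :=
  e.coord.symm (Fin.cons 1 x,
    Fin.cons (2 * g x - ∑ i, x i * fderiv ℂ g x (Pi.single i 1))
      (fun i => fderiv ℂ g x (Pi.single i 1)))

/-- `F³ = ℂ z_g(x)` and `F² = span {z_g(x), ∂₁ z_g(x), …, ∂ₕ z_g(x)}`. -/
def IsLegendreFlag {S : SymplecticForm V h} (e : S.Frame) (g : (Fin h → ℂ) → ℂ)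
    (x : Fin h → ℂ) (F : S.CompactDual) : Prop :=
  F.F3 = Submodule.span ℂ {legendreVector e g x} ∧
    F.F2 = Submodule.span ℂ ({legendreVector e g x} ∪
      range fun i => fderiv ℂ (legendreVector e g) x (Pi.single i 1))

end SymplecticForm

end Systems

/-! ### Holomorphic parametrizations of ℙ(V) and Ď, and the inverse function theorem -/

section Parametrizations

variable {E M V : Type*} [NormedAddCommGroup E] [NormedSpace ℂ E] [TopologicalSpace M]
  [ChartedSpace E M] [NormedAddCommGroup V] [NormedSpace ℂ V]

/-! Everything reduces to linear algebra at a point of ℙ(V). A point of Ď is a line ℓ = F³ inside a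
Lagrangian subspace Λ = F²; F¹ = ℓ^⊥ is then forced. Under T_ℓ ℙ(V) = Hom(ℓ, V/ℓ) the contact
hyperplane is Hom(ℓ, ℓ^⊥/ℓ), and on it dθ is a nonzero multiple of the form induced by Q. An
h-dimensional integral element is therefore an isotropic subspace of dimension h + 1 containing ℓ,
that is, a Lagrangian Λ ⊇ ℓ (`isIntegralElement_iff`, `range_planeMap`), so Ď → G_h(C) is a
bijection.

To see that G_h(C) is smooth everywhere and that this bijection is biholomorphic,
`exists_prolongation_coordinates` describes the Grassmann bundle near a given element by jets ((x,
b), A), in which integrality becomes a system of isotropy equations. Their solutions are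
parametrized by symmetric matrices through `paramJet`, which has the polynomial left inverse
`jetParam`; and the image of a holomorphic map with a holomorphic left inverse is a submanifold
(`isSubmanifoldAt_of_leftInverse`).

As for the systems, in a chart where F² = {b = s a} and F³ is spanned by a = (1, x), the condition
dF³ ⊆ F² reads δs (1, x) = 0, and the symmetry of δs then gives dF² ⊆ F¹ for free
(`mem_horizontal_iff`). So the horizontal space is the preimage under dπ of the plane Hom(F³,
F²/F³), and because dπ is onto, its annihilator is the pullback of the annihilator of the plane.

The statements on integral manifolds are mediated by one condition, `IsLiftAt`: d(π ∘ f) is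
injective with image the plane of f n. It is a reformulation of Calabi–Yau type and already forces f
to be integral for I; it also says that π ∘ f is integral for C with canonical lift f. Hence π ∘ f
determines f. Conversely, on an integral manifold of C the equation Q(dz, z) = 0 differentiates to
Q(dz, dz) = 0, so the tangent spaces are integral elements and a pointwise lift to Ď exists; it is
holomorphic by the following normal form.

Normalize a lift z = (a, b) to V by a₀ = 1, take x = (a₁, …, aₕ) and g = ½ ∑ aᵢ bᵢ. Then Q(dz, z) =
0 gives dg = ∑ bᵢ dxᵢ over i ≥ 1, so bᵢ = ∂ᵢg, and the definition of g returns b₀ = 2g - ∑ xᵢ ∂ᵢg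
(`exists_potential`). The general position of the flag is what makes x a coordinate system. In the
other direction, quadratic functions g realize every flag of the big cell.

Finally, the Hodge components are orthogonal for Q(v, conj w), so membership in D amounts to
definiteness of i Q(v, conj v) on F³ and on H^{2,1} (`mem_periodDomain_iff`), which is an open
condition by compactness of the unit sphere. -/

/-- A globally defined holomorphic parametrization `φ : E → M`, namely the inverse of a chart in the
maximal atlas whose image is all of `E`. -/
structure HolParam (E M : Type*) [NormedAddCommGroup E] [NormedSpace ℂ E] [TopologicalSpace M]
    [ChartedSpace E M] where
  chart : OpenPartialHomeomorph M E
  mem : chart ∈ IsManifold.maximalAtlas 𝓘(ℂ, E) ω M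
  target : chart.target = univ

namespace HolParam

variable (p : HolParam E M)

instance : CoeFun (HolParam E M) fun _ => E → M := ⟨fun p => p.chart.symm⟩

theorem chart_apply (u : E) : p.chart (p u) = u := p.chart.right_inv (by rw [p.target]; trivial)

theorem mem_source (u : E) : p u ∈ p.chart.source :=
  p.chart.map_target (by rw [p.target]; trivial)

theorem apply_chart {m : M} (hm : m ∈ p.chart.source) : p (p.chart m) = m := p.chart.left_inv hm

theorem eventually_apply_chart (u : E) : ∀ᶠ m in 𝓝 (p u), p (p.chart m) = m := by
  filter_upwards [p.chart.open_source.mem_nhds (p.mem_source u)] with m hm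
  exact p.apply_chart hm

theorem continuous : Continuous p := by
  have := p.chart.continuousOn_symm
  rwa [p.target, continuousOn_univ] at this

/-- A parametrization is a homeomorphism onto an open set, so statements about germs on `M` can be
moved to the model space, where ordinary Fréchet derivatives are available. -/
theorem eventually_iff (u : E) {q : M → Prop} :
    (∀ᶠ m in 𝓝 (p u), q m) ↔ ∀ᶠ u' in 𝓝 u, q (p u') := by
  refine ⟨fun h => p.continuous.continuousAt.eventually h, fun h => ?_⟩
  have h1 : ContinuousAt p.chart (p u) := p.chart.continuousAt (p.mem_source u)
  have h2 : Tendsto p.chart (𝓝 (p u)) (𝓝 u) := by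
    have := h1.tendsto
    rwa [p.chart_apply] at this
  filter_upwards [h2.eventually h, p.eventually_apply_chart u] with m hm hm'
  rwa [hm'] at hm

theorem contMDiffAt (u : E) : ContMDiffAt 𝓘(ℂ, E) 𝓘(ℂ, E) ω p u :=
  contMDiffAt_symm_of_mem_maximalAtlas p.mem (by rw [p.target]; trivial)

theorem mdifferentiableAt (u : E) : MDifferentiableAt 𝓘(ℂ, E) 𝓘(ℂ, E) p u :=
  (p.contMDiffAt u).mdifferentiableAt (by simp)

theorem contMDiffAt_chart {m : M} (hm : m ∈ p.chart.source) :
    ContMDiffAt 𝓘(ℂ, E) 𝓘(ℂ, E) ω p.chart m :=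
  contMDiffAt_of_mem_maximalAtlas p.mem hm

theorem mdifferentiableAt_chart {m : M} (hm : m ∈ p.chart.source) :
    MDifferentiableAt 𝓘(ℂ, E) 𝓘(ℂ, E) p.chart m :=
  (p.contMDiffAt_chart hm).mdifferentiableAt (by simp)

theorem mfderiv_chart_comp (u : E) : (mfderiv 𝓘(ℂ, E) 𝓘(ℂ, E) p.chart (p u)).comp
    (mfderiv 𝓘(ℂ, E) 𝓘(ℂ, E) p u) = ContinuousLinearMap.id ℂ (TangentSpace 𝓘(ℂ, E) u) := by
  rw [← mfderiv_comp u (p.mdifferentiableAt_chart (p.mem_source u)) (p.mdifferentiableAt u),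
    ← mfderiv_id]
  congr 1
  ext v
  exact p.chart_apply v

theorem mfderiv_comp_chart (u : E) : (mfderiv 𝓘(ℂ, E) 𝓘(ℂ, E) p u).comp
    (mfderiv 𝓘(ℂ, E) 𝓘(ℂ, E) p.chart (p u)) =
      ContinuousLinearMap.id ℂ (TangentSpace 𝓘(ℂ, E) (p u)) := by
  have h1 := p.mdifferentiableAt_chart (p.mem_source u)
  have h2 := p.mdifferentiableAt u
  have h3 : HasMFDerivAt 𝓘(ℂ, E) 𝓘(ℂ, E) p (p.chart (p u)) (mfderiv 𝓘(ℂ, E) 𝓘(ℂ, E) p u) := by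
    have := h2.hasMFDerivAt
    rwa [p.chart_apply]
  have h4 := (h3.comp (p u) h1.hasMFDerivAt).congr_of_eventuallyEq (f₁ := id)
    ((p.eventually_apply_chart u).mono fun m hm => hm.symm)
  rw [← mfderiv_id]
  exact h4.mfderiv.symm

theorem mfderiv_chart_apply (u : E) (v : E) : mfderiv 𝓘(ℂ, E) 𝓘(ℂ, E) p.chart (p u)
    (mfderiv 𝓘(ℂ, E) 𝓘(ℂ, E) p u v) = v :=
  DFunLike.congr_fun (p.mfderiv_chart_comp u) v

theorem mfderiv_apply_chart (u : E) (v : TangentSpace 𝓘(ℂ, E) (p u)) :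
    mfderiv 𝓘(ℂ, E) 𝓘(ℂ, E) p u (mfderiv 𝓘(ℂ, E) 𝓘(ℂ, E) p.chart (p u) v) = v :=
  DFunLike.congr_fun (p.mfderiv_comp_chart u) v

/-- The derivative of a parametrization, as a linear equivalence. -/
noncomputable def tangentEquiv (u : E) : E ≃ₗ[ℂ] TangentSpace 𝓘(ℂ, E) (p u) where
  toFun := mfderiv 𝓘(ℂ, E) 𝓘(ℂ, E) p u
  map_add' := map_add (mfderiv 𝓘(ℂ, E) 𝓘(ℂ, E) p u)
  map_smul' := map_smul (mfderiv 𝓘(ℂ, E) 𝓘(ℂ, E) p u)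
  invFun := mfderiv 𝓘(ℂ, E) 𝓘(ℂ, E) p.chart (p u)
  left_inv := p.mfderiv_chart_apply u
  right_inv := p.mfderiv_apply_chart u

theorem contMDiffAt_comp_iff {σ : M → V} (u : E) :
    ContMDiffAt 𝓘(ℂ, E) 𝓘(ℂ, V) ω σ (p u) ↔ ContDiffAt ℂ ω (fun u => σ (p u)) u := by
  rw [← contMDiffAt_iff_contDiffAt]
  refine ⟨fun h => h.comp u (p.contMDiffAt u), fun h => ?_⟩
  have h1 := p.contMDiffAt_chart (p.mem_source u)
  have h' : ContMDiffAt 𝓘(ℂ, E) 𝓘(ℂ, V) ω (fun u => σ (p u)) (p.chart (p u)) := by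
    rwa [p.chart_apply]
  refine (ContMDiffAt.comp (p u) h' h1).congr_of_eventuallyEq ?_
  filter_upwards [p.eventually_apply_chart u] with m hm
  simp [Function.comp, hm]

theorem vectorDeriv_apply {σ : M → V} {u : E} (hσ : ContMDiffAt 𝓘(ℂ, E) 𝓘(ℂ, V) ω σ (p u))
    (v : E) : vectorDeriv E σ (p u) (p.tangentEquiv u v) = fderiv ℂ (fun u => σ (p u)) u v := by
  have := mfderiv_comp u (hσ.mdifferentiableAt (by simp)) (p.mdifferentiableAt u)
  have h2 := DFunLike.congr_fun this v
  rw [← mfderiv_eq_fderiv]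
  exact h2.symm

end HolParam

namespace HolAtlas

variable {ι X : Type*} (A : HolAtlas ι E X)

/-- The charts of a holomorphic atlas belong to the maximal atlas. -/
noncomputable def param (i : ι) :
    letI := A.core.toTopologicalSpace
    letI := A.core.toChartedSpace
    HolParam E X :=
  letI := A.core.toTopologicalSpace
  letI := A.core.toChartedSpace
  haveI := A.isManifold
  { chart := A.core.openPartialHomeomorph (A.chart i) (mem_range_self i)
    mem := IsManifold.subset_maximalAtlas (mem_iUnion.2 ⟨A.chart i, mem_iUnion.2 ⟨mem_range_self i, rfl⟩⟩)
    target := rfl }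

end HolAtlas

namespace SymplecticForm
variable {W : Type*} [AddCommGroup W] [Module ℂ W] {h : ℕ} (S : SymplecticForm W h)

/-- The affine parametrization of `ℙ(V)` given by linear coordinates. -/
noncomputable def projP (e : W ≃ₗ[ℂ] ℂ × (Fin (2 * h + 1) → ℂ)) :
    HolParam (Fin (2 * h + 1) → ℂ) S.Proj := S.projAtlas.param e

theorem projP_apply (e : W ≃ₗ[ℂ] ℂ × (Fin (2 * h + 1) → ℂ)) (u : Fin (2 * h + 1) → ℂ) :
    S.projP e u = S.projParam e u := rfl

/-- The affine parametrization of `Ď` given by symplectic coordinates. -/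
noncomputable def dualP (e : S.Frame) : HolParam (DualModel h) S.CompactDual :=
  S.dualAtlas.param e

theorem dualP_apply (e : S.Frame) (u : DualModel h) : S.dualP e u = S.dualParam e u := rfl

/-- Exterior derivatives and coordinates on the Grassmann bundle are defined through preferred
charts. These are affine charts by construction, so explicit formulas apply to them. -/
theorem exists_projP_eq_chartAt (x : S.Proj) : ∃ e,
    chartAt (Fin (2 * h + 1) → ℂ) x = (S.projP e).chart := ⟨_, rfl⟩

theorem exists_dualP_eq_chartAt (x : S.CompactDual) : ∃ e,
    chartAt (DualModel h) x = (S.dualP e).chart := ⟨_, rfl⟩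

theorem mem_dualP_source (e : S.Frame) (F : S.CompactDual) :
    F ∈ (S.dualP e).chart.source ↔ ∃ u, S.dualParam e u = F := Iff.rfl

theorem mem_projP_source (e : W ≃ₗ[ℂ] ℂ × (Fin (2 * h + 1) → ℂ)) (x : S.Proj) :
    x ∈ (S.projP e).chart.source ↔ ∃ u, S.projParam e u = x := Iff.rfl

end SymplecticForm

namespace HolParam

variable {p : HolParam E M} {x : M}

theorem extChartAt_eq (hp : chartAt E x = p.chart) :
    (extChartAt 𝓘(ℂ, E) x : M → E) = p.chart := by
  simp [extChartAt, hp]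

theorem extChartAt_symm_eq (hp : chartAt E x = p.chart) :
    ((extChartAt 𝓘(ℂ, E) x).symm : E → M) = p := by
  simp [extChartAt, hp]

theorem apply_chart_of_eq (hp : chartAt E x = p.chart) : p (p.chart x) = x :=
  p.apply_chart (by rw [← hp]; exact mem_chart_source E x)

end HolParam

/-- The inverse function theorem, with the domain shrunk to points where `f` is analytic with
invertible derivative, so that both directions are holomorphic throughout and not just at `a`. -/
theorem exists_openPartialHomeomorph_of_bijective [CompleteSpace E] {E' : Type*}
    [NormedAddCommGroup E']
    [NormedSpace ℂ E'] [CompleteSpace E'] {f : E → E'} {a : E} (hf : ContDiffAt ℂ ω f a)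
    (hb : Function.Bijective (fderiv ℂ f a)) :
    ∃ Ψ : OpenPartialHomeomorph E E', a ∈ Ψ.source ∧ (Ψ : E → E') = f ∧
      ContDiffOn ℂ ω Ψ Ψ.source ∧ ContDiffOn ℂ ω Ψ.symm Ψ.target := by
  have hd := hf.differentiableAt (by simp)
  let f' : E ≃L[ℂ] E' := ContinuousLinearEquiv.ofBijective (fderiv ℂ f a)
    (LinearMap.ker_eq_bot.2 hb.1) (LinearMap.range_eq_top.2 hb.2)
  have hf' : HasFDerivAt f (f' : E →L[ℂ] E') a := hd.hasFDerivAt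
  let Ψ := hf.toOpenPartialHomeomorph f hf' (by simp)
  have hev : ∀ᶠ y in 𝓝 a, ContDiffAt ℂ ω f y ∧
      fderiv ℂ f y ∈ range ((↑) : (E ≃L[ℂ] E') → E →L[ℂ] E') := by
    refine (hf.eventually (by simp)).and ?_
    have h1 : ContinuousAt (fderiv ℂ f) a := (hf.fderiv_right (m := 0) (by simp)).continuousAt
    refine h1.eventually ?_
    rw [hf'.fderiv]
    exact ContinuousLinearEquiv.nhds f'
  obtain ⟨s, hs, ho, ha⟩ := eventually_nhds_iff.1 hev
  refine ⟨Ψ.restrOpen s ho, ⟨hf.mem_toOpenPartialHomeomorph_source hf' (by simp), ha⟩, rfl, ?_, ?_⟩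
  · intro y hy
    exact (hs y hy.2).1.contDiffWithinAt
  · intro y hy
    have hy' := (Ψ.restrOpen s ho).map_target hy
    obtain ⟨g, hg⟩ := (hs _ hy'.2).2
    refine ((Ψ.restrOpen s ho).contDiffAt_symm (f₀' := g) hy ?_ (hs _ hy'.2).1).contDiffWithinAt
    rw [hg]
    exact ((hs _ hy'.2).1.differentiableAt (by simp)).hasFDerivAt

end Parametrizations

/-! ### Symmetric matrices, isotropic jets and symplectic frames -/

section LinearAlgebra

variable {V : Type*} [NormedAddCommGroup V] [NormedSpace ℂ V] {h : ℕ}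

theorem eq_sum_smul_single {n : ℕ} (a : Fin n → ℂ) : a = ∑ j, a j • Pi.single j (1 : ℂ) := by
  ext k
  simp [Finset.sum_apply, Pi.single_apply]

/-- A symmetric matrix, as a function on unordered pairs. -/
noncomputable def symOfMatrix {n : ℕ} (M : Fin n → Fin n → ℂ) : Sym2 (Fin n) → ℂ :=
  fun q => M (Quot.out q).1 (Quot.out q).2

theorem symOfMatrix_mk {n : ℕ} {M : Fin n → Fin n → ℂ} (hM : ∀ i j, M i j = M j i) (i j : Fin n) :
    symOfMatrix M s(i, j) = M i j := by
  have : Sym2.mk (Quot.out s(i, j)).1 (Quot.out s(i, j)).2 = s(i, j) := Quot.out_eq s(i, j)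
  unfold symOfMatrix
  rcases Sym2.eq_iff.1 this with ⟨h1, h2⟩ | ⟨h1, h2⟩
  · rw [h1, h2]
  · rw [h1, h2, hM]

theorem symOfMatrix_sym {n : ℕ} (s : Sym2 (Fin n) → ℂ) :
    symOfMatrix (fun i j => s s(i, j)) = s := by
  ext q
  induction q using Sym2.ind with
  | _ i j => rw [symOfMatrix_mk fun i j => by rw [Sym2.eq_swap]]

theorem symOp_symOfMatrix {n : ℕ} {M : Fin n → Fin n → ℂ} (hM : ∀ i j, M i j = M j i)
    (a : Fin n → ℂ) (i : Fin n) : symOp n (symOfMatrix M) a i = ∑ j, M i j * a j := by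
  simp [symOp_apply, symOfMatrix_mk hM]

/-- The inclusion `a ↦ (0, a)`. -/
noncomputable def consZero (h : ℕ) : (Fin h → ℂ) →L[ℂ] (Fin (h + 1) → ℂ) :=
  ContinuousLinearMap.pi
    (Fin.cases 0 fun i => ContinuousLinearMap.proj (R := ℂ) (φ := fun _ : Fin h => ℂ) i)

@[simp]
theorem consZero_apply (a : Fin h → ℂ) : consZero h a = Fin.cons 0 a := by
  ext i
  refine Fin.cases ?_ (fun i => ?_) i <;> simp [consZero]

/-- The space of the data `((x, b), A)`: a vector with coordinates `((1, x), b)` and a tangent space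
with coordinates `((0, a), A a)`. -/
abbrev JetSpace (h : ℕ) : Type :=
  ((Fin h → ℂ) × (Fin (h + 1) → ℂ)) × ((Fin h → ℂ) →L[ℂ] (Fin (h + 1) → ℂ))

/-- The vector `((1, x), b)` together with the vectors `((0, a), A a)` span an isotropic subspace. -/
def IsIsotropicJet (q : JetSpace h) : Prop :=
  (∀ a, ∑ i, (Fin.cons 1 q.1.1 : Fin (h + 1) → ℂ) i * q.2 a i = ∑ i, q.1.2 (Fin.succ i) * a i) ∧
    ∀ a a', ∑ i, a' i * q.2 a (Fin.succ i) = ∑ i, q.2 a' (Fin.succ i) * a i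

/-- The matrix of the symmetric operator with graph the isotropic subspace given by a jet. -/
noncomputable def jetMatrix (q : JetSpace h) (i j : Fin (h + 1)) : ℂ :=
  Fin.cases (motive := fun _ => ℂ)
    (Fin.cases (motive := fun _ => ℂ)
      (q.1.2 0 - ∑ k, q.2 (Pi.single k 1) 0 * q.1.1 k) (fun i' => q.2 (Pi.single i' 1) 0) i)
    (fun j' => q.2 (Pi.single j' 1) i) j

/-- The point of the affine chart of `Ď` determined by a jet. -/
noncomputable def jetParam (q : JetSpace h) : DualModel h := (q.1.1, symOfMatrix (jetMatrix q))

/-- The jet determined by a point of the affine chart of `Ď`. -/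
noncomputable def paramJet (u : DualModel h) : JetSpace h :=
  ((u.1, symOp (h + 1) u.2 (Fin.cons 1 u.1)), (symOp (h + 1) u.2).comp (consZero h))

/-- Both equations are instances of the symmetry of `s`: pairing (1, x) with (0, a), and (0, a')
with (0, a). -/
theorem isIsotropicJet_paramJet (u : DualModel h) : IsIsotropicJet (paramJet u) := by
  constructor
  · intro a
    simp only [paramJet, ContinuousLinearMap.comp_apply, consZero_apply]
    rw [symOp_symm, Fin.sum_univ_succ]
    simp
  · intro a a'
    have := symOp_symm (h + 1) u.2 (Fin.cons 0 a') (Fin.cons 0 a)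
    rw [Fin.sum_univ_succ, Fin.sum_univ_succ] at this
    simpa [paramJet] using this

/-- The columns of `s` other than the first are the values of A on basis vectors, the rest of the
first column follows by symmetry, and the corner is solved from b₀ = s₀₀ + ∑ s₀ₖ xₖ. -/
theorem jetMatrix_paramJet (u : DualModel h) (i j : Fin (h + 1)) :
    jetMatrix (paramJet u) i j = u.2 s(i, j) := by
  have key : ∀ k i, (paramJet u).2 (Pi.single k 1) i = u.2 s(i, Fin.succ k) := by
    intro k i
    simp only [paramJet, ContinuousLinearMap.comp_apply, consZero_apply, symOp_apply]
    rw [Fin.sum_univ_succ]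
    simp [Pi.single_apply]
  refine Fin.cases ?_ (fun j => ?_) j
  · refine Fin.cases ?_ (fun i => ?_) i
    · simp only [jetMatrix, Fin.cases_zero, key]
      simp only [paramJet, symOp_apply, Fin.sum_univ_succ]
      simp
    · simp only [jetMatrix, Fin.cases_zero, Fin.cases_succ, key]
      rw [Sym2.eq_swap]
  · simp only [jetMatrix, Fin.cases_succ, key]

theorem jetParam_paramJet (u : DualModel h) : jetParam (paramJet u) = u := by
  refine Prod.ext rfl ?_
  change symOfMatrix (jetMatrix (paramJet u)) = u.2
  conv_rhs => rw [← symOfMatrix_sym u.2]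
  congr 1
  ext i j
  exact jetMatrix_paramJet u i j

theorem jetMatrix_symm {q : JetSpace h} (hq : IsIsotropicJet q) (i j : Fin (h + 1)) :
    jetMatrix q i j = jetMatrix q j i := by
  refine Fin.cases ?_ (fun j => ?_) j <;> refine Fin.cases ?_ (fun i => ?_) i
  · rfl
  · simp [jetMatrix]
  · simp [jetMatrix]
  · simpa [jetMatrix, Pi.single_apply] using hq.2 (Pi.single j 1) (Pi.single i 1)

/-- Isotropy says that b and A come from one symmetric operator: the second equation makes the
matrix symmetric, and the first recovers bᵢ for i ≥ 1; b₀ is right by the choice of the corner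
entry. -/
theorem paramJet_jetParam {q : JetSpace h} (hq : IsIsotropicJet q) :
    paramJet (jetParam q) = q := by
  refine Prod.ext (Prod.ext rfl ?_) ?_
  · ext i
    change symOp (h + 1) (symOfMatrix (jetMatrix q)) (Fin.cons 1 q.1.1) i = _
    rw [symOp_symOfMatrix (jetMatrix_symm hq), Fin.sum_univ_succ]
    refine Fin.cases ?_ (fun i => ?_) i
    · simp [jetMatrix]
    · have := hq.1 (Pi.single i 1)
      rw [Fin.sum_univ_succ] at this
      simp only [Fin.cons_zero, one_mul, Fin.cons_succ, Pi.single_apply, mul_ite, mul_one,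
        mul_zero, Finset.sum_ite_eq', Finset.mem_univ, if_true] at this
      simp only [jetMatrix, Fin.cases_zero, Fin.cases_succ, Fin.cons_zero, mul_one, Fin.cons_succ]
      rw [← this]
      congr 1
      refine Finset.sum_congr rfl fun j _ => ?_
      have h2 := hq.2 (Pi.single j 1) (Pi.single i 1)
      simp only [Pi.single_apply, ite_mul, one_mul, zero_mul, mul_ite, mul_one,
        mul_zero, Finset.sum_ite_eq', Finset.mem_univ, if_true] at h2
      rw [h2, mul_comm]
  · ext a i
    change symOp (h + 1) (symOfMatrix (jetMatrix q)) (consZero h a) i = q.2 a i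
    rw [symOp_symOfMatrix (jetMatrix_symm hq), Fin.sum_univ_succ, consZero_apply]
    conv_rhs => rw [eq_sum_smul_single a]
    simp [jetMatrix, mul_comm]

theorem contDiff_cons (c : ℂ) : ContDiff ℂ ω fun x : Fin h → ℂ => (Fin.cons c x : Fin (h + 1) → ℂ) := by
  rw [contDiff_pi]
  intro i
  refine Fin.cases ?_ (fun j => ?_) i
  · simpa using contDiff_const
  · simp only [Fin.cons_succ]; fun_prop

theorem contDiff_symOp (n : ℕ) : ContDiff ℂ ω (symOp n) :=
  (LinearMap.toContinuousLinearMap (symOp n)).contDiff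

/-- The formula is polynomial on all jets, isotropic or not. This lets `jetParam` serve as a left
inverse of `paramJet` on the whole ambient space. -/
theorem contDiff_jetParam : ContDiff ℂ ω (jetParam (h := h)) := by
  refine contDiff_fst.fst.prodMk ?_
  rw [contDiff_pi]
  intro q
  generalize hi : (Quot.out q).1 = i
  generalize hj : (Quot.out q).2 = j
  have hA : ∀ k i, ContDiff ℂ ω fun q : JetSpace h => q.2 (Pi.single k 1) i := fun k i =>
    contDiff_pi.1 (contDiff_snd.clm_apply contDiff_const) i
  simp only [symOfMatrix, hi, hj]
  refine Fin.cases ?_ (fun j => ?_) j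
  · refine Fin.cases ?_ (fun i => ?_) i
    · simp only [jetMatrix, Fin.cases_zero]
      refine ContDiff.sub (contDiff_pi.1 contDiff_fst.snd 0) (ContDiff.sum fun k _ => ?_)
      exact (hA k 0).mul (contDiff_pi.1 contDiff_fst.fst k)
    · simp only [jetMatrix, Fin.cases_zero, Fin.cases_succ]
      exact hA _ _
  · simp only [jetMatrix, Fin.cases_succ]
    exact hA _ _

theorem contDiff_paramJet : ContDiff ℂ ω (paramJet (h := h)) := by
  have h1 : ContDiff ℂ ω fun u : DualModel h => symOp (h + 1) u.2 :=
    (contDiff_symOp _).comp contDiff_snd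
  exact (contDiff_fst.prodMk (h1.clm_apply ((contDiff_cons 1).comp contDiff_fst))).prodMk
    (h1.clm_comp contDiff_const)

/-- The operator `s ↦ s (1, x)` on symmetric matrices is onto. -/
theorem exists_symOp_cons_eq (x : Fin h → ℂ) (b : Fin (h + 1) → ℂ) :
    ∃ s, symOp (h + 1) s (Fin.cons 1 x) = b := by
  -- Only the first row and column are nonzero. They carry b, with the corner lowered by ∑ bₖ xₖ to
  -- compensate what the first row contributes on x.
  let M : Fin (h + 1) → Fin (h + 1) → ℂ := fun i j =>
    Fin.cases (motive := fun _ => ℂ)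
      (Fin.cases (motive := fun _ => ℂ) (b 0 - ∑ k, b (Fin.succ k) * x k) (fun i' => b i'.succ) i)
      (fun j' => Fin.cases (motive := fun _ => ℂ) (b j'.succ) (fun _ => 0) i) j
  have hM : ∀ i j, M i j = M j i := by
    intro i j
    refine Fin.cases ?_ (fun j => ?_) j <;> refine Fin.cases ?_ (fun i => ?_) i <;> simp [M]
  refine ⟨symOfMatrix M, ?_⟩
  ext i
  rw [symOp_symOfMatrix hM, Fin.sum_univ_succ]
  refine Fin.cases ?_ (fun i => ?_) i <;> simp [M]

namespace SymplecticForm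

variable {S : SymplecticForm V h}

theorem form_self (S : SymplecticForm V h) (v : V) : S.form v v = 0 := S.alt v

theorem form_swap (S : SymplecticForm V h) (v w : V) : S.form v w = -S.form w v := by
  rw [S.alt.neg_eq]

theorem eq_zero_of_form (S : SymplecticForm V h) {v : V} (hv : ∀ w, S.form v w = 0) : v = 0 :=
  S.nondeg.1 v hv

theorem dualParam_F3 (e : S.Frame) (u : DualModel h) : (S.dualParam e u).F3 =
    Submodule.span ℂ {graphVec e u.2 (Fin.cons 1 u.1)} := rfl

theorem dualParam_F2 (e : S.Frame) (u : DualModel h) : (S.dualParam e u).F2 =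
    LinearMap.range (graphVec e u.2) := rfl

theorem mem_dualParam_F2 (e : S.Frame) (u : DualModel h) (v : V) :
    v ∈ (S.dualParam e u).F2 ↔ (e.coord v).2 = symOp (h + 1) u.2 (e.coord v).1 := by
  rw [dualParam_F2]
  constructor
  · rintro ⟨a, rfl⟩
    rw [coord_graphVec]
  · intro hv
    refine ⟨(e.coord v).1, e.coord.injective ?_⟩
    rw [coord_graphVec, ← hv]

theorem CompactDual.form_F2 (F : S.CompactDual) {v w : V} (hv : v ∈ F.F2) (hw : w ∈ F.F2) :
    S.form v w = 0 := by
  rw [F.F2_eq] at hw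
  exact LinearMap.BilinForm.mem_orthogonal_iff.1 hw v hv

theorem CompactDual.F3_eq_span (F : S.CompactDual) {z : V} (hz : z ∈ F.F3) (hz0 : z ≠ 0) :
    F.F3 = Submodule.span ℂ {z} := by
  have := S.finiteDimensional
  refine (Submodule.eq_of_le_of_finrank_eq ?_ ?_).symm
  · rwa [Submodule.span_singleton_le_iff_mem]
  · rw [finrank_span_singleton hz0, F.finrank_F3]

theorem CompactDual.exists_F3_eq_span (F : S.CompactDual) :
    ∃ z ≠ 0, F.F3 = Submodule.span ℂ {z} := by
  have := S.finiteDimensional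
  obtain ⟨z, hz, hz0⟩ : ∃ z ∈ F.F3, z ≠ 0 := by
    refine Submodule.exists_mem_ne_zero_of_ne_bot fun hb => ?_
    have := F.finrank_F3
    rw [hb, finrank_bot] at this
    omega
  exact ⟨z, hz0, F.F3_eq_span hz hz0⟩

/-- The flag given by a line in a Lagrangian subspace. -/
def flagOfLine (S : SymplecticForm V h) (z : V) (hz : z ≠ 0) (L : Submodule ℂ V) (hzL : z ∈ L)
    (hL : finrank ℂ L = h + 1) (hiso : ∀ v ∈ L, ∀ w ∈ L, S.form v w = 0) : S.CompactDual :=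
  have := S.finiteDimensional
  have hle : Submodule.span ℂ {z} ≤ L := by rwa [Submodule.span_singleton_le_iff_mem]
  have hL2 : L = S.form.orthogonal L := by
    refine Submodule.eq_of_le_of_finrank_eq ?_ ?_
    · intro w hw
      rw [LinearMap.BilinForm.mem_orthogonal_iff]
      exact fun v hv => hiso v hv w hw
    · rw [LinearMap.BilinForm.finrank_orthogonal S.nondeg, hL, S.dim]
      omega
  { F3 := Submodule.span ℂ {z}
    F2 := L
    F1 := S.form.orthogonal (Submodule.span ℂ {z})
    F3_le_F2 := hle
    F2_le_F1 := hL2.le.trans (LinearMap.BilinForm.orthogonal_le hle)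
    finrank_F3 := finrank_span_singleton hz
    finrank_F2 := hL
    finrank_F1 := by
      rw [LinearMap.BilinForm.finrank_orthogonal S.nondeg, finrank_span_singleton hz, S.dim]
      omega
    F1_eq := rfl
    F2_eq := hL2 }

/-- The flags in general position are those of the affine chart. -/
theorem mem_bigCell_iff (e : S.Frame) (F : S.CompactDual) :
    F ∈ bigCell e ↔ ∃ u, S.dualParam e u = F := by
  have := S.finiteDimensional
  constructor
  · rintro ⟨h2, h3⟩
    let p : F.F2 →ₗ[ℂ] (Fin (h + 1) → ℂ) :=
      LinearMap.fst ℂ _ _ ∘ₗ e.coord.toLinearMap ∘ₗ F.F2.subtype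
    have hp : Function.Injective p := by
      rw [← LinearMap.ker_eq_bot, LinearMap.ker_eq_bot']
      rintro ⟨v, hv⟩ hv0
      exact Subtype.ext (h2 v hv hv0)
    let pe : F.F2 ≃ₗ[ℂ] (Fin (h + 1) → ℂ) := LinearEquiv.ofInjectiveOfFinrankEq p hp
      (by rw [F.finrank_F2]; simp)
    have hpe : ∀ v : F.F2, pe v = (e.coord v).1 := fun v => rfl
    -- `R` is the operator whose graph is F². It is symmetric because F² is isotropic.
    let R : (Fin (h + 1) → ℂ) →L[ℂ] (Fin (h + 1) → ℂ) := LinearMap.toContinuousLinearMap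
      (LinearMap.snd ℂ _ _ ∘ₗ e.coord.toLinearMap ∘ₗ F.F2.subtype ∘ₗ pe.symm.toLinearMap)
    have hR : ∀ v : F.F2, R (e.coord v).1 = (e.coord v).2 := by
      intro v
      change (e.coord (pe.symm (pe v))).2 = _
      rw [pe.symm_apply_apply]
    have hsym : ∀ a b, ∑ i, a i * R b i = ∑ i, R a i * b i := by
      intro a b
      obtain ⟨v, rfl⟩ := pe.surjective a
      obtain ⟨w, rfl⟩ := pe.surjective b
      have := F.form_F2 v.2 w.2
      rw [e.form_eq, Finset.sum_sub_distrib, sub_eq_zero] at this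
      rw [hpe, hpe, hR, hR, this]
    obtain ⟨z, hz0, hz⟩ := F.exists_F3_eq_span
    have hzF : z ∈ F.F3 := by rw [hz]; exact Submodule.mem_span_singleton_self z
    have hc : (e.coord z).1 0 ≠ 0 := fun h0 => hz0 (h3 z hzF h0)
    refine ⟨(fun i => ((e.coord z).1 0)⁻¹ * (e.coord z).1 i.succ,
      fun q => R (Pi.single (Quot.out q).2 1) (Quot.out q).1), ?_⟩
    have hs := symOp_surj _ R hsym
    have hF2 : F.F2 ≤ LinearMap.range (graphVec e
        (fun q => R (Pi.single (Quot.out q).2 1) (Quot.out q).1)) := by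
      intro v hv
      refine ⟨(e.coord v).1, e.coord.injective ?_⟩
      rw [coord_graphVec, hs, hR ⟨v, hv⟩]
    refine CompactDual.ext' ?_ ?_
    · rw [dualParam_F3, hz]
      have : graphVec e (fun q => R (Pi.single (Quot.out q).2 1) (Quot.out q).1)
          (Fin.cons 1 fun i => ((e.coord z).1 0)⁻¹ * (e.coord z).1 i.succ) =
          ((e.coord z).1 0)⁻¹ • z := by
        obtain ⟨a, ha⟩ := hF2 (F.F3_le_F2 hzF)
        have ha' : a = (e.coord z).1 := by rw [← ha, coord_graphVec]
        rw [← ha, ← map_smul]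
        congr 1
        rw [ha, ha']
        ext i
        refine Fin.cases ?_ (fun i => ?_) i
        · simp [hc]
        · simp
      rw [this]
      exact Submodule.span_singleton_smul_eq (IsUnit.mk0 _ (inv_ne_zero hc)) z
    · rw [dualParam_F2]
      refine (Submodule.eq_of_le_of_finrank_eq hF2 ?_).symm
      rw [F.finrank_F2, LinearMap.finrank_range_of_inj (graphVec_injective e _)]
      simp
  · rintro ⟨u, rfl⟩
    constructor
    · rintro _ ⟨a, rfl⟩ ha
      rw [coord_graphVec] at ha
      simp only at ha
      rw [ha, map_zero]
    · intro v hv hv0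
      obtain ⟨c, rfl⟩ := Submodule.mem_span_singleton.1 hv
      rw [map_smul, coord_graphVec] at hv0
      have : c = 0 := by simpa using hv0
      rw [this, zero_smul]

theorem exists_frame_mem_bigCell (F : S.CompactDual) : ∃ e : S.Frame, F ∈ bigCell e := by
  obtain ⟨e, he⟩ := S.exists_frame F
  exact ⟨e, (mem_bigCell_iff e F).2 ⟨0, he⟩⟩

/-- A linear map to the standard symplectic space which preserves the form is a frame. -/
noncomputable def Frame.ofForm (f : V →ₗ[ℂ] (Fin (h + 1) → ℂ) × (Fin (h + 1) → ℂ))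
    (hf : ∀ v w, S.form v w = ∑ i, ((f v).1 i * (f w).2 i - (f v).2 i * (f w).1 i)) : S.Frame :=
  have := S.finiteDimensional
  { coord := LinearEquiv.ofInjectiveOfFinrankEq f
      (by
        rw [← LinearMap.ker_eq_bot, LinearMap.ker_eq_bot']
        intro v hv
        refine S.eq_zero_of_form fun w => ?_
        rw [hf, hv]
        simp)
      (by rw [S.dim]; simp; omega)
    form_eq := hf }

theorem Frame.coord_ofForm (f : V →ₗ[ℂ] (Fin (h + 1) → ℂ) × (Fin (h + 1) → ℂ))
    (hf : ∀ v w, S.form v w = ∑ i, ((f v).1 i * (f w).2 i - (f v).2 i * (f w).1 i)) (v : V) :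
    (Frame.ofForm f hf).coord v = f v := rfl

/-- Symplectic coordinates centred at a flag, with prescribed first coordinate. -/
theorem exists_frame_of_functional (F : S.CompactDual) (l : V →ₗ[ℂ] ℂ) {z : V} (hz : z ∈ F.F3)
    (hl : l z = 1) : ∃ c : S.Frame, S.dualParam c 0 = F ∧ c.coord z = (Fin.cons 1 0, 0) ∧
      ∀ v, (c.coord v).1 0 = l v := by
  obtain ⟨e, he⟩ := S.exists_frame F
  have hg0 : ∀ (c : S.Frame) a, graphVec c 0 a = c.coord.symm (a, 0) := fun c a => by
    rw [coord_symm_graphVec, map_zero]; rfl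
  obtain ⟨t, ht⟩ : ∃ t : ℂ, t • graphVec e 0 (Fin.cons 1 0) = z := by
    rw [← he] at hz
    exact Submodule.mem_span_singleton.1 hz
  -- Coefficients of l = ∑ λᵢ aᵢ + ∑ μᵢ bᵢ. Since z is t times the first basis vector, l z = 1 means
  -- t λ₀ = 1.
  let lam : Fin (h + 1) → ℂ := fun i => l (e.coord.symm (Pi.single i 1, 0))
  let mu : Fin (h + 1) → ℂ := fun i => l (e.coord.symm (0, Pi.single i 1))
  have hl' : ∀ v, l v = ∑ i, lam i * (e.coord v).1 i + ∑ i, mu i * (e.coord v).2 i := by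
    intro v
    have hv : v = ∑ i, (e.coord v).1 i • e.coord.symm (Pi.single i 1, 0) +
        ∑ i, (e.coord v).2 i • e.coord.symm (0, Pi.single i 1) := by
      apply e.coord.injective
      simp only [map_add, map_sum, map_smul, LinearEquiv.apply_symm_apply]
      refine Prod.ext ?_ ?_
      · simp only [Prod.fst_add, Prod.fst_sum, Prod.smul_fst, smul_zero, Finset.sum_const_zero,
          add_zero]
        exact eq_sum_smul_single _
      · simp only [Prod.snd_add, Prod.snd_sum, Prod.smul_snd, smul_zero, Finset.sum_const_zero,
          zero_add]
        exact eq_sum_smul_single _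
    conv_lhs => rw [hv]
    simp [lam, mu, mul_comm]
  have hcz : e.coord z = t • ((Fin.cons 1 0, 0) :
      (Fin (h + 1) → ℂ) × (Fin (h + 1) → ℂ)) := by
    rw [← ht, map_smul, hg0, LinearEquiv.apply_symm_apply]
  have htl : t * lam 0 = 1 := by
    rw [← hl, hl', hcz, Fin.sum_univ_succ]
    simp [mul_comm]
  let A : Fin (h + 1) → V →ₗ[ℂ] ℂ := fun i =>
    LinearMap.proj i ∘ₗ LinearMap.fst ℂ _ _ ∘ₗ e.coord.toLinearMap
  let B : Fin (h + 1) → V →ₗ[ℂ] ℂ := fun i =>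
    LinearMap.proj i ∘ₗ LinearMap.snd ℂ _ _ ∘ₗ e.coord.toLinearMap
  have hA : ∀ i v, A i v = (e.coord v).1 i := fun i v => rfl
  have hB : ∀ i v, B i v = (e.coord v).2 i := fun i v => rfl
  -- The new a₀ is `l`, its dual coordinate is t b₀, and adding multiples of b₀ to the other
  -- coordinates restores the form. All new b-coordinates are combinations of the old ones, so F² =
  -- {b = 0} is preserved.
  let f : V →ₗ[ℂ] (Fin (h + 1) → ℂ) × (Fin (h + 1) → ℂ) := LinearMap.prod
    (LinearMap.pi (Fin.cases l fun i => A i.succ + (t * mu i.succ) • B 0))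
    (LinearMap.pi (Fin.cases (t • B 0) fun i => B i.succ - (t * lam i.succ) • B 0))
  have f1 : ∀ v, (f v).1 0 = l v := fun v => rfl
  have f2 : ∀ v i, (f v).1 (Fin.succ i) = (e.coord v).1 i.succ + t * mu i.succ * (e.coord v).2 0 :=
    fun v i => rfl
  have f3 : ∀ v, (f v).2 0 = t * (e.coord v).2 0 := fun v => rfl
  have f4 : ∀ v i, (f v).2 (Fin.succ i) = (e.coord v).2 i.succ - t * lam i.succ * (e.coord v).2 0 :=
    fun v i => rfl
  have hf : ∀ v w, S.form v w = ∑ i, ((f v).1 i * (f w).2 i - (f v).2 i * (f w).1 i) := by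
    intro v w
    rw [e.form_eq, Fin.sum_univ_succ, Fin.sum_univ_succ]
    simp only [f1, f2, f3, f4, hl', Fin.sum_univ_succ]
    generalize e.coord v = v'
    generalize e.coord w = w'
    have h1 : ∀ i : Fin h, ((v'.1 i.succ + t * mu i.succ * v'.2 0) *
          (w'.2 i.succ - t * lam i.succ * w'.2 0) -
        (v'.2 i.succ - t * lam i.succ * v'.2 0) *
          (w'.1 i.succ + t * mu i.succ * w'.2 0)) =
        (v'.1 i.succ * w'.2 i.succ - v'.2 i.succ * w'.1 i.succ) -
        t * w'.2 0 * (lam i.succ * v'.1 i.succ) + t * v'.2 0 * (mu i.succ * w'.2 i.succ) +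
        t * v'.2 0 * (lam i.succ * w'.1 i.succ) - t * w'.2 0 * (mu i.succ * v'.2 i.succ) := by
      intro i; ring
    simp only [h1, Finset.sum_add_distrib, Finset.sum_sub_distrib, ← Finset.mul_sum]
    linear_combination (-(v'.1 0 * w'.2 0) + v'.2 0 * w'.1 0) * htl
  have hfz : f z = (Fin.cons 1 0, 0) := by
    refine Prod.ext ?_ ?_
    · ext i
      refine Fin.cases ?_ (fun i => ?_) i
      · rw [f1, hl]; rfl
      · rw [f2, hcz]; simp
    · ext i
      refine Fin.cases ?_ (fun i => ?_) i
      · rw [f3, hcz]; simp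
      · rw [f4, hcz]; simp
  refine ⟨Frame.ofForm f hf, ?_, hfz, fun v => rfl⟩
  have hz0 : z ≠ 0 := by
    rintro rfl
    simp at hl
  refine CompactDual.ext' ?_ ?_
  · rw [F.F3_eq_span hz hz0, dualParam_F3]
    congr 2
    apply (Frame.ofForm f hf).coord.injective
    rw [coord_graphVec, Frame.coord_ofForm, hfz]
    simp
  · have := S.finiteDimensional
    refine (Submodule.eq_of_le_of_finrank_eq ?_ ?_).symm
    · intro v hv
      rw [← he, mem_dualParam_F2] at hv
      have hv' : (e.coord v).2 = 0 := by simpa using hv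
      rw [mem_dualParam_F2]
      simp only [Prod.snd_zero, map_zero, zero_apply]
      rw [Frame.coord_ofForm]
      ext i
      refine Fin.cases ?_ (fun i => ?_) i
      · rw [f3, hv']; simp
      · rw [f4, hv']; simp
    · rw [CompactDual.finrank_F2, CompactDual.finrank_F2]

end SymplecticForm

end LinearAlgebra

/-! ### Tangent vectors, 1-forms and sections in the preferred chart -/

section PreferredChart

variable {E M V : Type*} [NormedAddCommGroup E] [NormedSpace ℂ E] [TopologicalSpace M]
  [ChartedSpace E M] [NormedAddCommGroup V] [NormedSpace ℂ V]

/-- The tangent space at a point is the model space by way of the preferred chart, so that chart has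
the identity as its derivative there. -/
theorem HolParam.tangentEquiv_eq_self [IsManifold 𝓘(ℂ, E) ω M] (p : HolParam E M) {u : E}
    (hp : chartAt E (p u) = p.chart) (v : E) : p.tangentEquiv u v = v := by
  have : IsManifold 𝓘(ℂ, E) 1 M := IsManifold.of_le (n := ω) le_top
  have h1 : mfderiv 𝓘(ℂ, E) 𝓘(ℂ, E) p.chart (p u) = ContinuousLinearMap.id ℂ _ := by
    have := mfderiv_extChartAt_self (I := 𝓘(ℂ, E)) (x := p u)
    rwa [HolParam.extChartAt_eq hp] at this
  have h2 := p.mfderiv_chart_apply u v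
  rw [h1] at h2
  exact h2

theorem OneForm.inChart_param (θ : OneForm E M) (p : HolParam E M) {x : M}
    (hp : chartAt E x = p.chart) (u v : E) :
    θ.inChart x u v = θ (p u) (p.tangentEquiv u v) := by
  have : ∀ φ : E → M, φ = p → (θ (φ u)).comp (mfderiv 𝓘(ℂ, E) 𝓘(ℂ, E) φ u) v =
      θ (p u) (p.tangentEquiv u v) := by
    rintro _ rfl
    rfl
  exact this _ (HolParam.extChartAt_symm_eq hp)

theorem OneForm.HolomorphicAt.analyticAt {θ : OneForm E M} {p : HolParam E M} {u : E}
    (hp : chartAt E (p u) = p.chart) (hθ : θ.HolomorphicAt (p u)) :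
    AnalyticAt ℂ (θ.inChart (p u)) u := by
  have := hθ
  rwa [OneForm.HolomorphicAt, HolParam.extChartAt_eq hp, p.chart_apply] at this

theorem OneForm.d_eq [IsManifold 𝓘(ℂ, E) ω M] {θ : OneForm E M} {p : HolParam E M} {u : E}
    (hp : chartAt E (p u) = p.chart) (hθ : DifferentiableAt ℂ (θ.inChart (p u)) u) (v w : E) :
    θ.d (p u) (p.tangentEquiv u v) (p.tangentEquiv u w) =
      fderiv ℂ (θ.inChart (p u)) u v w - fderiv ℂ (θ.inChart (p u)) u w v := by
  rw [p.tangentEquiv_eq_self hp, p.tangentEquiv_eq_self hp]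
  unfold OneForm.d
  rw [HolParam.extChartAt_eq hp, p.chart_apply, extDeriv_apply]
  · rw [Fin.sum_univ_two]
    have key : ∀ y : Fin 1 → E, ∀ z, fderiv ℂ (fun u' => (ContinuousAlternatingMap.ofSubsingleton ℂ E ℂ (0 : Fin 1)
        (θ.inChart (p u) u')) y) u z = fderiv ℂ (θ.inChart (p u)) u z (y 0) := by
      intro y z
      have h1 : (fun u' => (ContinuousAlternatingMap.ofSubsingleton ℂ E ℂ (0 : Fin 1)
        (θ.inChart (p u) u')) y) = fun u' => θ.inChart (p u) u' (y 0) := by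
        ext u'
        simp
      rw [h1, fderiv_clm_apply hθ (differentiableAt_const _)]
      simp
    rw [key, key]
    simp [Fin.removeNth, sub_eq_add_neg]
  · exact ((ContinuousAlternatingMap.ofSubsingletonLIE (𝕜 := ℂ) (E := E) (F := ℂ)
      (0 : Fin 1)).toContinuousLinearEquiv.differentiableAt).comp u hθ

/-- The derivative of a multiple of a section, modulo that section. -/
theorem HolParam.exists_vectorDeriv_eq_of_smul (p : HolParam E M) {u : E} {σ σ' : M → V}
    (hσ : ContMDiffAt 𝓘(ℂ, E) 𝓘(ℂ, V) ω σ (p u)) (hσ' : ContMDiffAt 𝓘(ℂ, E) 𝓘(ℂ, V) ω σ' (p u))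
    {a : E → ℂ} (ha : DifferentiableAt ℂ a u) (hs : ∀ᶠ u' in 𝓝 u, σ (p u') = a u' • σ' (p u'))
    (v : TangentSpace 𝓘(ℂ, E) (p u)) :
    ∃ t : ℂ, vectorDeriv E σ (p u) v = t • σ' (p u) + a u • vectorDeriv E σ' (p u) v := by
  obtain ⟨v, rfl⟩ := (p.tangentEquiv u).surjective v
  refine ⟨fderiv ℂ a u v, ?_⟩
  rw [p.vectorDeriv_apply hσ, p.vectorDeriv_apply hσ', Filter.EventuallyEq.fderiv_eq hs,
    fderiv_fun_smul ha (((p.contMDiffAt_comp_iff u).1 hσ').differentiableAt (by simp))]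
  simp [add_comm]

end PreferredChart

/-! ### The contact system on ℙ(V) in affine charts -/

section ProjectiveSpace

variable {V : Type*} [NormedAddCommGroup V] [NormedSpace ℂ V] {h : ℕ}

namespace SymplecticForm

variable (S : SymplecticForm V h)

/-- The symplectic form, as a continuous bilinear map. -/
noncomputable def formL : V →L[ℂ] V →L[ℂ] ℂ :=
  haveI := S.finiteDimensional
  LinearMap.toContinuousBilinearMap S.form

theorem formL_apply (v w : V) : S.formL v w = S.form v w := rfl

/-- The vector `(1, u)` in linear coordinates. -/
noncomputable def affineVec (e : V ≃ₗ[ℂ] ℂ × ProjModel h) (u : ProjModel h) : V := e.symm (1, u)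

/-- The vector `(0, v)` in linear coordinates. -/
noncomputable def dirVec (e : V ≃ₗ[ℂ] ℂ × ProjModel h) : ProjModel h →L[ℂ] V :=
  LinearMap.toContinuousLinearMap (e.symm.toLinearMap ∘ₗ LinearMap.inr ℂ ℂ (ProjModel h))

theorem coord_affineVec (e : V ≃ₗ[ℂ] ℂ × ProjModel h) (u : ProjModel h) :
    e (affineVec e u) = (1, u) := e.apply_symm_apply _

theorem coord_dirVec (e : V ≃ₗ[ℂ] ℂ × ProjModel h) (v : ProjModel h) :
    e (dirVec e v) = (0, v) := e.apply_symm_apply _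

theorem affineVec_ne_zero (e : V ≃ₗ[ℂ] ℂ × ProjModel h) (u : ProjModel h) : affineVec e u ≠ 0 :=
  fun h0 => by
    have := coord_affineVec e u
    rw [h0, map_zero] at this
    exact zero_ne_one (congrArg Prod.fst this)

theorem dirVec_injective (e : V ≃ₗ[ℂ] ℂ × ProjModel h) : Function.Injective (dirVec e) :=
  fun v w hvw => by
    have := congrArg e hvw
    rw [coord_dirVec, coord_dirVec] at this
    exact congrArg Prod.snd this

theorem eq_smul_add_dirVec (e : V ≃ₗ[ℂ] ℂ × ProjModel h) (u : ProjModel h) (w : V) :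
    w = (e w).1 • affineVec e u + dirVec e ((e w).2 - (e w).1 • u) := by
  apply e.injective
  rw [map_add, map_smul, coord_affineVec, coord_dirVec]
  ext1 <;> simp

theorem affineVec_eq (e : V ≃ₗ[ℂ] ℂ × ProjModel h) (u u' : ProjModel h) :
    affineVec e u' = affineVec e u + dirVec e (u' - u) := by
  apply e.injective
  rw [map_add, coord_affineVec, coord_affineVec, coord_dirVec]
  ext1 <;> simp

theorem contDiff_affineVec (e : V ≃ₗ[ℂ] ℂ × ProjModel h) : ContDiff ℂ ω (affineVec e) := by
  have : affineVec e = fun u => affineVec e 0 + dirVec e (u - 0) := by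
    ext u
    exact affineVec_eq e 0 u
  rw [this]
  fun_prop

theorem fderiv_affineVec (e : V ≃ₗ[ℂ] ℂ × ProjModel h) (u : ProjModel h) :
    fderiv ℂ (affineVec e) u = dirVec e := by
  have : affineVec e = fun u => affineVec e 0 + dirVec e u := by
    ext u
    simpa using affineVec_eq e 0 u
  rw [this, fderiv_const_add, ContinuousLinearMap.fderiv]

theorem line_projP (e : V ≃ₗ[ℂ] ℂ × ProjModel h) (u : ProjModel h) :
    S.line (S.projP e u) = Submodule.span ℂ {affineVec e u} :=
  Projectivization.submodule_mk _ _

theorem line_injective : Function.Injective S.line := Projectivization.submodule_injective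

theorem line_lineMap (F : S.CompactDual) : S.line (S.lineMap F) = F.F3 :=
  Projectivization.submodule_mk'' _ _

theorem lineMap_eq_projP_iff (e : V ≃ₗ[ℂ] ℂ × ProjModel h) (u : ProjModel h)
    (F : S.CompactDual) : S.lineMap F = S.projP e u ↔ affineVec e u ∈ F.F3 := by
  rw [← S.line_injective.eq_iff, line_lineMap, line_projP]
  refine ⟨fun hF => by rw [hF]; exact Submodule.mem_span_singleton_self _,
    fun hF => F.F3_eq_span hF (affineVec_ne_zero e u)⟩

/-- The section `(1, u)` of the tautological line bundle. -/
noncomputable def affineSection (e : V ≃ₗ[ℂ] ℂ × ProjModel h) (x : S.Proj) : V :=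
  affineVec e ((S.projP e).chart x)

theorem affineSection_projP (e : V ≃ₗ[ℂ] ℂ × ProjModel h) (u : ProjModel h) :
    S.affineSection e (S.projP e u) = affineVec e u := by
  rw [affineSection, HolParam.chart_apply]

theorem contMDiffAt_affineSection (e : V ≃ₗ[ℂ] ℂ × ProjModel h) (u : ProjModel h) :
    ContMDiffAt 𝓘(ℂ, ProjModel h) 𝓘(ℂ, V) ω (S.affineSection e) (S.projP e u) := by
  rw [HolParam.contMDiffAt_comp_iff]
  simp only [affineSection_projP]
  exact (contDiff_affineVec e).contDiffAt

theorem isSectionAt_affineSection (e : V ≃ₗ[ℂ] ℂ × ProjModel h) (u : ProjModel h) :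
    IsSectionAt (ProjModel h) S.line (S.affineSection e) (S.projP e u) := by
  refine ⟨S.contMDiffAt_affineSection e u, ?_⟩
  rw [HolParam.eventually_iff]
  refine Eventually.of_forall fun u' => ?_
  rw [affineSection_projP, line_projP]
  exact Submodule.mem_span_singleton_self _

theorem vectorDeriv_affineSection (e : V ≃ₗ[ℂ] ℂ × ProjModel h) (u v : ProjModel h) :
    vectorDeriv (ProjModel h) (S.affineSection e) (S.projP e u) ((S.projP e).tangentEquiv u v) =
      dirVec e v := by
  rw [HolParam.vectorDeriv_apply _ (S.contMDiffAt_affineSection e u)]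
  simp only [affineSection_projP]
  rw [fderiv_affineVec]

/-- A section of the tautological line bundle is a multiple of the section `(1, u)`. -/
theorem exists_section_eq (e : V ≃ₗ[ℂ] ℂ × ProjModel h) (u : ProjModel h) {z : S.Proj → V}
    (hz : IsSectionAt (ProjModel h) S.line z (S.projP e u)) :
    ∃ a : ℂ, z (S.projP e u) = a • affineVec e u ∧ ∀ v, ∃ t : ℂ,
      vectorDeriv (ProjModel h) z (S.projP e u) ((S.projP e).tangentEquiv u v) =
        t • affineVec e u + a • dirVec e v := by
  have := S.finiteDimensional
  -- The first coordinate is 1 on the vector (1, u), so it reads off the factor of proportionality.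
  let l : V →L[ℂ] ℂ := LinearMap.toContinuousLinearMap (LinearMap.fst ℂ _ _ ∘ₗ e.toLinearMap)
  have hl : ∀ v, l v = (e v).1 := fun v => rfl
  have hmul : ∀ᶠ u' in 𝓝 u, z (S.projP e u') = l (z (S.projP e u')) •
      S.affineSection e (S.projP e u') := by
    refine (((S.projP e).eventually_iff u).1 hz.2).mono fun u' hu' => ?_
    rw [line_projP] at hu'
    obtain ⟨c, hc⟩ := Submodule.mem_span_singleton.1 hu'
    rw [← hc, affineSection_projP, map_smul, hl, coord_affineVec]
    simp
  refine ⟨l (z (S.projP e u)), ?_, fun v => ?_⟩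
  · rw [← affineSection_projP]
    exact hmul.self_of_nhds
  · have ha : DifferentiableAt ℂ (fun u' => l (z (S.projP e u'))) u :=
      l.differentiableAt.comp u
        ((((S.projP e).contMDiffAt_comp_iff u).1 hz.1).differentiableAt (by simp))
    obtain ⟨t, ht⟩ := (S.projP e).exists_vectorDeriv_eq_of_smul hz.1
      (S.contMDiffAt_affineSection e u) ha hmul ((S.projP e).tangentEquiv u v)
    refine ⟨t, ?_⟩
    rw [ht, affineSection_projP, vectorDeriv_affineSection]

/-- The contact form `Q(dz, z)` for `z = (1, u)`. -/
noncomputable def contactForm (e : V ≃ₗ[ℂ] ℂ × ProjModel h) : OneForm (ProjModel h) S.Proj :=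
  fun x => (S.formL.flip (S.affineSection e x)).comp
    (vectorDeriv (ProjModel h) (S.affineSection e) x)

theorem contactForm_projP (e : V ≃ₗ[ℂ] ℂ × ProjModel h) (u v : ProjModel h) :
    S.contactForm e (S.projP e u) ((S.projP e).tangentEquiv u v) =
      S.form (dirVec e v) (affineVec e u) := by
  change S.form (vectorDeriv (ProjModel h) (S.affineSection e) (S.projP e u)
    ((S.projP e).tangentEquiv u v)) (S.affineSection e (S.projP e u)) = _
  rw [vectorDeriv_affineSection, affineSection_projP]

/-- Replacing z by a z multiplies Q(dz, z) by a², since the term with da contains Q(z, z) = 0. One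
section therefore generates the system. -/
theorem contactSystem_projP (e : V ≃ₗ[ℂ] ℂ × ProjModel h) (u : ProjModel h) :
    S.contactSystem (S.projP e u) = Submodule.span ℂ {S.contactForm e (S.projP e u)} := by
  refine le_antisymm ?_ ?_
  · refine Submodule.span_le.2 ?_
    rintro α ⟨z, hz, hα⟩
    obtain ⟨a, ha, hd⟩ := S.exists_section_eq e u hz
    refine Submodule.mem_span_singleton.2 ⟨a * a, ?_⟩
    ext v
    obtain ⟨v, rfl⟩ := ((S.projP e).tangentEquiv u).surjective v
    obtain ⟨t, ht⟩ := hd v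
    rw [hα, ht, ha]
    change (a * a) * S.contactForm e (S.projP e u) ((S.projP e).tangentEquiv u v) = _
    rw [contactForm_projP]
    simp only [map_add, map_smul, LinearMap.add_apply, LinearMap.smul_apply, smul_eq_mul,
      form_self]
    ring
  · rw [Submodule.span_singleton_le_iff_mem]
    exact Submodule.subset_span ⟨_, S.isSectionAt_affineSection e u, fun v => rfl⟩

theorem contactForm_inChart {e : V ≃ₗ[ℂ] ℂ × ProjModel h} {x : S.Proj}
    (he : chartAt (ProjModel h) x = (S.projP e).chart) :
    (S.contactForm e).inChart x = fun u => (S.formL.flip (affineVec e u)).comp (dirVec e) := by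
  ext1 u
  apply ContinuousLinearMap.ext
  intro v
  rw [OneForm.inChart_param _ _ he]
  exact S.contactForm_projP e u v

theorem contDiff_contactForm_inChart {e : V ≃ₗ[ℂ] ℂ × ProjModel h} {x : S.Proj}
    (he : chartAt (ProjModel h) x = (S.projP e).chart) :
    ContDiff ℂ ω ((S.contactForm e).inChart x) := by
  rw [contactForm_inChart S he]
  exact (S.formL.flip.contDiff.comp (contDiff_affineVec e)).clm_comp contDiff_const

theorem holomorphicAt_contactForm {e : V ≃ₗ[ℂ] ℂ × ProjModel h} {x : S.Proj}
    (he : chartAt (ProjModel h) x = (S.projP e).chart) : (S.contactForm e).HolomorphicAt x :=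
  (S.contDiff_contactForm_inChart he).contDiffAt.analyticAt

theorem fderiv_contactForm_inChart {e : V ≃ₗ[ℂ] ℂ × ProjModel h} {x : S.Proj}
    (he : chartAt (ProjModel h) x = (S.projP e).chart) (u v w : ProjModel h) :
    fderiv ℂ ((S.contactForm e).inChart x) u v w = S.form (dirVec e w) (dirVec e v) := by
  rw [contactForm_inChart S he]
  have h1 : DifferentiableAt ℂ (affineVec e) u :=
    (contDiff_affineVec e).contDiffAt.differentiableAt (by simp)
  have h2 : HasFDerivAt (fun u => (S.formL.flip (affineVec e u)).comp (dirVec e))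
      (((ContinuousLinearMap.compL ℂ (ProjModel h) V ℂ).flip (dirVec e)).comp
        (S.formL.flip.comp (dirVec e))) u := by
    have h3 := h1.hasFDerivAt
    rw [fderiv_affineVec] at h3
    exact ((ContinuousLinearMap.compL ℂ (ProjModel h) V ℂ).flip
      (dirVec e)).hasFDerivAt.comp u (S.formL.flip.hasFDerivAt.comp u h3)
  rw [h2.fderiv]
  rfl

/-- The form is affine in u; by skewness of Q the two terms of its antisymmetrized derivative
coincide, whence the factor 2. -/
theorem contactForm_d {e : V ≃ₗ[ℂ] ℂ × ProjModel h} {u : ProjModel h}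
    (he : chartAt (ProjModel h) (S.projP e u) = (S.projP e).chart) (v w : ProjModel h) :
    (S.contactForm e).d (S.projP e u) ((S.projP e).tangentEquiv u v)
      ((S.projP e).tangentEquiv u w) = 2 * S.form (dirVec e w) (dirVec e v) := by
  rw [OneForm.d_eq he ((S.contDiff_contactForm_inChart he).contDiffAt.differentiableAt (by simp)),
    fderiv_contactForm_inChart S he, fderiv_contactForm_inChart S he,
    S.form_swap (dirVec e v) (dirVec e w)]
  ring

/-- V is spanned by (1, u) and the directions (0, v). As Q((1, u), (1, u)) = 0, nondegeneracy must
be witnessed by a direction. -/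
theorem exists_form_dirVec_ne_zero (e : V ≃ₗ[ℂ] ℂ × ProjModel h) (u : ProjModel h) :
    ∃ v, S.form (dirVec e v) (affineVec e u) ≠ 0 := by
  by_contra hcon
  push Not at hcon
  refine affineVec_ne_zero e u (S.eq_zero_of_form fun w => ?_)
  rw [S.form_swap, eq_smul_add_dirVec e u w]
  simp [form_self, hcon]

theorem exists_projP_eq (x : S.Proj) : ∃ e u,
    x = S.projP e u ∧ chartAt (ProjModel h) (S.projP e u) = (S.projP e).chart := by
  obtain ⟨e, he⟩ := S.exists_projP_eq_chartAt x
  have := HolParam.apply_chart_of_eq he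
  refine ⟨e, (S.projP e).chart x, this.symm, ?_⟩
  rw [this, he]

theorem isContactSystem_contactSystem : IsContactSystem S.contactSystem h := by
  refine ⟨by simp, fun x => ?_⟩
  obtain ⟨e, u, rfl, he⟩ := S.exists_projP_eq x
  refine ⟨S.contactForm e, S.holomorphicAt_contactForm he, ?_, ?_, ?_⟩
  · rw [HolParam.eventually_iff]
    exact Eventually.of_forall fun u' => S.contactSystem_projP e u'
  · intro h0
    obtain ⟨v, hv⟩ := S.exists_form_dirVec_ne_zero e u
    rw [← contactForm_projP, h0] at hv
    exact hv rfl
  · intro v hv hvw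
    obtain ⟨v, rfl⟩ := ((S.projP e).tangentEquiv u).surjective v
    rw [contactForm_projP] at hv
    have hort : ∀ w, S.form (dirVec e w) (affineVec e u) = 0 →
        S.form (dirVec e w) (dirVec e v) = 0 := by
      intro w hw
      have := hvw ((S.projP e).tangentEquiv u w) (by rw [contactForm_projP, hw])
      rw [contactForm_d S he] at this
      simpa using this
    obtain ⟨w0, hw0⟩ := S.exists_form_dirVec_ne_zero e u
    set c := S.form (dirVec e w0) (affineVec e u) with hc
    set d := S.form (dirVec e w0) (dirVec e v) with hd
    -- The functional Q(·, (0, v)) vanishes where Q(·, (1, u)) does, so it is a multiple of it, with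
    -- ratio read off at w₀. Nondegeneracy makes the vectors proportional, and comparing first
    -- coordinates then gives v = 0.
    have key : dirVec e v - (d / c) • affineVec e u = 0 := by
      refine S.eq_zero_of_form fun w => ?_
      rw [S.form_swap, eq_smul_add_dirVec e u w]
      set w' := (e w).2 - (e w).1 • u
      set f := S.form (dirVec e w') (affineVec e u) with hf
      -- Subtracting this multiple of w₀ moves w' into the contact hyperplane.
      have h1 := hort (w' - (f / c) • w0) (by
        simp only [map_sub, map_smul, LinearMap.sub_apply, LinearMap.smul_apply, smul_eq_mul]
        rw [← hf, ← hc]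
        field_simp
        ring)
      simp only [map_sub, map_smul, LinearMap.sub_apply, LinearMap.smul_apply, smul_eq_mul] at h1
      rw [← hd] at h1
      have h2 : S.form (affineVec e u) (dirVec e v) = 0 := by rw [S.form_swap, hv, neg_zero]
      simp only [map_add, map_sub, map_smul, LinearMap.add_apply, LinearMap.smul_apply,
        smul_eq_mul, form_self, h2]
      rw [← hf]
      linear_combination -h1
    have h3 := congrArg e (sub_eq_zero.1 key)
    rw [map_smul, coord_affineVec, coord_dirVec] at h3
    have h4 : d / c = 0 := by simpa using (congrArg Prod.fst h3).symm
    have h5 : v = 0 := by simpa [h4] using congrArg Prod.snd h3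
    rw [h5, map_zero]

end SymplecticForm

end ProjectiveSpace

/-! ### Integral elements of the contact system as Lagrangian subspaces -/

section IntegralElements

variable {V : Type*} [NormedAddCommGroup V] [NormedSpace ℂ V] {h : ℕ}

namespace SymplecticForm

variable (S : SymplecticForm V h)

/-- The subspace of `T_x ℙ(V)` of the vectors `v` such that `dz(v) ∈ W` for the local holomorphic
sections `z` of the tautological line bundle. -/
noncomputable def planeOf (x : S.Proj) (W : Submodule ℂ V) :
    Submodule ℂ (TangentSpace 𝓘(ℂ, ProjModel h) x) where
  carrier := {v | ∀ z : S.Proj → V, IsSectionAt (ProjModel h) S.line z x →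
    vectorDeriv (ProjModel h) z x v ∈ W}
  zero_mem' z _ := by rw [map_zero]; exact Submodule.zero_mem _
  add_mem' hv hw z hz := by rw [map_add]; exact Submodule.add_mem _ (hv z hz) (hw z hz)
  smul_mem' c v hv z hz := by rw [map_smul]; exact Submodule.smul_mem _ c (hv z hz)

theorem planeMap_eq_mk {F : S.CompactDual} {x : S.Proj} (hx : S.lineMap F = x) :
    S.planeMap F = ⟨x, S.planeOf x F.F2⟩ := by
  subst hx
  rfl

/-- The subspace of `V` which corresponds to a subspace of `T_x ℙ(V) = Hom(ℓ, V / ℓ)`: it contains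
the line `ℓ` and the derivatives of the sections of the tautological line bundle. -/
noncomputable def planeSpan (g : TangentPlane (ProjModel h) S.Proj) : Submodule ℂ V :=
  S.line g.base ⊔ Submodule.span ℂ {w | ∃ z : S.Proj → V, IsSectionAt (ProjModel h) S.line z g.base ∧
    ∃ v ∈ g.plane, w = vectorDeriv (ProjModel h) z g.base v}

/-- The tangent plane with the given coordinates in an affine chart of `ℙ(V)`. -/
noncomputable def affinePlane (e : V ≃ₗ[ℂ] ℂ × ProjModel h) (u : ProjModel h)
    (L : Submodule ℂ (ProjModel h)) : TangentPlane (ProjModel h) S.Proj :=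
  ⟨S.projP e u, L.map ((S.projP e).tangentEquiv u).toLinearMap⟩

theorem exists_affinePlane_eq (e : V ≃ₗ[ℂ] ℂ × ProjModel h) (u : ProjModel h)
    {g : TangentPlane (ProjModel h) S.Proj} (hg : g.base = S.projP e u) :
    ∃ L, g = S.affinePlane e u L := by
  obtain ⟨b, p⟩ := g
  subst hg
  refine ⟨p.comap ((S.projP e).tangentEquiv u).toLinearMap, ?_⟩
  rw [affinePlane, Submodule.map_comap_eq_of_surjective ((S.projP e).tangentEquiv u).surjective]

theorem finrank_affinePlane (e : V ≃ₗ[ℂ] ℂ × ProjModel h) (u : ProjModel h)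
    (L : Submodule ℂ (ProjModel h)) : finrank ℂ (S.affinePlane e u L).plane = finrank ℂ L :=
  LinearEquiv.finrank_map_eq ((S.projP e).tangentEquiv u) L

theorem planeOf_projP (e : V ≃ₗ[ℂ] ℂ × ProjModel h) (u : ProjModel h) {W : Submodule ℂ V}
    (hu : affineVec e u ∈ W) : S.planeOf (S.projP e u) W =
      (W.comap (dirVec e).toLinearMap).map ((S.projP e).tangentEquiv u).toLinearMap := by
  ext v
  obtain ⟨v, rfl⟩ := ((S.projP e).tangentEquiv u).surjective v
  constructor
  · intro hv
    refine ⟨v, ?_, rfl⟩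
    have := hv _ (S.isSectionAt_affineSection e u)
    rwa [vectorDeriv_affineSection] at this
  · rintro ⟨v', hv', hvv⟩ z hz
    have hvv' : v' = v := ((S.projP e).tangentEquiv u).injective hvv
    subst hvv'
    obtain ⟨a, -, hd⟩ := S.exists_section_eq e u hz
    obtain ⟨t, ht⟩ := hd v'
    rw [ht]
    exact W.add_mem (W.smul_mem _ hu) (W.smul_mem _ hv')

theorem planeMap_eq (e : V ≃ₗ[ℂ] ℂ × ProjModel h) (u : ProjModel h) {F : S.CompactDual}
    (hu : affineVec e u ∈ F.F3) :
    S.planeMap F = S.affinePlane e u (F.F2.comap (dirVec e).toLinearMap) := by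
  rw [S.planeMap_eq_mk ((S.lineMap_eq_projP_iff e u F).2 hu),
    S.planeOf_projP e u (F.F3_le_F2 hu), affinePlane]

theorem planeSpan_affinePlane (e : V ≃ₗ[ℂ] ℂ × ProjModel h) (u : ProjModel h)
    (L : Submodule ℂ (ProjModel h)) : S.planeSpan (S.affinePlane e u L) =
      Submodule.span ℂ {affineVec e u} ⊔ L.map (dirVec e).toLinearMap := by
  have hb : (S.affinePlane e u L).base = S.projP e u := rfl
  unfold planeSpan
  refine le_antisymm ?_ ?_
  · refine sup_le ?_ (Submodule.span_le.2 ?_)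
    · rw [hb, line_projP]
      exact le_sup_left
    · rintro _ ⟨z, hz, _, ⟨v, hv, rfl⟩, rfl⟩
      obtain ⟨a, -, hd⟩ := S.exists_section_eq e u hz
      obtain ⟨t, ht⟩ := hd v
      refine (congrArg (· ∈ _) ht).mpr ?_
      exact Submodule.add_mem_sup (Submodule.smul_mem _ _ (Submodule.mem_span_singleton_self _))
        (Submodule.smul_mem _ _ ⟨v, hv, rfl⟩)
  · refine sup_le ?_ ?_
    · rw [hb, line_projP]
      exact le_sup_left
    · rintro _ ⟨v, hv, rfl⟩
      refine le_sup_right (α := Submodule ℂ V) (Submodule.subset_span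
        ⟨_, S.isSectionAt_affineSection e u, _, ⟨v, hv, rfl⟩, ?_⟩)
      exact (S.vectorDeriv_affineSection e u v).symm

theorem comap_dirVec_planeSpan (e : V ≃ₗ[ℂ] ℂ × ProjModel h) (u : ProjModel h)
    (L : Submodule ℂ (ProjModel h)) :
    (S.planeSpan (S.affinePlane e u L)).comap (dirVec e).toLinearMap = L := by
  rw [planeSpan_affinePlane]
  ext v
  constructor
  · intro hv
    obtain ⟨_, ha, _, ⟨w, hw, rfl⟩, hvw⟩ := Submodule.mem_sup.1 hv
    obtain ⟨a, rfl⟩ := Submodule.mem_span_singleton.1 ha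
    have h1 := congrArg e hvw
    change e (a • affineVec e u + dirVec e w) = e (dirVec e v) at h1
    rw [map_add, map_smul, coord_affineVec, coord_dirVec, coord_dirVec] at h1
    have h2 : a = 0 := by simpa using congrArg Prod.fst h1
    have h3 : w = v := by simpa [h2] using congrArg Prod.snd h1
    exact h3 ▸ hw
  · intro hv
    exact le_sup_right (α := Submodule ℂ V) ⟨v, hv, rfl⟩

theorem finrank_planeSpan (g : TangentPlane (ProjModel h) S.Proj) :
    finrank ℂ (S.planeSpan g) = finrank ℂ g.plane + 1 := by
  have := S.finiteDimensional
  obtain ⟨e, u, hu, -⟩ := S.exists_projP_eq g.base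
  obtain ⟨L, rfl⟩ := S.exists_affinePlane_eq e u hu
  have h1 := Submodule.finrank_sup_add_finrank_inf_eq (Submodule.span ℂ {affineVec e u})
    (L.map (dirVec e).toLinearMap)
  have h2 : Submodule.span ℂ {affineVec e u} ⊓ L.map (dirVec e).toLinearMap = ⊥ := by
    rw [eq_bot_iff]
    rintro _ ⟨ha, v, -, rfl⟩
    obtain ⟨a, ha⟩ := Submodule.mem_span_singleton.1 ha
    have h1 := congrArg e ha
    change e (a • affineVec e u) = e (dirVec e v) at h1
    rw [map_smul, coord_affineVec, coord_dirVec] at h1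
    have h2 : a = 0 := by simpa using congrArg Prod.fst h1
    rw [← ha, h2, zero_smul]
    exact Submodule.zero_mem _
  rw [h2, finrank_bot, finrank_span_singleton (affineVec_ne_zero e u),
    (LinearEquiv.finrank_eq (Submodule.equivMapOfInjective (dirVec e).toLinearMap
      (dirVec_injective e) L)).symm] at h1
  rw [planeSpan_affinePlane, finrank_affinePlane]
  omega

/-- The isotropy of a subspace of `V` containing `(1, u)`, in an affine chart. -/
theorem planeSpan_isotropic_iff (e : V ≃ₗ[ℂ] ℂ × ProjModel h) (u : ProjModel h)
    (L : Submodule ℂ (ProjModel h)) :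
    (∀ v ∈ S.planeSpan (S.affinePlane e u L), ∀ w ∈ S.planeSpan (S.affinePlane e u L),
      S.form v w = 0) ↔ (∀ v ∈ L, S.form (dirVec e v) (affineVec e u) = 0) ∧
        ∀ v ∈ L, ∀ w ∈ L, S.form (dirVec e v) (dirVec e w) = 0 := by
  rw [planeSpan_affinePlane]
  constructor
  · intro hS
    have h1 : ∀ v ∈ L, dirVec e v ∈
        Submodule.span ℂ {affineVec e u} ⊔ L.map (dirVec e).toLinearMap :=
      fun v hv => le_sup_right (α := Submodule ℂ V) ⟨v, hv, rfl⟩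
    exact ⟨fun v hv => hS _ (h1 v hv) _
      (le_sup_left (α := Submodule ℂ V) (Submodule.mem_span_singleton_self _)),
      fun v hv w hw => hS _ (h1 v hv) _ (h1 w hw)⟩
  · rintro ⟨h1, h2⟩ v hv w hw
    obtain ⟨_, hv1, _, ⟨v, hv2, rfl⟩, rfl⟩ := Submodule.mem_sup.1 hv
    obtain ⟨_, hw1, _, ⟨w, hw2, rfl⟩, rfl⟩ := Submodule.mem_sup.1 hw
    obtain ⟨a, rfl⟩ := Submodule.mem_span_singleton.1 hv1
    obtain ⟨b, rfl⟩ := Submodule.mem_span_singleton.1 hw1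
    have h3 := h1 v hv2
    have h4 := h1 w hw2
    rw [S.form_swap, neg_eq_zero] at h4
    have h5 := h2 v hv2 w hw2
    simp only [map_add, map_smul, LinearMap.add_apply, LinearMap.smul_apply, smul_eq_mul,
      form_self, ContinuousLinearMap.coe_coe, h3, h4, h5]
    ring

/-- The generator θ₀ = Q(dz, z) alone yields both conditions, the second through dθ₀ = 2Q up to
sign. Any other local section is c θ₀ with c differentiable, and d(c θ₀) = dc ∧ θ₀ + c dθ₀ vanishes
where θ₀ and dθ₀ do. -/
theorem isIntegralElement_affinePlane_iff {e : V ≃ₗ[ℂ] ℂ × ProjModel h} {u : ProjModel h}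
    (he : chartAt (ProjModel h) (S.projP e u) = (S.projP e).chart)
    (L : Submodule ℂ (ProjModel h)) :
    IsIntegralElement S.contactSystem (S.affinePlane e u L) ↔
      (∀ v ∈ L, S.form (dirVec e v) (affineVec e u) = 0) ∧
        ∀ v ∈ L, ∀ w ∈ L, S.form (dirVec e v) (dirVec e w) = 0 := by
  constructor
  · intro hI
    obtain ⟨h1, h2⟩ := hI (S.contactForm e) (S.holomorphicAt_contactForm he) (by
      refine ((S.projP e).eventually_iff u).2 (Eventually.of_forall fun u' => ?_)
      rw [contactSystem_projP]
      exact Submodule.mem_span_singleton_self _)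
    constructor
    · intro v hv
      rw [← contactForm_projP]
      exact h1 _ ⟨v, hv, rfl⟩
    · intro v hv w hw
      have := (S.contactForm_d he w v).symm.trans (h2 _ ⟨w, hw, rfl⟩ _ ⟨v, hv, rfl⟩)
      simpa using this
  · rintro ⟨h1, h2⟩ θ hθ hθI
    have hθ' : θ.HolomorphicAt (S.projP e u) := hθ
    have hθI' := ((S.projP e).eventually_iff u).1 hθI
    set β := θ.inChart (S.projP e u) with hβ
    set β' := (S.contactForm e).inChart (S.projP e u) with hβ'
    have hβd : DifferentiableAt ℂ β u := (hθ'.analyticAt he).differentiableAt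
    have hβd' : DifferentiableAt ℂ β' u :=
      (S.contDiff_contactForm_inChart he).contDiffAt.differentiableAt (by simp)
    have hβv : ∀ u' v, β' u' v = S.form (dirVec e v) (affineVec e u') := fun u' v => by
      rw [hβ', contactForm_inChart S he]; rfl
    obtain ⟨w0, hw0⟩ := S.exists_form_dirVec_ne_zero e u
    rw [← hβv] at hw0
    -- Membership in the system gives a coefficient at each point only. Evaluating on the fixed
    -- vector w₀ exhibits it as a quotient of differentiable functions.
    have hmul : ∀ᶠ u' in 𝓝 u, β u' = (β u' w0 / β' u' w0) • β' u' := by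
      have hne : ∀ᶠ u' in 𝓝 u, β' u' w0 ≠ 0 :=
        (hβd'.continuousAt.clm_apply continuousAt_const).eventually_ne hw0
      filter_upwards [hne, hθI'] with u' hu' hI
      rw [contactSystem_projP] at hI
      obtain ⟨c, hc⟩ := Submodule.mem_span_singleton.1 hI
      have hc' : ∀ v, β u' v = c * β' u' v := fun v => by
        rw [hβ, hβ', OneForm.inChart_param _ _ he, OneForm.inChart_param _ _ he, ← hc]
        rfl
      ext v
      rw [smul_apply, hc', hc', smul_eq_mul]
      field_simp
    have hcd : DifferentiableAt ℂ (fun u' => β u' w0 / β' u' w0) u := by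
      have h3 : DifferentiableAt ℂ (fun u' => β u' w0) u :=
        hβd.clm_apply (differentiableAt_const _)
      have h4 : DifferentiableAt ℂ (fun u' => β' u' w0) u :=
        hβd'.clm_apply (differentiableAt_const _)
      simpa only [div_eq_mul_inv] using h3.fun_mul (h4.fun_inv hw0)
    constructor
    · rintro _ ⟨v, hv, rfl⟩
      have h3 : β u v = 0 := by
        rw [hmul.self_of_nhds, smul_apply, hβv u v, h1 v hv, smul_zero]
      rw [hβ, OneForm.inChart_param _ _ he] at h3
      exact h3
    · rintro _ ⟨v, hv, rfl⟩ _ ⟨w, hw, rfl⟩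
      refine (OneForm.d_eq he hβd v w).trans ?_
      -- Product rule: the terms with the derivative of the coefficient carry a factor θ₀(v) or
      -- θ₀(w), and the others carry Q of two directions in L.
      rw [← hβ, Filter.EventuallyEq.fderiv_eq hmul, fderiv_fun_smul hcd hβd']
      have h3 := hβv u v
      have h4 := hβv u w
      rw [h1 v hv] at h3
      rw [h1 w hw] at h4
      have h5 : ∀ v w, fderiv ℂ β' u v w = S.form (dirVec e w) (dirVec e v) :=
        S.fderiv_contactForm_inChart he u
      simp only [add_apply, smul_apply, ContinuousLinearMap.smulRight_apply, h3, h4, h5,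
        h2 v hv w hw, h2 w hw v hv]
      simp

/-- A subspace of `T_x ℙ(V)` is an integral element of the contact system if and only if the
corresponding subspace of `V` is isotropic. -/
theorem isIntegralElement_iff (g : TangentPlane (ProjModel h) S.Proj) :
    IsIntegralElement S.contactSystem g ↔
      ∀ v ∈ S.planeSpan g, ∀ w ∈ S.planeSpan g, S.form v w = 0 := by
  obtain ⟨e, u, hu, he⟩ := S.exists_projP_eq g.base
  obtain ⟨L, rfl⟩ := S.exists_affinePlane_eq e u hu
  rw [planeSpan_isotropic_iff, isIntegralElement_affinePlane_iff S he]

theorem CompactDual.exists_affineVec_mem {S : SymplecticForm V h} (F : S.CompactDual) :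
    ∃ (e : V ≃ₗ[ℂ] ℂ × ProjModel h) (u : ProjModel h), affineVec e u ∈ F.F3 := by
  obtain ⟨e, u, hu, -⟩ := S.exists_projP_eq (S.lineMap F)
  exact ⟨e, u, (S.lineMap_eq_projP_iff e u F).1 hu⟩

theorem planeSpan_planeMap (F : S.CompactDual) : S.planeSpan (S.planeMap F) = F.F2 := by
  obtain ⟨e, u, hu⟩ := F.exists_affineVec_mem
  rw [S.planeMap_eq e u hu, planeSpan_affinePlane]
  have hu2 := F.F3_le_F2 hu
  refine le_antisymm (sup_le ?_ (Submodule.map_comap_le _ _)) ?_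
  · rwa [Submodule.span_singleton_le_iff_mem]
  · intro w hw
    rw [eq_smul_add_dirVec e u w]
    refine Submodule.add_mem_sup (Submodule.smul_mem _ _ (Submodule.mem_span_singleton_self _))
      ⟨_, ?_, rfl⟩
    have : dirVec e ((e w).2 - (e w).1 • u) = w - (e w).1 • affineVec e u :=
      eq_sub_of_add_eq' (eq_smul_add_dirVec e u w).symm
    change dirVec e _ ∈ F.F2
    rw [this]
    exact F.F2.sub_mem hw (F.F2.smul_mem _ hu2)

/-- F³ is the line of the base point and F² is the span recovered by `planeSpan`; together they
determine the flag. -/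
theorem planeMap_injective : Function.Injective S.planeMap := by
  intro F F' hF
  refine CompactDual.ext' ?_ ?_
  · rw [← S.line_lineMap, ← S.line_lineMap]
    exact congrArg (fun g => S.line g.base) hF
  · rw [← S.planeSpan_planeMap, hF, S.planeSpan_planeMap]

theorem planeMap_mem_integralElements (F : S.CompactDual) :
    S.planeMap F ∈ integralElements S.contactSystem h := by
  constructor
  · have := S.finrank_planeSpan (S.planeMap F)
    rw [planeSpan_planeMap, F.finrank_F2] at this
    omega
  · rw [isIntegralElement_iff, planeSpan_planeMap]
    exact fun v hv w hw => F.form_F2 hv hw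

/-- An h-dimensional integral element spans, together with its line, an isotropic subspace of
dimension h + 1. This is Lagrangian for dimension reasons, hence the F² of a flag. -/
theorem range_planeMap : range S.planeMap = integralElements S.contactSystem h := by
  refine Subset.antisymm (range_subset_iff.2 S.planeMap_mem_integralElements) ?_
  rintro g ⟨hg, hI⟩
  rw [isIntegralElement_iff] at hI
  have hf := S.finrank_planeSpan g
  obtain ⟨e, u, hu, -⟩ := S.exists_projP_eq g.base
  obtain ⟨L, rfl⟩ := S.exists_affinePlane_eq e u hu
  have hmem : affineVec e u ∈ S.planeSpan (S.affinePlane e u L) := by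
    rw [planeSpan_affinePlane]
    exact le_sup_left (α := Submodule ℂ V) (Submodule.mem_span_singleton_self _)
  let F := S.flagOfLine (affineVec e u) (affineVec_ne_zero e u)
    (S.planeSpan (S.affinePlane e u L)) hmem (by rw [hf, hg]) hI
  have hF2 : F.F2 = S.planeSpan (S.affinePlane e u L) := rfl
  refine ⟨F, ?_⟩
  rw [S.planeMap_eq e u (Submodule.mem_span_singleton_self _ : _ ∈ F.F3), hF2,
    comap_dirVec_planeSpan]

end SymplecticForm

end IntegralElements

/-! ### The infinitesimal period relation in affine charts of Ď -/

section CompactDualCalculus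

variable {V : Type*} [NormedAddCommGroup V] [NormedSpace ℂ V] {h : ℕ}

/-- The inclusion of symmetric matrices in operators, as a continuous linear map. -/
noncomputable def symOpL (n : ℕ) :
    (Sym2 (Fin n) → ℂ) →L[ℂ] (Fin n → ℂ) →L[ℂ] (Fin n → ℂ) :=
  LinearMap.toContinuousLinearMap (symOp n)

theorem hasFDerivAt_cons (x : Fin h → ℂ) :
    HasFDerivAt (fun x : Fin h → ℂ => (Fin.cons 1 x : Fin (h + 1) → ℂ)) (consZero h) x := by
  have : (fun x : Fin h → ℂ => (Fin.cons 1 x : Fin (h + 1) → ℂ)) =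
      fun x => Fin.cons 1 0 + consZero h x := by
    ext x i
    refine Fin.cases ?_ (fun i => ?_) i <;> simp
  rw [this]
  exact (consZero h).hasFDerivAt.const_add _

theorem hasFDerivAt_symOp_apply {n : ℕ} {E : Type*} [NormedAddCommGroup E] [NormedSpace ℂ E]
    {s : E → Sym2 (Fin n) → ℂ} {a : E → Fin n → ℂ} {s' : E →L[ℂ] Sym2 (Fin n) → ℂ}
    {a' : E →L[ℂ] Fin n → ℂ} {u : E} (hs : HasFDerivAt s s' u) (ha : HasFDerivAt a a' u) :
    HasFDerivAt (fun u => symOp n (s u) (a u))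
      ((symOp n (s u)).comp a' + ((symOpL n).comp s').flip (a u)) u :=
  ((symOpL n).hasFDerivAt.comp u hs).clm_apply ha

namespace SymplecticForm

variable {S : SymplecticForm V h}

/-- Symplectic coordinates, as a continuous linear map. -/
noncomputable def Frame.coordL (c : S.Frame) :
    V →L[ℂ] (Fin (h + 1) → ℂ) × (Fin (h + 1) → ℂ) :=
  haveI := S.finiteDimensional
  LinearMap.toContinuousLinearMap c.coord.toLinearMap

/-- The inverse of symplectic coordinates, as a continuous linear map. -/
noncomputable def Frame.symmL (c : S.Frame) :
    (Fin (h + 1) → ℂ) × (Fin (h + 1) → ℂ) →L[ℂ] V :=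
  LinearMap.toContinuousLinearMap c.coord.symm.toLinearMap

/-- The vector of `F³` with `a₀ = 1`, in an affine chart of `Ď`. -/
noncomputable def dualVec (c : S.Frame) (u : DualModel h) : V := graphVec c u.2 (Fin.cons 1 u.1)

theorem coord_dualVec (c : S.Frame) (u : DualModel h) :
    c.coord (dualVec c u) = (Fin.cons 1 u.1, symOp (h + 1) u.2 (Fin.cons 1 u.1)) :=
  coord_graphVec _ _ _

theorem dualVec_ne_zero (c : S.Frame) (u : DualModel h) : dualVec c u ≠ 0 := fun h0 => by
  have := coord_dualVec c u
  rw [h0, map_zero] at this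
  simpa using congrFun (congrArg Prod.fst this) 0

theorem dualP_F3 (c : S.Frame) (u : DualModel h) :
    (S.dualP c u).F3 = Submodule.span ℂ {dualVec c u} := rfl

theorem dualVec_mem_F3 (c : S.Frame) (u : DualModel h) : dualVec c u ∈ (S.dualP c u).F3 :=
  Submodule.mem_span_singleton_self _

theorem mem_dualP_F2 (c : S.Frame) (u : DualModel h) (v : V) :
    v ∈ (S.dualP c u).F2 ↔ (c.coord v).2 = symOp (h + 1) u.2 (c.coord v).1 :=
  mem_dualParam_F2 c u v

theorem hasFDerivAt_dualVec (c : S.Frame) (u : DualModel h) :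
    HasFDerivAt (dualVec c) (c.symmL.comp
      (((consZero h).comp (ContinuousLinearMap.fst ℂ (Fin h → ℂ) (Sym2 (Fin (h + 1)) → ℂ))).prod
        ((symOp (h + 1) u.2).comp ((consZero h).comp (ContinuousLinearMap.fst ℂ (Fin h → ℂ) (Sym2 (Fin (h + 1)) → ℂ))) +
          ((symOpL (h + 1)).comp (ContinuousLinearMap.snd ℂ (Fin h → ℂ) _)).flip (Fin.cons 1 u.1 : Fin (h + 1) → ℂ)))) u := by
  have h1 : HasFDerivAt (fun u : DualModel h => (Fin.cons 1 u.1 : Fin (h + 1) → ℂ))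
      ((consZero h).comp (ContinuousLinearMap.fst ℂ (Fin h → ℂ) (Sym2 (Fin (h + 1)) → ℂ))) u :=
    (hasFDerivAt_cons u.1).comp u hasFDerivAt_fst
  exact c.symmL.hasFDerivAt.comp u (h1.prodMk (hasFDerivAt_symOp_apply hasFDerivAt_snd h1))

theorem fderiv_dualVec (c : S.Frame) (u δ : DualModel h) : fderiv ℂ (dualVec c) u δ =
    c.coord.symm (Fin.cons 0 δ.1, symOp (h + 1) u.2 (Fin.cons 0 δ.1) +
      symOp (h + 1) δ.2 (Fin.cons 1 u.1)) := by
  rw [(hasFDerivAt_dualVec c u).fderiv, ← consZero_apply]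
  rfl

theorem contDiff_dualVec (c : S.Frame) : ContDiff ℂ ω (dualVec c) := by
  have h1 : ContDiff ℂ ω fun u : DualModel h => (Fin.cons 1 u.1 : Fin (h + 1) → ℂ) :=
    (contDiff_cons 1).comp contDiff_fst
  exact c.symmL.contDiff.comp
    (h1.prodMk (((contDiff_symOp _).comp contDiff_snd).clm_apply h1))

/-- The section of the line bundle `F³` with `a₀ = 1`. -/
noncomputable def dualSection (c : S.Frame) (F : S.CompactDual) : V :=
  dualVec c ((S.dualP c).chart F)

theorem dualSection_dualP (c : S.Frame) (u : DualModel h) :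
    dualSection c (S.dualP c u) = dualVec c u := by
  rw [dualSection, HolParam.chart_apply]

theorem contMDiffAt_dualSection (c : S.Frame) (u : DualModel h) :
    ContMDiffAt 𝓘(ℂ, DualModel h) 𝓘(ℂ, V) ω (dualSection c) (S.dualP c u) := by
  rw [HolParam.contMDiffAt_comp_iff]
  simp only [dualSection_dualP]
  exact (contDiff_dualVec c).contDiffAt

theorem isSectionAt_dualSection (c : S.Frame) (u : DualModel h) :
    IsSectionAt (DualModel h) (fun F : S.CompactDual => F.F3) (dualSection c) (S.dualP c u) := by
  refine ⟨contMDiffAt_dualSection c u, ?_⟩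
  rw [HolParam.eventually_iff]
  refine Eventually.of_forall fun u' => ?_
  rw [dualSection_dualP]
  exact dualVec_mem_F3 c u'

theorem vectorDeriv_dualSection (c : S.Frame) (u δ : DualModel h) :
    vectorDeriv (DualModel h) (dualSection c) (S.dualP c u) ((S.dualP c).tangentEquiv u δ) =
      c.coord.symm (Fin.cons 0 δ.1, symOp (h + 1) u.2 (Fin.cons 0 δ.1) +
      symOp (h + 1) δ.2 (Fin.cons 1 u.1)) := by
  rw [HolParam.vectorDeriv_apply _ (contMDiffAt_dualSection c u)]
  simp only [dualSection_dualP]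
  exact fderiv_dualVec c u δ

theorem IsSectionAt_F2_of_F3 {σ : S.CompactDual → V} {F : S.CompactDual}
    (hσ : IsSectionAt (DualModel h) (fun F : S.CompactDual => F.F3) σ F) :
    IsSectionAt (DualModel h) (fun F : S.CompactDual => F.F2) σ F :=
  ⟨hσ.1, hσ.2.mono fun F' hF' => F'.F3_le_F2 hF'⟩

/-- The derivative of a section of `F²`, in symplectic coordinates. -/
theorem coord_vectorDeriv_section_F2 (c : S.Frame) (u δ : DualModel h) {σ : S.CompactDual → V}
    (hσ : IsSectionAt (DualModel h) (fun F : S.CompactDual => F.F2) σ (S.dualP c u)) :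
    (c.coord (vectorDeriv (DualModel h) σ (S.dualP c u) ((S.dualP c).tangentEquiv u δ))).2 =
      symOp (h + 1) u.2 (c.coord (vectorDeriv (DualModel h) σ (S.dualP c u)
        ((S.dualP c).tangentEquiv u δ))).1 +
      symOp (h + 1) δ.2 (c.coord (σ (S.dualP c u))).1 := by
  rw [HolParam.vectorDeriv_apply _ hσ.1]
  have hd : DifferentiableAt ℂ (fun u => σ (S.dualP c u)) u :=
    (((S.dualP c).contMDiffAt_comp_iff u).1 hσ.1).differentiableAt (by simp)
  have h1 := c.coordL.hasFDerivAt.comp u hd.hasFDerivAt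
  have h2 := hasFDerivAt_symOp_apply (hasFDerivAt_snd (p := u)) h1.fst
  have h3 : (fun u => (c.coordL (σ (S.dualP c u))).2) =ᶠ[𝓝 u]
      fun u => symOp (h + 1) u.2 (c.coordL (σ (S.dualP c u))).1 :=
    (((S.dualP c).eventually_iff u).1 hσ.2).mono fun u' hu' => (mem_dualP_F2 c u' _).1 hu'
  have h4 := (h2.congr_of_eventuallyEq h3).unique h1.snd
  exact (DFunLike.congr_fun h4 δ).symm

theorem vectorDeriv_eq_zero_of_eventually {σ : S.CompactDual → V} {F : S.CompactDual}
    (hσ : ∀ᶠ F' in 𝓝 F, σ F' = 0) (v : TangentSpace 𝓘(ℂ, DualModel h) F) :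
    vectorDeriv (DualModel h) σ F v = 0 := by
  have : HasMFDerivAt 𝓘(ℂ, DualModel h) 𝓘(ℂ, V) σ F 0 :=
    (hasMFDerivAt_const (0 : V) F).congr_of_eventuallyEq hσ
  unfold vectorDeriv
  rw [this.mfderiv]
  rfl

/-- Differentiating b = s a along a section of F² gives δb = s δa + δs a. For the section of F³ with
a = (1, x), the error term δs (1, x) is the obstruction to dF³ ⊆ F². If it vanishes, then pairing
dF² with F³ gives δs (1, x) · a = 0 by symmetry of δs, so dF² ⊆ F¹ costs nothing more. -/
theorem mem_horizontal_iff (c : S.Frame) (u δ : DualModel h) :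
    (S.dualP c).tangentEquiv u δ ∈ S.horizontal (S.dualP c u) ↔
      symOp (h + 1) δ.2 (Fin.cons 1 u.1) = 0 := by
  constructor
  · intro hv
    -- Index 2 is the condition dF³ ⊆ F², the only one needed.
    have h1 := hv 2 _ (isSectionAt_dualSection c u)
    have h2 := coord_vectorDeriv_section_F2 c u δ
      (IsSectionAt_F2_of_F3 (isSectionAt_dualSection c u))
    have h3 := (mem_dualP_F2 c u _).1 h1
    rw [h3, dualSection_dualP, coord_dualVec] at h2
    simpa using h2
  · intro hδ p σ hσ
    match p, hσ with
    | 0, _ => exact Submodule.mem_top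
    | 1, hσ =>
      change _ ∈ (S.dualP c u).F1
      rw [CompactDual.F1_eq, LinearMap.BilinForm.mem_orthogonal_iff]
      intro n hn
      rw [dualP_F3] at hn
      obtain ⟨t, rfl⟩ := Submodule.mem_span_singleton.1 hn
      have h2 := coord_vectorDeriv_section_F2 c u δ hσ
      change S.form _ _ = 0
      rw [map_smul, LinearMap.smul_apply, dualVec, form_graphVec, h2]
      simp only [Pi.add_apply, add_sub_cancel_left]
      rw [symOp_symm, hδ]
      simp
    | 2, hσ =>
      change _ ∈ (S.dualP c u).F2
      have hσ' : IsSectionAt (DualModel h) (fun F : S.CompactDual => F.F3) σ (S.dualP c u) := hσ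
      have h1 : σ (S.dualP c u) ∈ (S.dualP c u).F3 := hσ'.2.self_of_nhds
      rw [dualP_F3] at h1
      obtain ⟨t, ht⟩ := Submodule.mem_span_singleton.1 h1
      rw [mem_dualP_F2, coord_vectorDeriv_section_F2 c u δ (IsSectionAt_F2_of_F3 hσ'), ← ht,
        map_smul, coord_dualVec]
      simp [hδ]
    | p + 3, hσ =>
      have h1 : ∀ᶠ F' in 𝓝 (S.dualP c u), σ F' = 0 := hσ.2.mono fun F' hF' => hF'
      rw [vectorDeriv_eq_zero_of_eventually h1]
      exact Submodule.zero_mem _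

/-- The operator `(δx, δs) ↦ δs (1, x)`, whose kernel is the horizontal space. -/
noncomputable def periodOp (u : DualModel h) : DualModel h →L[ℂ] (Fin (h + 1) → ℂ) :=
  ((symOpL (h + 1)).flip (Fin.cons 1 u.1)).comp (ContinuousLinearMap.snd ℂ _ _)

/-- The forms which generate the infinitesimal period relation in an affine chart of `Ď`. -/
noncomputable def periodForm (c : S.Frame) (i : Fin (h + 1)) :
    OneForm (DualModel h) S.CompactDual := fun F =>
  ((ContinuousLinearMap.proj (R := ℂ) (φ := fun _ : Fin (h + 1) => ℂ) i).comp
    (periodOp ((S.dualP c).chart F))).comp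
      (mfderiv 𝓘(ℂ, DualModel h) 𝓘(ℂ, DualModel h) (S.dualP c).chart F)

theorem periodForm_dualP (c : S.Frame) (i : Fin (h + 1)) (u δ : DualModel h) :
    periodForm c i (S.dualP c u) ((S.dualP c).tangentEquiv u δ) =
      symOp (h + 1) δ.2 (Fin.cons 1 u.1) i := by
  exact congrArg₂ (fun (u' w : DualModel h) => periodOp u' w i) ((S.dualP c).chart_apply u)
    ((S.dualP c).mfderiv_chart_apply u δ)

theorem holomorphicAt_periodForm {c : S.Frame} {F : S.CompactDual}
    (hc : chartAt (DualModel h) F = (S.dualP c).chart) (i : Fin (h + 1)) :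
    (periodForm c i).HolomorphicAt F := by
  have h1 : (periodForm c i).inChart F = fun u =>
      (ContinuousLinearMap.proj (R := ℂ) (φ := fun _ : Fin (h + 1) => ℂ) i).comp
        (((symOpL (h + 1)).flip (Fin.cons 1 u.1)).comp (ContinuousLinearMap.snd ℂ _ _)) := by
    ext1 u
    apply ContinuousLinearMap.ext
    intro δ
    rw [OneForm.inChart_param _ _ hc, periodForm_dualP]
    rfl
  have h2 : ContDiff ℂ ω ((periodForm c i).inChart F) := by
    rw [h1]
    exact contDiff_const.clm_comp (((symOpL (h + 1)).flip.contDiff.comp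
      ((contDiff_cons 1).comp contDiff_fst)).clm_comp contDiff_const)
  exact h2.contDiffAt.analyticAt

/-- The common kernel of these forms is the horizontal space, and a functional vanishing on the
common kernel of finitely many functionals lies in their span. -/
theorem periodRelation_dualP (c : S.Frame) (u : DualModel h) :
    S.periodRelation (S.dualP c u) =
      Submodule.span ℂ (range fun i => periodForm c i (S.dualP c u)) := by
  refine le_antisymm ?_ (Submodule.span_le.2 ?_)
  · intro α hα
    have hα' : ∀ v ∈ S.horizontal (S.dualP c u), α v = 0 := hα
    let L : Fin (h + 1) → TangentSpace 𝓘(ℂ, DualModel h) (S.dualP c u) →ₗ[ℂ] ℂ :=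
      fun i => (periodForm c i (S.dualP c u)).toLinearMap
    have hmem : α.toLinearMap ∈ Submodule.span ℂ (range L) := by
      refine mem_span_of_iInf_ker_le_ker fun v hv => ?_
      obtain ⟨δ, rfl⟩ := ((S.dualP c).tangentEquiv u).surjective v
      refine hα' _ ((mem_horizontal_iff c u δ).2 ?_)
      ext i
      rw [← periodForm_dualP c i u δ]
      exact (Submodule.mem_iInf _).1 hv i
    obtain ⟨a, ha⟩ := (Submodule.mem_span_range_iff_exists_fun ℂ).1 hmem
    refine (Submodule.mem_span_range_iff_exists_fun ℂ).2 ⟨a, ?_⟩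
    ext v
    have := LinearMap.congr_fun ha v
    simpa [L] using this
  · rintro _ ⟨i, rfl⟩ v hv
    obtain ⟨δ, rfl⟩ := ((S.dualP c).tangentEquiv u).surjective v
    have := (mem_horizontal_iff c u δ).1 hv
    change periodForm c i (S.dualP c u) ((S.dualP c).tangentEquiv u δ) = 0
    rw [periodForm_dualP, this, Pi.zero_apply]

/-- Since s ↦ s (1, x) is onto, some vertical tangent vector (0, s) has the i-th basis vector as its
values under these forms. -/
theorem linearIndependent_periodForm (c : S.Frame) (u : DualModel h) :
    LinearIndependent ℂ fun i => periodForm c i (S.dualP c u) := by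
  rw [Fintype.linearIndependent_iff]
  intro a ha i
  obtain ⟨s, hs⟩ := exists_symOp_cons_eq u.1 (Pi.single i 1)
  have h1 := DFunLike.congr_fun ha ((S.dualP c).tangentEquiv u (0, s))
  have h2 : ∀ i, periodForm c i (S.dualP c u) ((S.dualP c).tangentEquiv u (0, s)) =
      symOp (h + 1) s (Fin.cons 1 u.1) i := fun i => periodForm_dualP c i u (0, s)
  simpa [h2, hs, Pi.single_apply] using h1

variable (S) in
theorem exists_dualP_eq (F : S.CompactDual) : ∃ c u,
    F = S.dualP c u ∧ chartAt (DualModel h) (S.dualP c u) = (S.dualP c).chart := by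
  obtain ⟨c, hc⟩ := S.exists_dualP_eq_chartAt F
  have := HolParam.apply_chart_of_eq hc
  refine ⟨c, (S.dualP c).chart F, this.symm, ?_⟩
  rw [this, hc]

variable (S) in
theorem isPfaffianSystem_periodRelation : IsPfaffianSystem S.periodRelation (h + 1) := by
  intro F
  obtain ⟨c, u, rfl, hc⟩ := S.exists_dualP_eq F
  refine ⟨periodForm c, holomorphicAt_periodForm hc, ?_⟩
  rw [HolParam.eventually_iff]
  exact Eventually.of_forall fun u' => ⟨linearIndependent_periodForm c u', periodRelation_dualP c u'⟩

end SymplecticForm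

end CompactDualCalculus

/-! ### The projection π : Ď → ℙ(V), and I as the pullback of the canonical system -/

section LineMap

variable {V : Type*} [NormedAddCommGroup V] [NormedSpace ℂ V] {h : ℕ}

namespace SymplecticForm

variable (S : SymplecticForm V h)

/-- A map to `ℙ(V)` given by a nonvanishing holomorphic vector is holomorphic. -/
theorem contMDiffAt_proj_of_line {E M : Type*} [NormedAddCommGroup E] [NormedSpace ℂ E]
    [TopologicalSpace M] [ChartedSpace E M] {k : M → S.Proj} {σ : M → V} {m : M}
    (hσ : ContMDiffAt 𝓘(ℂ, E) 𝓘(ℂ, V) ω σ m) (h0 : σ m ≠ 0)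
    (hk : ∀ᶠ m' in 𝓝 m, σ m' ∈ S.line (k m')) :
    ContMDiffAt 𝓘(ℂ, E) 𝓘(ℂ, ProjModel h) ω k m := by
  have := S.finiteDimensional
  obtain ⟨e, u, hu, -⟩ := S.exists_projP_eq (k m)
  have h1 := hk.self_of_nhds
  rw [hu, line_projP] at h1
  obtain ⟨t, ht⟩ := Submodule.mem_span_singleton.1 h1
  let l : V →L[ℂ] ℂ × ProjModel h := LinearMap.toContinuousLinearMap e.toLinearMap
  have hl : ∀ v, l v = e v := fun v => rfl
  have hne : (l (σ m)).1 ≠ 0 := by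
    rw [← ht, map_smul, hl, coord_affineVec]
    rintro h2
    have h3 : t = 0 := by simpa using h2
    exact h0 (by rw [← ht, h3, zero_smul])
  have hlσ : ContMDiffAt 𝓘(ℂ, E) 𝓘(ℂ, ℂ × ProjModel h) ω (fun m => l (σ m)) m :=
    l.contDiff.contMDiff.contMDiffAt.comp m hσ
  -- Passage from homogeneous to inhomogeneous coordinates; `k` is locally this map applied to the
  -- coordinates of `σ`.
  let ψ : ℂ × ProjModel h → ProjModel h := fun q => q.1⁻¹ • q.2
  have hψ : ContDiffAt ℂ ω ψ (l (σ m)) :=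
    (contDiffAt_fst.inv hne).smul contDiffAt_snd
  have hev : k =ᶠ[𝓝 m] fun m' => S.projP e (ψ (l (σ m'))) := by
    have h2 : ∀ᶠ m' in 𝓝 m, (l (σ m')).1 ≠ 0 :=
      (continuous_fst.continuousAt.comp hlσ.continuousAt).eventually_ne hne
    filter_upwards [hk, h2] with m' hm hm'
    apply S.line_injective
    have hσ0 : σ m' ≠ 0 := fun h3 => hm' (by rw [h3, map_zero]; rfl)
    have h3 : S.line (k m') = Submodule.span ℂ {σ m'} := by
      have h4 : finrank ℂ (S.line (k m')) = 1 := Projectivization.finrank_submodule _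
      refine (Submodule.eq_of_le_of_finrank_eq ?_ ?_).symm
      · rwa [Submodule.span_singleton_le_iff_mem]
      · rw [h4, finrank_span_singleton hσ0]
    have h4 : affineVec e (ψ (l (σ m'))) = (l (σ m')).1⁻¹ • σ m' := by
      apply e.injective
      rw [coord_affineVec, map_smul]
      ext1
      · exact (inv_mul_cancel₀ hm').symm
      · rfl
    rw [h3, line_projP, h4]
    exact (Submodule.span_singleton_smul_eq (IsUnit.mk0 _ (inv_ne_zero hm')) _).symm
  refine ContMDiffAt.congr_of_eventuallyEq ?_ hev
  exact ((S.projP e).contMDiffAt _).comp m (hψ.contMDiffAt.comp m hlσ)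

theorem contMDiffAt_lineMap (F : S.CompactDual) :
    ContMDiffAt 𝓘(ℂ, DualModel h) 𝓘(ℂ, ProjModel h) ω S.lineMap F := by
  obtain ⟨c, u, rfl, -⟩ := S.exists_dualP_eq F
  refine S.contMDiffAt_proj_of_line (contMDiffAt_dualSection c u) ?_ ?_
  · rw [dualSection_dualP]
    exact dualVec_ne_zero c u
  · refine (isSectionAt_dualSection c u).2.mono fun F' hF' => ?_
    rwa [line_lineMap]

theorem contMDiff_lineMap : ContMDiff 𝓘(ℂ, DualModel h) 𝓘(ℂ, ProjModel h) ω S.lineMap :=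
  S.contMDiffAt_lineMap

theorem mdifferentiableAt_lineMap (F : S.CompactDual) :
    MDifferentiableAt 𝓘(ℂ, DualModel h) 𝓘(ℂ, ProjModel h) S.lineMap F :=
  (S.contMDiffAt_lineMap F).mdifferentiableAt (by simp)

/-- The derivative of the map `F ↦ F³`. -/
noncomputable def lineDeriv (F : S.CompactDual) : TangentSpace 𝓘(ℂ, DualModel h) F →L[ℂ]
    TangentSpace 𝓘(ℂ, ProjModel h) (S.lineMap F) :=
  mfderiv 𝓘(ℂ, DualModel h) 𝓘(ℂ, ProjModel h) S.lineMap F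

variable {S}

theorem vectorDeriv_comp {E M E' M' : Type*} [NormedAddCommGroup E] [NormedSpace ℂ E]
    [TopologicalSpace M] [ChartedSpace E M] [NormedAddCommGroup E'] [NormedSpace ℂ E']
    [TopologicalSpace M'] [ChartedSpace E' M'] {z : M' → V} {k : M → M'} {m : M}
    (hz : ContMDiffAt 𝓘(ℂ, E') 𝓘(ℂ, V) ω z (k m))
    (hk : MDifferentiableAt 𝓘(ℂ, E) 𝓘(ℂ, E') k m) (v : TangentSpace 𝓘(ℂ, E) m) :
    vectorDeriv E (z ∘ k) m v = vectorDeriv E' z (k m) (mfderiv 𝓘(ℂ, E) 𝓘(ℂ, E') k m v) :=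
  DFunLike.congr_fun (mfderiv_comp m (hz.mdifferentiableAt (by simp)) hk) v

theorem isSectionAt_comp_lineMap {z : S.Proj → V} {F : S.CompactDual}
    (hz : IsSectionAt (ProjModel h) S.line z (S.lineMap F)) :
    IsSectionAt (DualModel h) (fun F : S.CompactDual => F.F3) (z ∘ S.lineMap) F := by
  refine ⟨hz.1.comp F (S.contMDiffAt_lineMap F), ?_⟩
  refine ((S.contMDiffAt_lineMap F).continuousAt.eventually hz.2).mono fun F' hF' => ?_
  rw [line_lineMap] at hF'
  exact hF'

/-- Two nonvanishing sections of `F³` differ by a nonvanishing factor. -/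
theorem exists_section_F3_eq {σ τ : S.CompactDual → V} {F : S.CompactDual}
    (hσ : IsSectionAt (DualModel h) (fun F : S.CompactDual => F.F3) σ F)
    (hτ : IsSectionAt (DualModel h) (fun F : S.CompactDual => F.F3) τ F)
    (hσ0 : σ F ≠ 0) (hτ0 : τ F ≠ 0) :
    ∃ b : ℂ, b ≠ 0 ∧ ∀ v, ∃ t : ℂ,
      vectorDeriv (DualModel h) σ F v = t • τ F + b • vectorDeriv (DualModel h) τ F v := by
  have := S.finiteDimensional
  obtain ⟨c, u, rfl, -⟩ := S.exists_dualP_eq F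
  -- The coordinate a₀ is 1 on the normalized generator of F³, so the ratio of two sections is the
  -- ratio of their a₀.
  let l : V →L[ℂ] ℂ := (ContinuousLinearMap.proj (R := ℂ) (φ := fun _ : Fin (h + 1) => ℂ) 0).comp
    ((ContinuousLinearMap.fst ℂ _ _).comp c.coordL)
  have hl : ∀ (ρ : S.CompactDual → V) (F : S.CompactDual) u, F = S.dualP c u → ρ F ∈ F.F3 →
      ρ F = l (ρ F) • dualVec c u := by
    rintro ρ _ u rfl hρ
    rw [dualP_F3] at hρ
    obtain ⟨t, ht⟩ := Submodule.mem_span_singleton.1 hρ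
    have : l (dualVec c u) = 1 := by
      change (c.coord (dualVec c u)).1 0 = 1
      rw [coord_dualVec]
      rfl
    rw [← ht, map_smul, this, smul_eq_mul, mul_one]
  have hlσ := hl σ _ u rfl hσ.2.self_of_nhds
  have hlτ := hl τ _ u rfl hτ.2.self_of_nhds
  have hσ1 : l (σ (S.dualP c u)) ≠ 0 := fun h0 => hσ0 (by rw [hlσ, h0, zero_smul])
  have hτ1 : l (τ (S.dualP c u)) ≠ 0 := fun h0 => hτ0 (by rw [hlτ, h0, zero_smul])
  have hdσ : DifferentiableAt ℂ (fun u => l (σ (S.dualP c u))) u :=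
    l.differentiableAt.comp u
      ((((S.dualP c).contMDiffAt_comp_iff u).1 hσ.1).differentiableAt (by simp))
  have hdτ : DifferentiableAt ℂ (fun u => l (τ (S.dualP c u))) u :=
    l.differentiableAt.comp u
      ((((S.dualP c).contMDiffAt_comp_iff u).1 hτ.1).differentiableAt (by simp))
  have hdm : DifferentiableAt ℂ
      (fun u => l (σ (S.dualP c u)) * (l (τ (S.dualP c u)))⁻¹) u :=
    hdσ.fun_mul (hdτ.fun_inv hτ1)
  have hmul : ∀ᶠ u' in 𝓝 u, σ (S.dualP c u') =
      (l (σ (S.dualP c u')) * (l (τ (S.dualP c u')))⁻¹) • τ (S.dualP c u') := by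
    filter_upwards [((S.dualP c).eventually_iff u).1 hσ.2, ((S.dualP c).eventually_iff u).1 hτ.2,
      hdτ.continuousAt.eventually_ne hτ1] with u' h1 h2 h3
    have h4 := hl τ _ u' rfl h2
    conv_lhs => rw [hl σ _ u' rfl h1]
    conv_rhs => rw [h4]
    rw [smul_smul]
    congr 1
    rw [← h4]
    field_simp
  refine ⟨l (σ (S.dualP c u)) * (l (τ (S.dualP c u)))⁻¹, mul_ne_zero hσ1 (inv_ne_zero hτ1),
    fun v => ?_⟩
  exact (S.dualP c).exists_vectorDeriv_eq_of_smul hσ.1 hτ.1 hdm hmul v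

/-- Modulo the generator of F³ one may assume that a₀ = 0 on y. Then δx is chosen to match the
a-coordinates, and δs to match the b-coordinates by surjectivity of s ↦ s (1, x). This makes π a
submersion. -/
theorem exists_vectorDeriv_dualSection_eq (c : S.Frame) (u : DualModel h) (y : V) :
    ∃ v, ∃ t : ℂ, vectorDeriv (DualModel h) (dualSection c) (S.dualP c u) v =
      y + t • dualVec c u := by
  set y' := y + (-(c.coord y).1 0) • dualVec c u with hy'
  have h0 : (c.coord y').1 0 = 0 := by
    rw [hy', map_add, map_smul, coord_dualVec]
    simp
  obtain ⟨s, hs⟩ := exists_symOp_cons_eq u.1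
    ((c.coord y').2 - symOp (h + 1) u.2 (Fin.cons 0 fun i => (c.coord y').1 i.succ))
  refine ⟨(S.dualP c).tangentEquiv u (fun i => (c.coord y').1 i.succ, s), -(c.coord y).1 0, ?_⟩
  rw [← hy', vectorDeriv_dualSection]
  apply c.coord.injective
  rw [LinearEquiv.apply_symm_apply, hs]
  refine Prod.ext ?_ (by simp)
  ext i
  refine Fin.cases ?_ (fun i => ?_) i
  · simp [h0]
  · simp

/-- A section of `F³` identifies `T_ℓ ℙ(V)` with `V / ℓ`. -/
theorem exists_tangent_to_quotient {σ : S.CompactDual → V} {F : S.CompactDual}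
    (hσ : IsSectionAt (DualModel h) (fun F : S.CompactDual => F.F3) σ F) (hσ0 : σ F ≠ 0) :
    ∃ κ : TangentSpace 𝓘(ℂ, ProjModel h) (S.lineMap F) →ₗ[ℂ] V ⧸ F.F3,
      Function.Injective κ ∧
      (∀ v, F.F3.mkQ (vectorDeriv (DualModel h) σ F v) = κ (S.lineDeriv F v)) ∧
      (S.planeMap F).plane.map κ = F.F2.map F.F3.mkQ := by
  obtain ⟨e, u, hu⟩ := F.exists_affineVec_mem
  have hx := (S.lineMap_eq_projP_iff e u F).2 hu
  have hz : IsSectionAt (ProjModel h) S.line (S.affineSection e) (S.lineMap F) := by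
    rw [hx]; exact S.isSectionAt_affineSection e u
  have hzF : S.affineSection e (S.lineMap F) = affineVec e u := by rw [hx, affineSection_projP]
  have hz0 : (S.affineSection e ∘ S.lineMap) F ≠ 0 := by
    rw [Function.comp_apply, hzF]
    exact affineVec_ne_zero e u
  obtain ⟨b, hb, hd⟩ := exists_section_F3_eq hσ (isSectionAt_comp_lineMap hz) hσ0 hz0
  let D := vectorDeriv (ProjModel h) (S.affineSection e) (S.lineMap F)
  have hspan := F.F3_eq_span hu (affineVec_ne_zero e u)
  have hD : ∀ v, D v ∈ F.F3 → v = 0 := by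
    have key : ∀ x (_ : x = S.projP e u) (v : TangentSpace 𝓘(ℂ, ProjModel h) x),
        vectorDeriv (ProjModel h) (S.affineSection e) x v ∈ F.F3 → v = 0 := by
      rintro _ rfl v hv
      obtain ⟨v, rfl⟩ := ((S.projP e).tangentEquiv u).surjective v
      rw [vectorDeriv_affineSection, hspan] at hv
      obtain ⟨t, ht⟩ := Submodule.mem_span_singleton.1 hv
      have h1 := congrArg e ht
      rw [map_smul, coord_affineVec, coord_dirVec] at h1
      have h2 : t = 0 := by simpa using congrArg Prod.fst h1
      have h3 : v = 0 := by simpa [h2] using (congrArg Prod.snd h1).symm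
      rw [h3, map_zero]
    exact key _ hx
  -- The map evaluates an element of Hom(ℓ, V/ℓ) on the vector `σ F`; the factor `b` compares `σ`
  -- with the section (1, u) pulled back from ℙ(V).
  refine ⟨b • (F.F3.mkQ ∘ₗ D.toLinearMap), ?_, ?_, ?_⟩
  · rw [← LinearMap.ker_eq_bot, LinearMap.ker_eq_bot']
    intro v hv
    refine hD v ?_
    have h1 : b • F.F3.mkQ (D v) = 0 := hv
    rw [smul_eq_zero, or_iff_right hb] at h1
    exact (Submodule.Quotient.mk_eq_zero _).1 h1
  · intro v
    obtain ⟨t, ht⟩ := hd v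
    have h1 := vectorDeriv_comp hz.1 (S.mdifferentiableAt_lineMap F) v
    rw [ht, map_add, map_smul, map_smul, h1, Function.comp_apply, hzF]
    have h2 : F.F3.mkQ (affineVec e u) = 0 := (Submodule.Quotient.mk_eq_zero _).2 hu
    rw [h2, smul_zero, zero_add]
    rfl
  · have key : ∀ x (_ : x = S.projP e u), (S.planeOf x F.F2).map
        (vectorDeriv (ProjModel h) (S.affineSection e) x).toLinearMap ≤ F.F2 ∧
        ∀ w ∈ F.F2, ∃ v ∈ S.planeOf x F.F2, ∃ t : ℂ,
          w = vectorDeriv (ProjModel h) (S.affineSection e) x v + t • affineVec e u := by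
      rintro _ rfl
      constructor
      · rintro _ ⟨v, hv, rfl⟩
        exact hv _ (S.isSectionAt_affineSection e u)
      · intro w hw
        rw [S.planeOf_projP e u (F.F3_le_F2 hu)]
        refine ⟨_, ⟨(e w).2 - (e w).1 • u, ?_, rfl⟩, (e w).1, ?_⟩
        · have : dirVec e ((e w).2 - (e w).1 • u) = w - (e w).1 • affineVec e u :=
            eq_sub_of_add_eq' (eq_smul_add_dirVec e u w).symm
          change dirVec e _ ∈ F.F2
          rw [this]
          exact F.F2.sub_mem hw (F.F2.smul_mem _ (F.F3_le_F2 hu))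
        · refine (eq_smul_add_dirVec e u w).trans ?_
          rw [add_comm]
          congr 1
          exact (S.vectorDeriv_affineSection e u _).symm
    obtain ⟨h1, h2⟩ := key _ hx
    refine le_antisymm ?_ ?_
    · rintro _ ⟨v, hv, rfl⟩
      exact ⟨b • D v, F.F2.smul_mem _ (h1 ⟨v, hv, rfl⟩), by
        simp only [map_smul]; rfl⟩
    · rintro _ ⟨w, hw, rfl⟩
      obtain ⟨v, hv, t, rfl⟩ := h2 w hw
      refine ⟨b⁻¹ • v, (S.planeMap F).plane.smul_mem _ hv, ?_⟩
      have h3 : F.F3.mkQ (affineVec e u) = 0 := (Submodule.Quotient.mk_eq_zero _).2 hu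
      rw [map_add, map_smul _ t, h3, smul_zero, add_zero, map_smul]
      change b⁻¹ • b • F.F3.mkQ (D v) = _
      rw [smul_smul, inv_mul_cancel₀ hb, one_smul]

theorem lineDeriv_surjective (F : S.CompactDual) : Function.Surjective (S.lineDeriv F) := by
  obtain ⟨c, u, rfl, -⟩ := S.exists_dualP_eq F
  have hσ := isSectionAt_dualSection c u
  obtain ⟨κ, hκ, hd, -⟩ := exists_tangent_to_quotient hσ
    (by rw [dualSection_dualP]; exact dualVec_ne_zero c u)
  intro w
  obtain ⟨y, hy⟩ := (S.dualP c u).F3.mkQ_surjective (κ w)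
  obtain ⟨v, t, hv⟩ := exists_vectorDeriv_dualSection_eq c u y
  refine ⟨v, hκ ?_⟩
  have h3 : (S.dualP c u).F3.mkQ (dualVec c u) = 0 :=
    (Submodule.Quotient.mk_eq_zero _).2 (dualVec_mem_F3 c u)
  rw [← hd, hv, map_add, map_smul, h3, smul_zero, add_zero, hy]

/-- The plane is Hom(F³, F²/F³), so dπ(v) lies in it exactly when dF³(v) ⊆ F², and by
`mem_horizontal_iff` this is the whole of horizontality. -/
theorem mem_horizontal_iff_lineDeriv_mem (F : S.CompactDual)
    (v : TangentSpace 𝓘(ℂ, DualModel h) F) :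
    v ∈ S.horizontal F ↔ S.lineDeriv F v ∈ (S.planeMap F).plane := by
  constructor
  · intro hv z hz
    have h1 := hv 2 _ (isSectionAt_comp_lineMap hz)
    rw [vectorDeriv_comp hz.1 (S.mdifferentiableAt_lineMap F)] at h1
    exact h1
  · intro hv
    obtain ⟨c, u, rfl, -⟩ := S.exists_dualP_eq F
    have hσ := isSectionAt_dualSection c u
    obtain ⟨κ, hκ, hd, hm⟩ := exists_tangent_to_quotient hσ
      (by rw [dualSection_dualP]; exact dualVec_ne_zero c u)
    have h1 : (S.dualP c u).F3.mkQ (vectorDeriv (DualModel h) (dualSection c) _ v) ∈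
        (S.dualP c u).F2.map (S.dualP c u).F3.mkQ := by
      rw [← hm, hd]
      exact ⟨_, hv, rfl⟩
    obtain ⟨w, hw, hwv⟩ := h1
    have h2 : vectorDeriv (DualModel h) (dualSection c) _ v ∈ (S.dualP c u).F2 := by
      have h3 := (Submodule.Quotient.eq _).1 hwv
      have h4 := (S.dualP c u).F2.sub_mem hw ((S.dualP c u).F3_le_F2 h3)
      rwa [sub_sub_cancel] at h4
    obtain ⟨δ, rfl⟩ := ((S.dualP c).tangentEquiv u).surjective v
    rw [mem_horizontal_iff]
    have h3 := coord_vectorDeriv_section_F2 c u δ (IsSectionAt_F2_of_F3 hσ)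
    rw [(mem_dualP_F2 c u _).1 h2, dualSection_dualP, coord_dualVec] at h3
    simpa using h3

/-- A form that vanishes on the preimage of L vanishes in particular on ker T, so it descends along
T; composing with a right inverse of T produces the descended form. -/
theorem mem_annihilator_comap_iff {X Y : Type*} [AddCommGroup X] [Module ℂ X] [AddCommGroup Y]
    [Module ℂ Y] {T : X →ₗ[ℂ] Y} (hT : Function.Surjective T) (L : Submodule ℂ Y)
    (α : X →ₗ[ℂ] ℂ) : (∀ v, T v ∈ L → α v = 0) ↔ ∃ β : Y →ₗ[ℂ] ℂ, (∀ w ∈ L, β w = 0) ∧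
      α = β ∘ₗ T := by
  constructor
  · intro hα
    obtain ⟨R, hR⟩ := T.exists_rightInverse_of_surjective (LinearMap.range_eq_top.2 hT)
    have hR' : ∀ w, T (R w) = w := LinearMap.congr_fun hR
    refine ⟨α ∘ₗ R, fun w hw => hα _ (by rwa [hR']), ?_⟩
    ext v
    rw [← sub_eq_zero, LinearMap.comp_apply, LinearMap.comp_apply, ← map_sub]
    refine hα _ ?_
    rw [map_sub, hR', sub_self]
    exact L.zero_mem
  · rintro ⟨β, hβ, rfl⟩ v hv
    exact hβ _ hv

variable (S) in
-- The horizontal space is the preimage of the plane under the surjection dπ, so its annihilator is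
-- the pullback of the annihilator of the plane.
theorem periodRelation_eq_pullbackCanonical :
    S.periodRelation = pullbackCanonical S.planeMap := by
  ext F α
  have hfd : FiniteDimensional ℂ (TangentSpace 𝓘(ℂ, ProjModel h) (S.lineMap F)) :=
    inferInstanceAs (FiniteDimensional ℂ (ProjModel h))
  have h1 : α ∈ S.periodRelation F ↔
      ∀ v, S.lineDeriv F v ∈ (S.planeMap F).plane → α v = 0 :=
    forall_congr' fun v => by rw [mem_horizontal_iff_lineDeriv_mem]
  rw [h1]
  refine (mem_annihilator_comap_iff (T := (S.lineDeriv F).toLinearMap)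
    (lineDeriv_surjective F) (S.planeMap F).plane α.toLinearMap).trans ?_
  constructor
  · rintro ⟨β, hβ, hα⟩
    let β' : ProjModel h →L[ℂ] ℂ := LinearMap.toContinuousLinearMap (𝕜 := ℂ) (E := ProjModel h) β
    refine ⟨β', hβ, ?_⟩
    ext v
    exact (LinearMap.congr_fun hα v).symm
  · rintro ⟨β, hβ, rfl⟩
    exact ⟨β.toLinearMap, hβ, rfl⟩

end SymplecticForm

end LineMap

/-! ### Holomorphic retracts are submanifolds -/

section Submanifold

/-- The image of a holomorphic map with a holomorphic left inverse is a submanifold. -/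
theorem isSubmanifoldAt_of_leftInverse {D W : Type*} [NormedAddCommGroup D] [NormedSpace ℂ D]
    [NormedAddCommGroup W] [NormedSpace ℂ W] [CompleteSpace W] {γ : D → W} {ρ : W → D}
    (hγ : ContDiff ℂ ω γ) (hρ : ContDiff ℂ ω ρ) (hργ : ∀ u, ρ (γ u) = u) {X : Set W}
    (hX : ∀ w, w ∈ X ↔ γ (ρ w) = w) {a : W} (ha : a ∈ X) : IsSubmanifoldAt X a := by
  have hγd : HasFDerivAt γ (fderiv ℂ γ (ρ a)) (ρ a) :=
    (hγ.contDiffAt.differentiableAt (by simp)).hasFDerivAt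
  have hρd : HasFDerivAt ρ (fderiv ℂ ρ a) a :=
    (hρ.contDiffAt.differentiableAt (by simp)).hasFDerivAt
  set G := fderiv ℂ γ (ρ a)
  set R := fderiv ℂ ρ a
  have hRG : R.comp G = ContinuousLinearMap.id ℂ D := by
    have h1 : HasFDerivAt ρ R (γ (ρ a)) := by rwa [(hX a).1 ha]
    have h2 := h1.comp (ρ a) hγd
    have h3 : ρ ∘ γ = id := funext hργ
    rw [h3] at h2
    exact h2.unique (hasFDerivAt_id _)
  have hRG' : ∀ v, R (G v) = v := fun v => DFunLike.congr_fun hRG v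
  -- As R G = id, G R is the projection onto the tangent space range G, and `N` is the complementary
  -- projection.
  let N : W →L[ℂ] W := ContinuousLinearMap.id ℂ W - G.comp R
  have hNG : ∀ v, N (G v) = 0 := fun v => by
    change G v - G (R (G v)) = 0
    rw [hRG', sub_self]
  have hNN : ∀ w, N (w - G (R w)) = N w := fun w => by rw [map_sub, hNG, sub_zero]
  have hsplit : ∀ w, G (R w) + N w = w := fun w => add_sub_cancel _ _
  -- the straightening map
  let ψ : W → W := fun w => G (ρ w) + N (w - γ (ρ w))
  have hψ : ContDiff ℂ ω ψ :=
    (G.contDiff.comp hρ).add (N.contDiff.comp (contDiff_id.sub (hγ.comp hρ)))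
  have hψd : HasFDerivAt ψ (ContinuousLinearMap.id ℂ W) a := by
    have h1 := (G.hasFDerivAt.comp a hρd).add
      (N.hasFDerivAt.comp a ((hasFDerivAt_id a).sub (hγd.comp a hρd)))
    refine h1.congr_fderiv ?_
    ext w
    change G (R w) + N (w - G (R w)) = w
    rw [hNN, hsplit]
  -- an auxiliary map which is injective near `a`
  let η : W → W := fun w => G (ρ w) + N w
  have hη : ContDiff ℂ ω η := (G.contDiff.comp hρ).add N.contDiff
  have hηd : HasFDerivAt η (ContinuousLinearMap.id ℂ W) a := by
    have h1 := (G.hasFDerivAt.comp a hρd).add (N.hasFDerivAt (x := a))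
    refine h1.congr_fderiv ?_
    ext w
    exact hsplit w
  obtain ⟨Ψ, hΨa, hΨ, hΨ1, hΨ2⟩ := exists_openPartialHomeomorph_of_bijective
    (hψ.contDiffAt (x := a)) (by rw [hψd.fderiv]; exact Function.bijective_id)
  obtain ⟨Η, hΗa, hΗ, -, -⟩ := exists_openPartialHomeomorph_of_bijective
    (hη.contDiffAt (x := a)) (by rw [hηd.fderiv]; exact Function.bijective_id)
  have hcont : Continuous fun w => γ (ρ w) := hγ.continuous.comp hρ.continuous
  -- Both w and its retraction γ(ρ w) must lie where the auxiliary map is injective.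
  let s : Set W := Η.source ∩ (fun w => γ (ρ w)) ⁻¹' Η.source
  have hs : IsOpen s := Η.open_source.inter (hcont.isOpen_preimage _ Η.open_source)
  have has : a ∈ s := ⟨hΗa, by
    change γ (ρ a) ∈ Η.source
    rwa [(hX a).1 ha]⟩
  refine ⟨Ψ.restrOpen s hs, LinearMap.range G.toLinearMap, ⟨hΨa, has⟩,
    hΨ1.mono inter_subset_left, ?_, ?_⟩
  · refine hΨ2.mono ?_
    intro w hw
    exact hw.1
  · rintro w ⟨-, hw1, hw2⟩
    change w ∈ X ↔ Ψ w ∈ _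
    rw [hΨ, hX]
    constructor
    · intro hw
      refine ⟨ρ w, ?_⟩
      change G (ρ w) = G (ρ w) + N (w - γ (ρ w))
      rw [hw, sub_self, map_zero, add_zero]
    -- Applying the idempotent N to ψ(w) ∈ range G leaves N(w - γ(ρ w)) = 0. Since ρ ∘ γ = id, the
    -- points w and γ(ρ w) then have equal images under η, so they coincide.
    · rintro ⟨v, hv⟩
      have hv' : G v = G (ρ w) + N (w - γ (ρ w)) := hv
      have h1 : N (w - γ (ρ w)) = 0 := by
        have h2 := congrArg N hv'
        have h3 : ∀ w, N (N w) = N w := fun w => hNN w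
        rw [map_add, hNG, hNG, zero_add, h3] at h2
        exact h2.symm
      rw [map_sub, sub_eq_zero] at h1
      refine Η.injOn hw2 hw1 ?_
      rw [hΗ]
      change G (ρ (γ (ρ w))) + N (γ (ρ w)) = G (ρ w) + N w
      rw [hργ, h1]

end Submanifold

/-! ### Affine coordinates on Grassmann bundles -/

section GraphCoordinates

/-- Affine coordinates on the space of pairs of a point of `E` and a linear map between complementary
subspaces `P`, `K` of `E`. -/
theorem exists_graph_coordinates {E X Y : Type*} [NormedAddCommGroup E] [NormedSpace ℂ E]
    [NormedAddCommGroup X] [NormedSpace ℂ X] [NormedAddCommGroup Y] [NormedSpace ℂ Y]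
    [FiniteDimensional ℂ E] [FiniteDimensional ℂ X] [FiniteDimensional ℂ Y]
    (j : E ≃ₗ[ℂ] Y × X) (u : E) (P : Submodule ℂ E) (hP : ∀ v, v ∈ P ↔ (j v).2 = 0) :
    ∃ K : Submodule ℂ E, IsCompl P K ∧ ∃ (J : (Y × X) × (Y →L[ℂ] X) → E × (P →L[ℂ] K))
      (J' : E × (P →L[ℂ] K) → (Y × X) × (Y →L[ℂ] X)), ContDiff ℂ ω J ∧ ContDiff ℂ ω J' ∧
      (∀ q, J' (J q) = q) ∧ (∀ w, J (J' w) = w) ∧ J 0 = (u, 0) ∧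
      (∀ q, (J q).1 = u + j.symm q.1) ∧
      ∀ q, LinearMap.range (P.subtype + K.subtype ∘ₗ (J q).2.toLinearMap) =
        LinearMap.range (j.symm.toLinearMap ∘ₗ LinearMap.prod LinearMap.id q.2.toLinearMap) := by
  -- P is the factor Y of the splitting given by `j`. Taking K to be the factor X turns graphs of
  -- maps P → K into graphs of maps Y → X.
  let K : Submodule ℂ E := LinearMap.ker (LinearMap.fst ℂ Y X ∘ₗ j.toLinearMap)
  have hK : ∀ v, v ∈ K ↔ (j v).1 = 0 := fun v => Iff.rfl
  let jP : P ≃ₗ[ℂ] Y :=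
    { toFun := fun v => (j v).1
      map_add' := fun v w => by simp
      map_smul' := fun c v => by simp
      invFun := fun y => ⟨j.symm (y, 0), by rw [hP]; simp⟩
      left_inv := fun v => Subtype.ext (j.injective (by
        rw [LinearEquiv.apply_symm_apply]
        exact Prod.ext rfl ((hP v).1 v.2).symm))
      right_inv := fun y => by simp }
  let jK : K ≃ₗ[ℂ] X :=
    { toFun := fun v => (j v).2
      map_add' := fun v w => by simp
      map_smul' := fun c v => by simp
      invFun := fun y => ⟨j.symm (0, y), by rw [hK]; simp⟩
      left_inv := fun v => Subtype.ext (j.injective (by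
        rw [LinearEquiv.apply_symm_apply]
        exact Prod.ext ((hK v).1 v.2).symm rfl))
      right_inv := fun y => by simp }
  let cj := j.toContinuousLinearEquiv
  let cP := jP.toContinuousLinearEquiv
  let cK := jK.toContinuousLinearEquiv
  refine ⟨K, ?_, fun q => (u + cj.symm q.1,
      (cK.symm : X →L[ℂ] K).comp (q.2.comp (cP : P →L[ℂ] Y))),
    fun w => (cj (w.1 - u), (cK : K →L[ℂ] X).comp (w.2.comp (cP.symm : Y →L[ℂ] P))),
    ?_, ?_, ?_, ?_, ?_, ?_, ?_⟩
  · refine ⟨disjoint_iff.2 (eq_bot_iff.2 ?_), codisjoint_iff.2 (eq_top_iff.2 ?_)⟩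
    · rintro v ⟨h1, h2⟩
      have h3 : j v = 0 := Prod.ext ((hK v).1 h2) ((hP v).1 h1)
      exact (Submodule.mem_bot ℂ).2 (j.map_eq_zero_iff.1 h3)
    · intro v _
      refine Submodule.mem_sup.2 ⟨j.symm ((j v).1, 0), ?_, j.symm (0, (j v).2), ?_, ?_⟩
      · rw [hP]; simp
      · rw [hK]; simp
      · rw [← map_add]; simp
  · fun_prop
  · fun_prop
  · intro q
    refine Prod.ext (by simp) ?_
    ext y
    simp
  · intro w
    refine Prod.ext (by simp) ?_
    ext y
    simp
  · refine Prod.ext ?_ ?_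
    · change u + cj.symm 0 = u
      rw [map_zero, add_zero]
    · change (cK.symm : X →L[ℂ] K).comp ((0 : Y →L[ℂ] X).comp (cP : P →L[ℂ] Y)) = 0
      ext y
      simp
  · intro q
    rfl
  · intro q
    have key : ∀ v : P, (v : E) + (jK.symm (q.2 (jP v)) : K) = j.symm (jP v, q.2 (jP v)) := by
      intro v
      apply j.injective
      rw [map_add, LinearEquiv.apply_symm_apply]
      change j v + j (j.symm (0, q.2 (jP v))) = _
      rw [LinearEquiv.apply_symm_apply]
      refine Prod.ext ?_ ?_
      · simp [jP]
      · simp [(hP v).1 v.2]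
    ext w
    constructor
    · rintro ⟨v, rfl⟩
      exact ⟨jP v, (key v).symm⟩
    · rintro ⟨y, rfl⟩
      refine ⟨jP.symm y, (key _).trans ?_⟩
      rw [LinearEquiv.apply_symm_apply]
      rfl

end GraphCoordinates

/-! ### Ď as the first prolongation of the contact system -/

section Prolongation

theorem TangentPlane.param_eq {E M : Type*} [NormedAddCommGroup E] [NormedSpace ℂ E]
    [TopologicalSpace M] [ChartedSpace E M] (g : TangentPlane E M)
    {p : HolParam E M} (hp : chartAt E g.base = p.chart) (K : Submodule ℂ E)
    (q : E × (g.coordPlane →L[ℂ] K)) : g.param K q = ⟨p q.1,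
      (LinearMap.range (g.coordPlane.subtype + K.subtype ∘ₗ q.2.toLinearMap)).map
        (p.tangentEquiv q.1).toLinearMap⟩ := by
  have key : ∀ (φ : E → M) (_ : φ = p) (R : Submodule ℂ E),
      (⟨φ q.1, R.map (mfderiv 𝓘(ℂ, E) 𝓘(ℂ, E) φ q.1).toLinearMap⟩ : TangentPlane E M) =
        ⟨p q.1, R.map (p.tangentEquiv q.1).toLinearMap⟩ := by
    rintro _ rfl R
    rfl
  exact key _ (HolParam.extChartAt_symm_eq hp) _

variable {V : Type*} [NormedAddCommGroup V] [NormedSpace ℂ V] {h : ℕ}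

namespace SymplecticForm

variable (S : SymplecticForm V h)

theorem coordPlane_affinePlane {e : V ≃ₗ[ℂ] ℂ × ProjModel h} {u : ProjModel h}
    (he : chartAt (ProjModel h) (S.projP e u) = (S.projP e).chart)
    (L : Submodule ℂ (ProjModel h)) : (S.affinePlane e u L).coordPlane = L := by
  have h1 : (S.projP e).tangentEquiv u = LinearEquiv.refl ℂ (ProjModel h) := by
    ext1 v
    exact (S.projP e).tangentEquiv_eq_self he v
  change L.map ((S.projP e).tangentEquiv u).toLinearMap = L
  rw [h1]
  exact Submodule.map_id L

variable {S}

/-- Coordinates on the Grassmann bundle near the image of a flag, in which the integral elements are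
the isotropic jets. -/
theorem exists_prolongation_coordinates (F : S.CompactDual) :
    ∃ (c : S.Frame) (K : Submodule ℂ (ProjModel h)), S.dualP c 0 = F ∧
      IsCompl (S.planeMap F).coordPlane K ∧
      ∃ (J : JetSpace h → ProjModel h × ((S.planeMap F).coordPlane →L[ℂ] K))
        (J' : ProjModel h × ((S.planeMap F).coordPlane →L[ℂ] K) → JetSpace h),
        ContDiff ℂ ω J ∧ ContDiff ℂ ω J' ∧ (∀ q, J' (J q) = q) ∧ (∀ w, J (J' w) = w) ∧
        J 0 = (S.planeMap F).center K ∧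
        (∀ q, (S.planeMap F).param K (J q) ∈ integralElements S.contactSystem h ↔
          IsIsotropicJet q) ∧
        ∀ u, S.planeMap (S.dualP c u) = (S.planeMap F).param K (J (paramJet u)) := by
  obtain ⟨e, u₀, hu₀, he⟩ := S.exists_projP_eq (S.lineMap F)
  have hF3 := (S.lineMap_eq_projP_iff e u₀ F).1 hu₀
  -- The frame is adapted to the preferred affine chart: its a₀ is the denominator of that chart, so
  -- the vectors (1, u) have a₀ = 1 and the directions (0, v) have a₀ = 0.
  obtain ⟨c, hc0, hcz, hca⟩ := exists_frame_of_functional F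
    (LinearMap.fst ℂ _ _ ∘ₗ e.toLinearMap) hF3 (by
      change (e (affineVec e u₀)).1 = 1
      rw [coord_affineVec])
  have hca' : ∀ v, (c.coord v).1 0 = (e v).1 := hca
  rw [S.planeMap_eq e u₀ hF3]
  have hP := S.coordPlane_affinePlane he (F.F2.comap (dirVec e).toLinearMap)
  generalize hg : S.affinePlane e u₀ (F.F2.comap (dirVec e).toLinearMap) = g at hP ⊢
  have hgb : chartAt (ProjModel h) g.base = (S.projP e).chart := by rw [← hg]; exact he
  have hgc : extChartAt 𝓘(ℂ, ProjModel h) g.base g.base = u₀ := by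
    rw [HolParam.extChartAt_eq hgb, ← hg]
    exact (S.projP e).chart_apply u₀
  -- the coordinates `(a', b)` on `T_x ℙ(V)`
  let j₀ : ProjModel h →ₗ[ℂ] (Fin h → ℂ) × (Fin (h + 1) → ℂ) :=
    LinearMap.prod (LinearMap.pi fun i => LinearMap.proj i.succ ∘ₗ LinearMap.fst ℂ _ _ ∘ₗ
      c.coord.toLinearMap ∘ₗ (dirVec e).toLinearMap)
      (LinearMap.snd ℂ _ _ ∘ₗ c.coord.toLinearMap ∘ₗ (dirVec e).toLinearMap)
  have hj₀ : ∀ v, c.coord (dirVec e v) = (Fin.cons 0 (j₀ v).1, (j₀ v).2) := by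
    intro v
    refine Prod.ext ?_ rfl
    ext i
    refine Fin.cases ?_ (fun i => rfl) i
    rw [hca', coord_dirVec]
    rfl
  have hinj : Function.Injective j₀ := by
    intro v w hvw
    refine dirVec_injective e (c.coord.injective ?_)
    rw [hj₀, hj₀, hvw]
  let j := LinearEquiv.ofInjectiveOfFinrankEq j₀ hinj (by simp; omega)
  have hj : ∀ v, c.coord (dirVec e v) = (Fin.cons 0 (j v).1, (j v).2) := hj₀
  have hj' : ∀ q, c.coord (dirVec e (j.symm q)) = (Fin.cons 0 q.1, q.2) := fun q => by
    rw [hj, LinearEquiv.apply_symm_apply]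
  obtain ⟨K, hK, J, J', hJ, hJ', hJJ', hJ'J, hJ0, hJ1, hJ2⟩ := exists_graph_coordinates j u₀
    g.coordPlane (fun v => by
      rw [hP, Submodule.mem_comap, ← hc0]
      change dirVec e v ∈ (S.dualP c 0).F2 ↔ _
      rw [mem_dualP_F2, hj]
      simp)
  let L : JetSpace h → Submodule ℂ (ProjModel h) := fun q =>
    LinearMap.range (j.symm.toLinearMap ∘ₗ LinearMap.prod LinearMap.id q.2.toLinearMap)
  have hmemL : ∀ q a, j.symm (a, q.2 a) ∈ L q := fun q a => ⟨a, rfl⟩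
  have hLmem : ∀ q v, v ∈ L q → ∃ a, v = j.symm (a, q.2 a) := by
    rintro q _ ⟨a, rfl⟩
    exact ⟨a, rfl⟩
  -- The jet ((x, b), A) stands for the point with vector ((1, x), b) and the plane of directions
  -- ((0, a), A a).
  have hparam : ∀ q, g.param K (J q) = S.affinePlane e (u₀ + j.symm q.1) (L q) := by
    intro q
    rw [TangentPlane.param_eq g hgb, hJ2, hJ1]
    rfl
  have hvec : ∀ q : (Fin h → ℂ) × (Fin (h + 1) → ℂ),
      c.coord (affineVec e (u₀ + j.symm q)) = (Fin.cons 1 q.1, q.2) := by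
    intro q
    rw [affineVec_eq e u₀, add_sub_cancel_left, map_add, hj', hcz]
    refine Prod.ext ?_ (by simp)
    ext i
    refine Fin.cases ?_ (fun i => ?_) i <;> simp
  refine ⟨c, K, hc0, hK, J, J', hJ, hJ', hJJ', hJ'J, ?_, ?_, ?_⟩
  · rw [hJ0, TangentPlane.center, hgc]
  · intro q
    have hfr : finrank ℂ (L q) = h := by
      rw [LinearMap.finrank_range_of_inj]
      · simp
      · intro a a' haa
        exact congrArg Prod.fst (j.symm.injective haa)
    rw [hparam]
    have h1 : ∀ a, S.form (dirVec e (j.symm (a, q.2 a))) (affineVec e (u₀ + j.symm q.1)) =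
        ∑ i, q.1.2 (Fin.succ i) * a i - ∑ i, (Fin.cons 1 q.1.1 : Fin (h + 1) → ℂ) i * q.2 a i := by
      intro a
      rw [c.form_eq, hj', hvec, Finset.sum_sub_distrib]
      congr 1
      · rw [Fin.sum_univ_succ]
        simp [mul_comm]
      · simp only [mul_comm]
    have h2 : ∀ a a', S.form (dirVec e (j.symm (a', q.2 a'))) (dirVec e (j.symm (a, q.2 a))) =
        ∑ i, a' i * q.2 a (Fin.succ i) - ∑ i, q.2 a' (Fin.succ i) * a i := by
      intro a a'
      rw [c.form_eq, hj', hj', Finset.sum_sub_distrib]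
      congr 1
      · rw [Fin.sum_univ_succ]
        simp
      · rw [Fin.sum_univ_succ]
        simp
    have h3 : S.affinePlane e (u₀ + j.symm q.1) (L q) ∈ integralElements S.contactSystem h ↔
        IsIntegralElement S.contactSystem (S.affinePlane e (u₀ + j.symm q.1) (L q)) := by
      refine ⟨fun h => h.2, fun h => ⟨?_, h⟩⟩
      rw [finrank_affinePlane, hfr]
    rw [h3, isIntegralElement_iff, planeSpan_isotropic_iff]
    constructor
    · rintro ⟨h4, h5⟩
      refine ⟨fun a => ?_, fun a a' => ?_⟩
      · have := h4 _ (hmemL q a)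
        rw [h1, sub_eq_zero] at this
        exact this.symm
      · have := h5 _ (hmemL q a') _ (hmemL q a)
        rw [h2, sub_eq_zero] at this
        exact this
    · rintro ⟨h4, h5⟩
      constructor
      · intro v hv
        obtain ⟨a, rfl⟩ := hLmem q v hv
        rw [h1, h4, sub_self]
      · intro v hv w hw
        obtain ⟨a', rfl⟩ := hLmem q v hv
        obtain ⟨a, rfl⟩ := hLmem q w hw
        rw [h2, h5, sub_self]
  · intro u
    rw [hparam]
    have h1 : affineVec e (u₀ + j.symm (paramJet u).1) = dualVec c u := by
      apply c.coord.injective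
      rw [hvec, coord_dualVec]
      rfl
    rw [S.planeMap_eq e (u₀ + j.symm (paramJet u).1) (by rw [h1]; exact dualVec_mem_F3 c u)]
    congr 1
    ext v
    have h2 : v ∈ (S.dualP c u).F2.comap (dirVec e).toLinearMap ↔
        (j v).2 = (paramJet u).2 (j v).1 := by
      change dirVec e v ∈ (S.dualP c u).F2 ↔ _
      rw [mem_dualP_F2, hj, paramJet, ContinuousLinearMap.comp_apply, consZero_apply]
    rw [h2]
    constructor
    · intro hv
      refine ⟨(j v).1, j.injective ?_⟩
      change j (j.symm ((j v).1, (paramJet u).2 (j v).1)) = _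
      rw [LinearEquiv.apply_symm_apply, ← hv]
    · intro hv
      obtain ⟨a, rfl⟩ := hLmem _ v hv
      rw [LinearEquiv.apply_symm_apply]

theorem paramJet_zero : paramJet (0 : DualModel h) = 0 := by
  refine Prod.ext (Prod.ext rfl ?_) ?_
  · change symOp (h + 1) 0 (Fin.cons 1 0) = 0
    rw [map_zero, zero_apply]
  · change (symOp (h + 1) 0).comp (consZero h) = 0
    rw [map_zero, ContinuousLinearMap.zero_comp]

variable (S) in
-- In jet coordinates the map is u ↦ J(paramJet u) and its image is the set of isotropic jets. The
-- polynomial left inverse `jetParam` gives smoothness of that image, injectivity of the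
-- differential and continuity of the inverse.
theorem isFirstProlongation_planeMap :
    IsFirstProlongation h S.contactSystem S.periodRelation S.planeMap where
  injective := S.planeMap_injective
  range_eq := by
    refine Subset.antisymm ?_ (fun g hg => by rw [range_planeMap]; exact hg.1)
    rintro _ ⟨F, rfl⟩
    refine ⟨S.planeMap_mem_integralElements F, ?_⟩
    obtain ⟨c, K, hc, hK, J, J', hJ, hJ', hJJ', hJ'J, hJ0, hJI, hJP⟩ :=
      exists_prolongation_coordinates F
    -- A jet is isotropic exactly when it is fixed by the retraction `paramJet ∘ jetParam`.
    refine ⟨K, hK, isSubmanifoldAt_of_leftInverse (γ := fun u => J (paramJet u))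
      (ρ := fun w => jetParam (J' w)) (hJ.comp contDiff_paramJet) (contDiff_jetParam.comp hJ')
      (fun u => by rw [hJJ', jetParam_paramJet]) (fun w => ?_) ?_⟩
    · obtain ⟨q, rfl⟩ : ∃ q, J q = w := ⟨J' w, hJ'J w⟩
      change (S.planeMap F).param K (J q) ∈ integralElements S.contactSystem h ↔ _
      rw [hJI, hJJ']
      constructor
      · intro hq
        rw [paramJet_jetParam hq]
      · intro hq
        have h1 := congrArg J' hq
        rw [hJJ', hJJ'] at h1
        rw [← h1]
        exact isIsotropicJet_paramJet _
    · change (S.planeMap F).param K _ ∈ integralElements S.contactSystem h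
      rw [← hJ0, hJI, ← paramJet_zero]
      exact isIsotropicJet_paramJet _
  biholomorphic F := by
    obtain ⟨c, K, rfl, hK, J, J', hJ, hJ', hJJ', hJ'J, hJ0, hJI, hJP⟩ :=
      exists_prolongation_coordinates F
    have hJu : ContDiff ℂ ω fun u => J (paramJet u) := hJ.comp contDiff_paramJet
    have hsrc := (S.dualP c).mem_source 0
    have hγ : ContMDiffAt 𝓘(ℂ, DualModel h)
        𝓘(ℂ, ProjModel h × ((S.planeMap (S.dualP c 0)).coordPlane →L[ℂ] K)) ω
        (fun F' => J (paramJet ((S.dualP c).chart F'))) (S.dualP c 0) :=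
      hJu.contMDiff.contMDiffAt.comp _ ((S.dualP c).contMDiffAt_chart hsrc)
    have hγ0 : J (paramJet ((S.dualP c).chart (S.dualP c 0))) =
        (S.planeMap (S.dualP c 0)).center K := by
      rw [HolParam.chart_apply, paramJet_zero, hJ0]
    refine ⟨K, hK, fun F' => J (paramJet ((S.dualP c).chart F')), hγ0, ?_, hγ, ?_, ?_⟩
    · filter_upwards [(S.dualP c).eventually_apply_chart 0] with F' hF'
      rw [← hJP, hF']
    -- Composing with the left inverse gives the chart of Ď itself, whose derivative is invertible.
    · have hρ : ContDiff ℂ ω fun w => jetParam (J' w) := contDiff_jetParam.comp hJ'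
      have h1 := mfderiv_comp (S.dualP c 0)
        (hρ.contMDiff.contMDiffAt.mdifferentiableAt (by simp)) (hγ.mdifferentiableAt (by simp))
      have h2 : (fun w => jetParam (J' w)) ∘ (fun F' => J (paramJet ((S.dualP c).chart F'))) =
          (S.dualP c).chart := by
        ext1 F'
        simp only [Function.comp_apply]
        rw [hJJ', jetParam_paramJet]
      rw [h2] at h1
      intro v w hvw
      refine ((S.dualP c).tangentEquiv 0).symm.injective ?_
      change mfderiv 𝓘(ℂ, DualModel h) 𝓘(ℂ, DualModel h) (S.dualP c).chart (S.dualP c 0) v =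
        mfderiv 𝓘(ℂ, DualModel h) 𝓘(ℂ, DualModel h) (S.dualP c).chart (S.dualP c 0) w
      rw [h1]
      exact congrArg (mfderiv 𝓘(ℂ, ProjModel h × ((S.planeMap (S.dualP c 0)).coordPlane →L[ℂ] K))
        𝓘(ℂ, DualModel h) (fun w => jetParam (J' w)) _) hvw
    · intro N hN
      -- This continuous map recovers the flag from an integral element, so nearby integral elements
      -- come from flags in `N`.
      have h1 : Continuous fun w => S.dualP c (jetParam (J' w)) :=
        (S.dualP c).continuous.comp (contDiff_jetParam.continuous.comp hJ'.continuous)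
      have h2 : S.dualP c (jetParam (J' (J (paramJet ((S.dualP c).chart (S.dualP c 0)))))) =
          S.dualP c 0 := by
        rw [hJJ', jetParam_paramJet, HolParam.chart_apply]
      have h3 : ∀ᶠ w in 𝓝 (J (paramJet ((S.dualP c).chart (S.dualP c 0)))),
          S.dualP c (jetParam (J' w)) ∈ N :=
        h1.continuousAt.eventually (by
            rw [← h2] at hN
            exact hN)
      filter_upwards [h3] with w hw hwI
      refine ⟨_, hw, ?_⟩
      obtain ⟨q, rfl⟩ : ∃ q, J q = w := ⟨J' w, hJ'J w⟩
      rw [hJI] at hwI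
      rw [hJP, hJJ', paramJet_jetParam hwI]
  system_eq := S.periodRelation_eq_pullbackCanonical

end SymplecticForm

end Prolongation

/-! ### Calabi–Yau type, and the common criterion `IsLiftAt` -/

section CalabiYau

variable {V : Type*} [NormedAddCommGroup V] [NormedSpace ℂ V] {h : ℕ}
  {E N : Type*} [NormedAddCommGroup E] [NormedSpace ℂ E] [TopologicalSpace N] [ChartedSpace E N]

namespace SymplecticForm

variable {S : SymplecticForm V h}

variable (E) in
/-- The composite `π ∘ f` of `f` with `π : F ↦ F³` is an immersion at `n`, with tangent space the
plane of `ℙ(V)` determined by the flag `f n`. -/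
def IsLiftAt (f : N → S.CompactDual) (n : N) : Prop :=
  let T : TangentSpace 𝓘(ℂ, E) n →L[ℂ] TangentSpace 𝓘(ℂ, ProjModel h) (S.lineMap (f n)) :=
    mfderiv 𝓘(ℂ, E) 𝓘(ℂ, ProjModel h) (S.lineMap ∘ f) n
  Function.Injective T ∧ LinearMap.range T.toLinearMap = (S.planeMap (f n)).plane

theorem mfderiv_lineMap_comp {f : N → S.CompactDual} {n : N}
    (hf : MDifferentiableAt 𝓘(ℂ, E) 𝓘(ℂ, DualModel h) f n) (v : TangentSpace 𝓘(ℂ, E) n) :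
    mfderiv 𝓘(ℂ, E) 𝓘(ℂ, ProjModel h) (S.lineMap ∘ f) n v =
      S.lineDeriv (f n) (mfderiv 𝓘(ℂ, E) 𝓘(ℂ, DualModel h) f n v) :=
  DFunLike.congr_fun (mfderiv_comp n (S.mdifferentiableAt_lineMap (f n)) hf) v

/-- The Calabi–Yau map δ is κ ∘ d(π ∘ f), where κ embeds T_ℓ ℙ(V) in V/ℓ and carries the plane onto
F²/F³. Injectivity and image can thus be tested before or after κ. -/
theorem isLiftAt_iff {f : N → S.CompactDual} {n : N}
    (hf : MDifferentiableAt 𝓘(ℂ, E) 𝓘(ℂ, DualModel h) f n) {σ : S.CompactDual → V}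
    (hσ : IsSectionAt (DualModel h) (fun F : S.CompactDual => F.F3) σ (f n)) (hσ0 : σ (f n) ≠ 0) :
    IsLiftAt E f n ↔
      let δ : TangentSpace 𝓘(ℂ, E) n →ₗ[ℂ] V ⧸ (f n).F3 := (f n).F3.mkQ ∘ₗ
        (vectorDeriv (DualModel h) σ (f n)).toLinearMap ∘ₗ
          (mfderiv 𝓘(ℂ, E) 𝓘(ℂ, DualModel h) f n).toLinearMap
      Function.Injective δ ∧ LinearMap.range δ = Submodule.map (f n).F3.mkQ (f n).F2 := by
  obtain ⟨κ, hκ, hd, hm⟩ := exists_tangent_to_quotient hσ hσ0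
  let δ : TangentSpace 𝓘(ℂ, E) n →ₗ[ℂ] V ⧸ (f n).F3 := (f n).F3.mkQ ∘ₗ
    (vectorDeriv (DualModel h) σ (f n)).toLinearMap ∘ₗ
      (mfderiv 𝓘(ℂ, E) 𝓘(ℂ, DualModel h) f n).toLinearMap
  change IsLiftAt E f n ↔ Function.Injective δ ∧ LinearMap.range δ = _
  let T : TangentSpace 𝓘(ℂ, E) n →L[ℂ] TangentSpace 𝓘(ℂ, ProjModel h) (S.lineMap (f n)) :=
    mfderiv 𝓘(ℂ, E) 𝓘(ℂ, ProjModel h) (S.lineMap ∘ f) n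
  have hδ : δ = κ ∘ₗ T.toLinearMap := by
    ext v
    exact (hd _).trans (congrArg κ (mfderiv_lineMap_comp hf v).symm)
  rw [hδ, LinearMap.range_comp, ← hm]
  exact and_congr (hκ.of_comp_iff T).symm (Submodule.map_injective_of_injective hκ).eq_iff.symm

theorem isCalabiYauType_iff {f : N → S.CompactDual}
    (hf : MDifferentiable 𝓘(ℂ, E) 𝓘(ℂ, DualModel h) f) :
    IsCalabiYauType (E := E) f ↔ ∀ n, IsLiftAt E f n := by
  refine forall_congr' fun n => ⟨?_, fun hn => ?_⟩
  · rintro ⟨σ, hσ, hσ0, hδ⟩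
    exact (isLiftAt_iff (hf n) hσ hσ0).2 hδ
  · obtain ⟨c, u, hu, -⟩ := S.exists_dualP_eq (f n)
    have hσ := isSectionAt_dualSection c u
    have hσ0 : dualSection c (S.dualP c u) ≠ 0 := by
      rw [dualSection_dualP]
      exact dualVec_ne_zero c u
    rw [← hu] at hσ hσ0
    exact ⟨_, hσ, hσ0, (isLiftAt_iff (hf n) hσ hσ0).1 hn⟩

/-- The criterion contains integrality: d(π ∘ f) = dπ ∘ df injective makes df injective, and its
image lying in the plane makes df horizontal. -/
theorem isIntegralManifold_and_isCalabiYauType_iff {f : N → S.CompactDual}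
    (hf : ContMDiff 𝓘(ℂ, E) 𝓘(ℂ, DualModel h) ω f) :
    IsIntegralManifold (E := E) S.periodRelation f ∧ IsCalabiYauType (E := E) f ↔
      ∀ n, IsLiftAt E f n := by
  have hd : MDifferentiable 𝓘(ℂ, E) 𝓘(ℂ, DualModel h) f := hf.mdifferentiable (by simp)
  rw [isCalabiYauType_iff hd]
  refine ⟨fun h => h.2, fun hl => ⟨⟨hf, fun n => ⟨fun v w hvw => (hl n).1 ?_, fun α hα => ?_⟩⟩, hl⟩⟩
  · refine (mfderiv_lineMap_comp (hd n) v).trans (Eq.trans ?_ (mfderiv_lineMap_comp (hd n) w).symm)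
    exact congrArg (S.lineDeriv (f n)) hvw
  · ext v
    refine hα _ ?_
    rw [mem_horizontal_iff_lineDeriv_mem, ← (hl n).2]
    exact ⟨v, mfderiv_lineMap_comp (hd n) v⟩

/-- The contact forms vanish on the plane of `ℙ(V)` determined by a flag. -/
theorem contactSystem_eq_zero_of_mem_plane (F : S.CompactDual)
    {α : TangentSpace 𝓘(ℂ, ProjModel h) (S.lineMap F) →L[ℂ] ℂ}
    (hα : α ∈ S.contactSystem (S.lineMap F)) {v : TangentSpace 𝓘(ℂ, ProjModel h) (S.lineMap F)}
    (hv : v ∈ (S.planeMap F).plane) : α v = 0 := by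
  induction hα using Submodule.span_induction with
  | mem α hα =>
    obtain ⟨z, hz, hαz⟩ := hα
    rw [hαz]
    refine F.form_F2 (hv z hz) (F.F3_le_F2 ?_)
    have := hz.2.self_of_nhds
    rwa [line_lineMap] at this
  | zero => rfl
  | add α β _ _ h1 h2 => rw [add_apply, h1, h2, add_zero]
  | smul c α _ h1 => rw [smul_apply, h1, smul_zero]

theorem planeMap_eq_canonicalLift_iff (f : N → S.CompactDual) (n : N) :
    S.planeMap (f n) = canonicalLift (E' := E) (S.lineMap ∘ f) n ↔
      LinearMap.range (mfderiv 𝓘(ℂ, E) 𝓘(ℂ, ProjModel h) (S.lineMap ∘ f) n).toLinearMap =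
        (S.planeMap (f n)).plane := by
  have key : ∀ (x : S.Proj) (P P' : Submodule ℂ (TangentSpace 𝓘(ℂ, ProjModel h) x)),
      (⟨x, P⟩ : TangentPlane (ProjModel h) S.Proj) = ⟨x, P'⟩ ↔ P' = P := by
    intro x P P'
    simp [eq_comm]
  exact key _ _ _

/-- Equality with the canonical lift is the statement about the image of d(π ∘ f). The contact forms
then vanish automatically, since the plane comes from an isotropic F² containing F³. -/
theorem isIntegralManifold_lineMap_comp_iff {f : N → S.CompactDual}
    (hf : ContMDiff 𝓘(ℂ, E) 𝓘(ℂ, DualModel h) ω f) :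
    (IsIntegralManifold (E := E) S.contactSystem (S.lineMap ∘ f) ∧
      ∀ n, S.planeMap (f n) = canonicalLift (E' := E) (S.lineMap ∘ f) n) ↔
      ∀ n, IsLiftAt E f n := by
  constructor
  · rintro ⟨h1, h2⟩ n
    exact ⟨(h1.2 n).1, (planeMap_eq_canonicalLift_iff f n).1 (h2 n)⟩
  · intro hl
    refine ⟨⟨S.contMDiff_lineMap.comp hf, fun n => ⟨(hl n).1, fun α hα => ?_⟩⟩,
      fun n => (planeMap_eq_canonicalLift_iff f n).2 (hl n).2⟩
    ext v
    refine contactSystem_eq_zero_of_mem_plane (f n) hα ?_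
    rw [← (hl n).2]
    exact ⟨v, rfl⟩

end SymplecticForm

end CalabiYau

/-! ### The flags F_g attached to a holomorphic function g -/

section Legendre

theorem apply_eq_sum_single {n : ℕ} (l : (Fin n → ℂ) →L[ℂ] ℂ) (a : Fin n → ℂ) :
    l a = ∑ i, a i * l (Pi.single i 1) := by
  conv_lhs => rw [eq_sum_smul_single a]
  simp

variable {h : ℕ}

/-- The coordinates `b = (2 g - ∑ xᵢ ∂ᵢg, ∂₁g, …, ∂ₕg)`. -/
noncomputable def legendreDual (g : (Fin h → ℂ) → ℂ) (x : Fin h → ℂ) : Fin (h + 1) → ℂ :=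
  Fin.cons (2 * g x - ∑ i, x i * fderiv ℂ g x (Pi.single i 1))
    (fun i => fderiv ℂ g x (Pi.single i 1))

variable {g : (Fin h → ℂ) → ℂ} {x : Fin h → ℂ}

theorem contDiffAt_partialDeriv (hg : AnalyticAt ℂ g x) (v : Fin h → ℂ) :
    ContDiffAt ℂ ω (fun x => fderiv ℂ g x v) x :=
  ((hg.contDiffAt (n := ω)).fderiv_right (m := ω) (by simp)).clm_apply contDiffAt_const

theorem fderiv_partialDeriv (hg : AnalyticAt ℂ g x) (v a : Fin h → ℂ) :
    fderiv ℂ (fun x => fderiv ℂ g x v) x a = fderiv ℂ (fderiv ℂ g) x a v := by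
  have h1 : DifferentiableAt ℂ (fderiv ℂ g) x :=
    ((hg.contDiffAt (n := ω)).fderiv_right (m := ω) (by simp)).differentiableAt (by simp)
  have h2 := (ContinuousLinearMap.apply ℂ ℂ v).hasFDerivAt.comp x h1.hasFDerivAt
  exact DFunLike.congr_fun h2.fderiv a

theorem contDiffAt_legendreDual (hg : AnalyticAt ℂ g x) : ContDiffAt ℂ ω (legendreDual g) x := by
  rw [contDiffAt_pi]
  intro i
  refine Fin.cases ?_ (fun i => ?_) i
  · refine (contDiffAt_const.mul hg.contDiffAt).sub (ContDiffAt.sum fun i _ => ?_)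
    exact (contDiffAt_apply (𝕜 := ℂ) (E := ℂ) i x).mul (contDiffAt_partialDeriv hg _)
  · exact contDiffAt_partialDeriv hg _

theorem differentiableAt_legendreDual (hg : AnalyticAt ℂ g x) :
    DifferentiableAt ℂ (legendreDual g) x :=
  (contDiffAt_legendreDual hg).differentiableAt (by simp)

theorem fderiv_legendreDual_succ (hg : AnalyticAt ℂ g x) (a : Fin h → ℂ) (i : Fin h) :
    fderiv ℂ (legendreDual g) x a i.succ = fderiv ℂ (fderiv ℂ g) x a (Pi.single i 1) := by
  rw [← fderiv_partialDeriv hg]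
  exact DFunLike.congr_fun (fderiv_apply (differentiableAt_legendreDual hg) i.succ).symm a

/-- From b₀ = 2g - ∑ xᵢ bᵢ one gets db₀ = 2 dg - ∑ bᵢ dxᵢ - ∑ xᵢ dbᵢ, and ∑ bᵢ dxᵢ = dg. -/
theorem fderiv_legendreDual_zero (hg : AnalyticAt ℂ g x) (a : Fin h → ℂ) :
    fderiv ℂ (legendreDual g) x a 0 = fderiv ℂ g x a -
      ∑ i, x i * fderiv ℂ (fderiv ℂ g) x a (Pi.single i 1) := by
  have h1 : ∀ i : Fin h, HasFDerivAt (fun x : Fin h → ℂ => x i * fderiv ℂ g x (Pi.single i 1))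
      (x i • fderiv ℂ (fun x => fderiv ℂ g x (Pi.single i 1)) x + fderiv ℂ g x (Pi.single i 1) •
        ContinuousLinearMap.proj (R := ℂ) (φ := fun _ : Fin h => ℂ) i) x := fun i =>
    (hasFDerivAt_apply (𝕜 := ℂ) i x).mul
      ((contDiffAt_partialDeriv hg _).differentiableAt (by simp)).hasFDerivAt
  have h2 := (hg.differentiableAt.hasFDerivAt.const_mul 2).sub
    (HasFDerivAt.fun_sum fun i (_ : i ∈ Finset.univ) => h1 i)
  have h3 := DFunLike.congr_fun (h2.fderiv) a
  refine (DFunLike.congr_fun (fderiv_apply (differentiableAt_legendreDual hg) 0) a).symm.trans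
    (h3.trans ?_)
  simp only [sub_apply, smul_apply, smul_eq_mul, sum_apply, add_apply,
    ContinuousLinearMap.proj_apply, fderiv_partialDeriv hg, Finset.sum_add_distrib]
  rw [apply_eq_sum_single (fderiv ℂ g x) a]
  have h4 : ∑ i, fderiv ℂ g x (Pi.single i 1) * a i = ∑ i, a i * fderiv ℂ g x (Pi.single i 1) :=
    Finset.sum_congr rfl fun i _ => mul_comm _ _
  rw [h4]
  ring

/-- The 1-jet of the Legendre data of `g` is isotropic. -/
theorem isIsotropicJet_legendreDual (hg : AnalyticAt ℂ g x) :
    IsIsotropicJet ((x, legendreDual g x), fderiv ℂ (legendreDual g) x) := by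
  -- The first equation is db₀ + ∑ xᵢ dbᵢ = dg = ∑ bᵢ dxᵢ; the second is the symmetry of the Hessian
  -- of g.
  refine ⟨fun a => ?_, fun a a' => ?_⟩
  · change ∑ i, (Fin.cons 1 x : Fin (h + 1) → ℂ) i * fderiv ℂ (legendreDual g) x a i =
      ∑ i, fderiv ℂ g x (Pi.single i 1) * a i
    rw [Fin.sum_univ_succ, fderiv_legendreDual_zero hg]
    simp only [Fin.cons_zero, Fin.cons_succ, fderiv_legendreDual_succ hg, one_mul, sub_add_cancel]
    rw [apply_eq_sum_single (fderiv ℂ g x) a]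
    exact Finset.sum_congr rfl fun i _ => mul_comm _ _
  · simp only [fderiv_legendreDual_succ hg]
    have hs : IsSymmSndFDerivAt ℂ g x := (hg.contDiffAt (n := ω)).isSymmSndFDerivAt (by simp)
    have h1 := apply_eq_sum_single (fderiv ℂ (fderiv ℂ g) x a) a'
    have h2 := apply_eq_sum_single (fderiv ℂ (fderiv ℂ g) x a') a
    rw [← h1, hs.eq, h2]
    exact Finset.sum_congr rfl fun i _ => mul_comm _ _

variable {V : Type*} [NormedAddCommGroup V] [NormedSpace ℂ V]

namespace SymplecticForm

variable {S : SymplecticForm V h}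

theorem coord_legendreVector (c : S.Frame) (g : (Fin h → ℂ) → ℂ) (x : Fin h → ℂ) :
    c.coord (legendreVector c g x) = (Fin.cons 1 x, legendreDual g x) :=
  c.coord.apply_symm_apply _

theorem fderiv_legendreVector (c : S.Frame) (hb : DifferentiableAt ℂ (legendreDual g) x)
    (a : Fin h → ℂ) : fderiv ℂ (legendreVector c g) x a =
      c.coord.symm (Fin.cons 0 a, fderiv ℂ (legendreDual g) x a) := by
  have h1 := c.symmL.hasFDerivAt.comp x ((hasFDerivAt_cons x).prodMk hb.hasFDerivAt)
  refine (DFunLike.congr_fun h1.fderiv a).trans ?_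
  change c.coord.symm (consZero h a, _) = _
  rw [consZero_apply]
  rfl

/-- The flag with coordinates `u` is the Legendre flag of `g`, provided that the 1-jets agree. -/
theorem isLegendreFlag_dualP (c : S.Frame) (hb : DifferentiableAt ℂ (legendreDual g) x)
    {u : DualModel h} (hu : paramJet u = ((x, legendreDual g x), fderiv ℂ (legendreDual g) x)) :
    IsLegendreFlag c g x (S.dualP c u) := by
  have hx : u.1 = x := congrArg (fun q => q.1.1) hu
  have hs : symOp (h + 1) u.2 (Fin.cons 1 x) = legendreDual g x := by
    have h1 := congrArg (fun q => q.1.2) hu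
    change symOp (h + 1) u.2 (Fin.cons 1 u.1) = legendreDual g x at h1
    rwa [hx] at h1
  have hA : ∀ a, symOp (h + 1) u.2 (Fin.cons 0 a) = fderiv ℂ (legendreDual g) x a := fun a => by
    rw [← consZero_apply]
    exact DFunLike.congr_fun (congrArg Prod.snd hu) a
  have hz : dualVec c u = legendreVector c g x := by
    apply c.coord.injective
    rw [coord_dualVec, coord_legendreVector, hx, hs]
  refine ⟨by rw [dualP_F3, hz], le_antisymm ?_ ?_⟩
  · intro v hv
    rw [mem_dualP_F2] at hv
    set a := (c.coord v).1 with ha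
    -- On F² a vector is determined by its a-coordinates. Here a = a₀ (1, x) + (0, aᵢ - a₀ xᵢ), and
    -- (1, x), (0, eᵢ) are the a-coordinates of z_g and ∂ᵢz_g.
    have hav : v = a 0 • legendreVector c g x +
        ∑ i : Fin h, (a i.succ - a 0 * x i) • fderiv ℂ (legendreVector c g) x (Pi.single i 1) := by
      have h1 : ∑ i : Fin h, (a i.succ - a 0 * x i) •
          fderiv ℂ (legendreVector c g) x (Pi.single i 1) =
          fderiv ℂ (legendreVector c g) x (fun i => a i.succ - a 0 * x i) := by
        conv_rhs => rw [eq_sum_smul_single fun i : Fin h => a i.succ - a 0 * x i]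
        simp
      have h2 : a = a 0 • (Fin.cons 1 x : Fin (h + 1) → ℂ) +
          Fin.cons 0 (fun i => a i.succ - a 0 * x i) := by
        ext i
        refine Fin.cases ?_ (fun i => ?_) i <;> simp
      rw [h1, fderiv_legendreVector c hb]
      apply c.coord.injective
      rw [map_add, map_smul, coord_legendreVector, LinearEquiv.apply_symm_apply]
      refine Prod.ext h2 ?_
      rw [hv, Prod.snd_add, Prod.smul_snd, ← hs, ← hA, ← map_smul, ← map_add, ← h2]
    rw [hav]
    refine Submodule.add_mem _ (Submodule.smul_mem _ _ (Submodule.subset_span (Or.inl rfl)))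
      (Submodule.sum_mem _ fun i _ => Submodule.smul_mem _ _ (Submodule.subset_span (Or.inr ⟨i, rfl⟩)))
  · rw [Submodule.span_le]
    rintro v (rfl | ⟨i, rfl⟩)
    · refine (mem_dualP_F2 _ _ _).2 ?_
      rw [coord_legendreVector, hs]
    · refine (mem_dualP_F2 _ _ _).2 ?_
      simp only [fderiv_legendreVector c hb, LinearEquiv.apply_symm_apply, hA]

/-- The flag `F_g(x)`. -/
noncomputable def legendreFlag (c : S.Frame) (g : (Fin h → ℂ) → ℂ) (x : Fin h → ℂ) :
    S.CompactDual :=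
  S.dualP c (jetParam ((x, legendreDual g x), fderiv ℂ (legendreDual g) x))

theorem isLegendreFlag_legendreFlag (c : S.Frame) (hg : AnalyticAt ℂ g x) :
    IsLegendreFlag c g x (legendreFlag c g x) :=
  isLegendreFlag_dualP c (differentiableAt_legendreDual hg)
    (paramJet_jetParam (isIsotropicJet_legendreDual hg))

/-- The generator of F³ with a₀ = 1 is unique, so the two vectors z_g(x) and z_{g'}(x') agree; x and
the first derivatives can be read from them, and then b₀ gives the value of g. -/
theorem IsLegendreFlag.unique {c : S.Frame} {g' : (Fin h → ℂ) → ℂ} {x' : Fin h → ℂ}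
    {F : S.CompactDual} (hF : IsLegendreFlag c g x F) (hF' : IsLegendreFlag c g' x' F) :
    x = x' ∧ g x = g' x' := by
  have h1 : legendreVector c g x ∈ Submodule.span ℂ {legendreVector c g' x'} := by
    rw [← hF'.1, hF.1]
    exact Submodule.mem_span_singleton_self _
  obtain ⟨t, ht⟩ := Submodule.mem_span_singleton.1 h1
  have h2 := congrArg c.coord ht
  rw [map_smul, coord_legendreVector, coord_legendreVector] at h2
  have h3 := congrFun (congrArg Prod.fst h2)
  have h4 := congrFun (congrArg Prod.snd h2)
  have ht1 : t = 1 := by simpa using h3 0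
  subst ht1
  have hx : x = x' := by
    ext i
    simpa using (h3 i.succ).symm
  subst hx
  have h5 : ∀ i, fderiv ℂ g' x (Pi.single i 1) = fderiv ℂ g x (Pi.single i 1) := fun i => by
    simpa [legendreDual] using h4 i.succ
  refine ⟨rfl, ?_⟩
  have h6 := h4 0
  simp only [legendreDual, one_smul, Fin.cons_zero, h5, sub_left_inj] at h6
  exact (mul_left_cancel₀ two_ne_zero h6).symm

/-- The quadratic function with `z_g(x) = ((1, x), s (1, x))`. -/
noncomputable def quadraticPotential (s : Sym2 (Fin (h + 1)) → ℂ) (x : Fin h → ℂ) : ℂ :=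
  2⁻¹ * ∑ i, (Fin.cons 1 x : Fin (h + 1) → ℂ) i * symOp (h + 1) s (Fin.cons 1 x) i

/-- By symmetry of s the two terms of the product rule are equal, which cancels the factor ½. -/
theorem fderiv_quadraticPotential (s : Sym2 (Fin (h + 1)) → ℂ) (x a : Fin h → ℂ) :
    fderiv ℂ (quadraticPotential s) x a =
      ∑ i : Fin h, a i * symOp (h + 1) s (Fin.cons 1 x) i.succ := by
  have h1 := hasFDerivAt_cons x
  have h2 := (symOp (h + 1) s).hasFDerivAt.comp x h1
  have h3 := (HasFDerivAt.fun_sum fun i (_ : i ∈ (Finset.univ : Finset (Fin (h + 1)))) =>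
    (hasFDerivAt_pi'.1 h1 i).mul (hasFDerivAt_pi'.1 h2 i)).const_mul (2⁻¹ : ℂ)
  refine (DFunLike.congr_fun h3.fderiv a).trans ?_
  simp only [smul_apply, smul_eq_mul, sum_apply, add_apply, ContinuousLinearMap.comp_apply,
    ContinuousLinearMap.proj_apply, consZero_apply, Function.comp_apply, Finset.sum_add_distrib]
  rw [symOp_symm]
  have h4 : ∀ b : Fin (h + 1) → ℂ, ∑ i, b i * (Fin.cons 0 a : Fin (h + 1) → ℂ) i =
      ∑ i : Fin h, a i * b i.succ := fun b => by
    simp [Fin.sum_univ_succ, mul_comm]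
  rw [h4]
  ring

theorem analyticOnNhd_quadraticPotential (s : Sym2 (Fin (h + 1)) → ℂ) :
    AnalyticOnNhd ℂ (quadraticPotential s) univ := by
  have h1 : ContDiff ℂ ω (fun x : Fin h → ℂ => (Fin.cons 1 x : Fin (h + 1) → ℂ)) := contDiff_cons 1
  have h2 : ContDiff ℂ ω fun x : Fin h → ℂ => symOp (h + 1) s (Fin.cons 1 x) :=
    (symOp (h + 1) s).contDiff.comp h1
  have h3 : ContDiff ℂ ω (quadraticPotential s) :=
    contDiff_const.mul (ContDiff.sum fun i _ => (contDiff_pi.1 h1 i).mul (contDiff_pi.1 h2 i))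
  exact fun x _ => h3.contDiffAt.analyticAt

theorem legendreDual_quadraticPotential (s : Sym2 (Fin (h + 1)) → ℂ) :
    legendreDual (quadraticPotential s) = fun x => symOp (h + 1) s (Fin.cons 1 x) := by
  have hp : ∀ (x : Fin h → ℂ) (i : Fin h),
      fderiv ℂ (quadraticPotential s) x (Pi.single i 1) = symOp (h + 1) s (Fin.cons 1 x) i.succ :=
    fun x i => by simp [fderiv_quadraticPotential, Pi.single_apply]
  ext x i
  refine Fin.cases ?_ (fun i => ?_) i
  · simp only [legendreDual, Fin.cons_zero, hp, quadraticPotential]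
    rw [Fin.sum_univ_succ]
    simp
  · simp [legendreDual, hp]

/-- For the quadratic potential of s the vector b is s (1, x) at every x, so its 1-jet at the given
point is the jet of the flag with parameters (x, s). -/
theorem exists_isLegendreFlag (c : S.Frame) {F : S.CompactDual} (hF : F ∈ bigCell c) :
    ∃ g x, AnalyticOnNhd ℂ g univ ∧ IsLegendreFlag c g x F := by
  obtain ⟨u, rfl⟩ := (mem_bigCell_iff c F).1 hF
  refine ⟨quadraticPotential u.2, u.1, analyticOnNhd_quadraticPotential u.2, ?_⟩
  have h1 := (symOp (h + 1) u.2).hasFDerivAt.comp u.1 (hasFDerivAt_cons u.1)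
  refine isLegendreFlag_dualP c ?_ ?_
  · exact differentiableAt_legendreDual (analyticOnNhd_quadraticPotential u.2 _ trivial)
  · rw [legendreDual_quadraticPotential]
    exact congrArg (Prod.mk (u.1, symOp (h + 1) u.2 (Fin.cons 1 u.1))) h1.fderiv.symm

theorem isOpen_bigCell (c : S.Frame) : IsOpen (bigCell c) := by
  have : bigCell c = (S.dualP c).chart.source := by
    ext F
    rw [mem_bigCell_iff, mem_dualP_source]
  rw [this]
  exact (S.dualP c).chart.open_source

end SymplecticForm

end Legendre

/-! ### Canonical lifts and germs of contact integral manifolds -/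

section Lifts

variable {V : Type*} [NormedAddCommGroup V] [NormedSpace ℂ V] {h : ℕ}
  {E N E' M : Type*} [NormedAddCommGroup E] [NormedSpace ℂ E] [TopologicalSpace N]
  [ChartedSpace E N] [NormedAddCommGroup E'] [NormedSpace ℂ E'] [TopologicalSpace M]
  [ChartedSpace E' M]

theorem mfderiv_bijective_of_mem_maximalAtlas [IsManifold 𝓘(ℂ, E) ω N]
    {χ : OpenPartialHomeomorph N E} (hχ : χ ∈ IsManifold.maximalAtlas 𝓘(ℂ, E) ω N) {n : N}
    (hn : n ∈ χ.source) : Function.Bijective (mfderiv 𝓘(ℂ, E) 𝓘(ℂ, E) χ n) := by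
  have h1 : χ.MDifferentiable 𝓘(ℂ, E) 𝓘(ℂ, E) :=
    ⟨(contMDiffOn_of_mem_maximalAtlas hχ).mdifferentiableOn (by simp),
      (contMDiffOn_symm_of_mem_maximalAtlas hχ).mdifferentiableOn (by simp)⟩
  exact h1.mfderiv_bijective hn

theorem mfderiv_symm_bijective_of_mem_maximalAtlas [IsManifold 𝓘(ℂ, E) ω N]
    {χ : OpenPartialHomeomorph N E} (hχ : χ ∈ IsManifold.maximalAtlas 𝓘(ℂ, E) ω N) {y : E}
    (hy : y ∈ χ.target) : Function.Bijective (mfderiv 𝓘(ℂ, E) 𝓘(ℂ, E) χ.symm y) := by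
  have h1 : χ.MDifferentiable 𝓘(ℂ, E) 𝓘(ℂ, E) :=
    ⟨(contMDiffOn_of_mem_maximalAtlas hχ).mdifferentiableOn (by simp),
      (contMDiffOn_symm_of_mem_maximalAtlas hχ).mdifferentiableOn (by simp)⟩
  exact h1.symm.mfderiv_bijective hy

/-- The lift depends only on the image of the differential, which does not change under a
reparametrization with surjective derivative. -/
theorem canonicalLift_comp {k : N → M} {ψ : E → N} {y : E}
    (hk : MDifferentiableAt 𝓘(ℂ, E) 𝓘(ℂ, E') k (ψ y))
    (hψ : MDifferentiableAt 𝓘(ℂ, E) 𝓘(ℂ, E) ψ y)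
    (hs : Function.Surjective (mfderiv 𝓘(ℂ, E) 𝓘(ℂ, E) ψ y)) :
    canonicalLift (E := E') (E' := E) (k ∘ ψ) y = canonicalLift (E' := E) k (ψ y) := by
  unfold canonicalLift
  rw [mfderiv_comp y hk hψ]
  congr 1
  exact LinearMap.range_comp_of_range_eq_top _ (LinearMap.range_eq_top.2 hs)

theorem canonicalLift_congr {k k' : N → M} {n : N} (hk : k =ᶠ[𝓝 n] k') :
    canonicalLift (E := E') (E' := E) k n = canonicalLift (E' := E) k' n := by
  have key : ∀ (x x' : M) (_ : x = x') (P P' : Submodule ℂ E') (_ : P = P'),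
      (⟨x, P⟩ : TangentPlane E' M) = ⟨x', P'⟩ := by
    rintro x _ rfl P _ rfl
    rfl
  exact key _ _ hk.self_of_nhds _ _
    (congrArg (fun T : E →L[ℂ] E' => LinearMap.range T.toLinearMap) hk.mfderiv_eq)

namespace SymplecticForm

variable {S : SymplecticForm V h}

theorem IsLiftAt.comp {f : N → S.CompactDual} {ψ : M → N} {m : M}
    (hf : MDifferentiableAt 𝓘(ℂ, E) 𝓘(ℂ, DualModel h) f (ψ m)) (hl : IsLiftAt E f (ψ m))
    (hψ : MDifferentiableAt 𝓘(ℂ, E') 𝓘(ℂ, E) ψ m)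
    (hb : Function.Bijective (mfderiv 𝓘(ℂ, E') 𝓘(ℂ, E) ψ m)) : IsLiftAt E' (f ∘ ψ) m := by
  have h1 := mfderiv_comp (I := 𝓘(ℂ, E')) (I' := 𝓘(ℂ, E)) (I'' := 𝓘(ℂ, ProjModel h)) m
    ((S.mdifferentiableAt_lineMap (f (ψ m))).comp (ψ m) hf) hψ
  constructor
  · have h2 := hl.1.comp hb.1
    intro v w hvw
    refine h2 ?_
    exact (DFunLike.congr_fun h1 v).symm.trans (hvw.trans (DFunLike.congr_fun h1 w))
  · refine Eq.trans ?_ hl.2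
    refine (congrArg (fun T : E' →L[ℂ] ProjModel h => LinearMap.range T.toLinearMap) h1).trans ?_
    exact LinearMap.range_comp_of_range_eq_top _ (LinearMap.range_eq_top.2 hb.2)

section LegendreFlag

variable {g : (Fin h → ℂ) → ℂ} {x : Fin h → ℂ}

theorem contMDiffAt_legendreFlag (c : S.Frame) (hg : AnalyticAt ℂ g x) :
    ContMDiffAt 𝓘(ℂ, Fin h → ℂ) 𝓘(ℂ, DualModel h) ω (legendreFlag c g) x := by
  have h1 := contDiffAt_legendreDual hg
  have h2 : ContDiffAt ℂ ω
      (fun x => jetParam ((x, legendreDual g x), fderiv ℂ (legendreDual g) x)) x :=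
    contDiff_jetParam.contDiffAt.comp x
      ((contDiffAt_id.prodMk h1).prodMk (h1.fderiv_right (m := ω) (by simp)))
  exact ((S.dualP c).contMDiffAt _).comp x h2.contMDiffAt

/-- The derivatives ∂ᵢz_g are independent modulo z_g, because their a-coordinates are (0, eᵢ)
against (1, x); by definition of F_g they span F² together with z_g. -/
theorem isLiftAt_legendreFlag (c : S.Frame) (hg : AnalyticAt ℂ g x) :
    IsLiftAt (Fin h → ℂ) (legendreFlag c g) x := by
  have hf : MDifferentiableAt 𝓘(ℂ, Fin h → ℂ) 𝓘(ℂ, DualModel h) (legendreFlag c g) x :=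
    (contMDiffAt_legendreFlag c hg).mdifferentiableAt (by simp)
  have hF := isLegendreFlag_legendreFlag c hg
  have hσ : IsSectionAt (DualModel h) (fun F : S.CompactDual => F.F3) (dualSection c)
      (legendreFlag c g x) := isSectionAt_dualSection c _
  -- Both sides generate F³ and have a₀ = 1. The equality is needed at nearby points because it is
  -- differentiated below.
  have hz : ∀ x, AnalyticAt ℂ g x → dualSection c (legendreFlag c g x) = legendreVector c g x := by
    intro x hg
    have h1 := paramJet_jetParam (isIsotropicJet_legendreDual hg)
    apply c.coord.injective
    rw [legendreFlag, dualSection_dualP, coord_dualVec, coord_legendreVector]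
    exact Prod.ext rfl (congrArg (fun q => q.1.2) h1)
  have hz0 : dualSection c (legendreFlag c g x) ≠ 0 := by
    rw [legendreFlag, dualSection_dualP]
    exact dualVec_ne_zero c _
  rw [isLiftAt_iff hf hσ hz0]
  have hδ : ∀ a : Fin h → ℂ, vectorDeriv (DualModel h) (dualSection c) (legendreFlag c g x)
      (mfderiv 𝓘(ℂ, Fin h → ℂ) 𝓘(ℂ, DualModel h) (legendreFlag c g) x a) =
        fderiv ℂ (legendreVector c g) x a := by
    intro a
    refine (vectorDeriv_comp hσ.1 hf a).symm.trans ?_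
    have h1 : dualSection c ∘ legendreFlag c g =ᶠ[𝓝 x] legendreVector c g :=
      hg.eventually_analyticAt.mono hz
    refine (DFunLike.congr_fun h1.mfderiv_eq a).trans ?_
    exact DFunLike.congr_fun (mfderiv_eq_fderiv) a
  have hb := differentiableAt_legendreDual hg
  constructor
  · have h1 : ∀ a : Fin h → ℂ, fderiv ℂ (legendreVector c g) x a ∈ (legendreFlag c g x).F3 →
        a = 0 := by
      intro a ha
      rw [hF.1] at ha
      obtain ⟨t, ht⟩ := Submodule.mem_span_singleton.1 ha
      have h3 := congrArg c.coord ht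
      rw [fderiv_legendreVector c hb, LinearEquiv.apply_symm_apply, map_smul,
        coord_legendreVector] at h3
      have h4 := congrFun (congrArg Prod.fst h3)
      have ht0 : t = 0 := by simpa using h4 0
      ext i
      have h5 := h4 i.succ
      rw [ht0] at h5
      simpa using h5.symm
    rw [← LinearMap.ker_eq_bot, LinearMap.ker_eq_bot']
    intro a ha
    refine h1 a ?_
    have h2 := (Submodule.Quotient.mk_eq_zero _).1 ha
    exact (congrArg (· ∈ (legendreFlag c g x).F3) (hδ a)).mp h2
  · refine le_antisymm ?_ ?_
    · rintro _ ⟨a, rfl⟩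
      refine ⟨fderiv ℂ (legendreVector c g) x a, ?_, congrArg _ (hδ a).symm⟩
      rw [hF.2, eq_sum_smul_single a, map_sum]
      refine Submodule.sum_mem _ fun i _ => ?_
      rw [map_smul]
      exact Submodule.smul_mem _ _ (Submodule.subset_span (Or.inr ⟨i, rfl⟩))
    · rw [Submodule.map_le_iff_le_comap, hF.2, Submodule.span_le]
      rintro v (rfl | ⟨i, rfl⟩)
      · refine ⟨0, ?_⟩
        rw [map_zero]
        refine ((Submodule.Quotient.mk_eq_zero _).2 ?_).symm
        rw [hF.1]
        exact Submodule.mem_span_singleton_self _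
      · exact ⟨Pi.single i 1, congrArg _ (hδ _)⟩

end LegendreFlag

section IntegralGerms

/-- `k` is an integral manifold of the contact system at `n`. -/
def IsContactIntegralAt (k : N → S.Proj) (n : N) : Prop :=
  ContMDiffAt 𝓘(ℂ, E) 𝓘(ℂ, ProjModel h) ω k n ∧
    Function.Injective (mfderiv 𝓘(ℂ, E) 𝓘(ℂ, ProjModel h) k n) ∧
      ∀ α ∈ S.contactSystem (k n), α.comp (mfderiv 𝓘(ℂ, E) 𝓘(ℂ, ProjModel h) k n) = 0

/-- The lift of a holomorphic map to `V` by the section `(1, u)` is holomorphic. -/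
theorem contMDiffAt_affineSection_comp {k : N → S.Proj} {n : N}
    (hk : ContMDiffAt 𝓘(ℂ, E) 𝓘(ℂ, ProjModel h) ω k n) {e : V ≃ₗ[ℂ] ℂ × ProjModel h}
    (hn : k n ∈ (S.projP e).chart.source) :
    ContMDiffAt 𝓘(ℂ, E) 𝓘(ℂ, V) ω (S.affineSection e ∘ k) n := by
  obtain ⟨u, hu⟩ := (S.mem_projP_source e _).1 hn
  have h1 := S.contMDiffAt_affineSection e u
  rw [projP_apply, hu] at h1
  exact h1.comp n hk

/-- The canonical lift of `k`, and the kernel of `dk`, in terms of the derivative of the lift of `k`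
to `V` by the section `(1, u)`. -/
theorem canonicalLift_eq_affinePlane {k : N → S.Proj} {n : N}
    (hk : ContMDiffAt 𝓘(ℂ, E) 𝓘(ℂ, ProjModel h) ω k n) {e : V ≃ₗ[ℂ] ℂ × ProjModel h}
    {u : ProjModel h} (hn : k n = S.projP e u) :
    canonicalLift (E' := E) k n = S.affinePlane e u ((LinearMap.range
      (vectorDeriv E (S.affineSection e ∘ k) n).toLinearMap).comap (dirVec e).toLinearMap) ∧
    (∀ v, ∃ w, vectorDeriv E (S.affineSection e ∘ k) n v = dirVec e w) ∧
    ∀ v, vectorDeriv E (S.affineSection e ∘ k) n v = 0 →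
      mfderiv 𝓘(ℂ, E) 𝓘(ℂ, ProjModel h) k n v = 0 := by
  have hd : ∀ v, vectorDeriv E (S.affineSection e ∘ k) n v =
      vectorDeriv (ProjModel h) (S.affineSection e) (k n)
        (mfderiv 𝓘(ℂ, E) 𝓘(ℂ, ProjModel h) k n v) := fun v =>
    vectorDeriv_comp (by rw [hn]; exact S.contMDiffAt_affineSection e u)
      (hk.mdifferentiableAt (by simp)) v
  -- The base point is kept variable so that it can be replaced by `S.projP e u` in the tangent
  -- spaces that depend on it.
  have key : ∀ (x : S.Proj) (_ : x = S.projP e u)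
      (T : E →ₗ[ℂ] TangentSpace 𝓘(ℂ, ProjModel h) x) (D : E →ₗ[ℂ] V)
      (_ : ∀ v, D v = vectorDeriv (ProjModel h) (S.affineSection e) x (T v)),
      (⟨x, LinearMap.range T⟩ : TangentPlane (ProjModel h) S.Proj) =
        S.affinePlane e u ((LinearMap.range D).comap (dirVec e).toLinearMap) ∧
      (∀ v, ∃ w, D v = dirVec e w) ∧ ∀ v, D v = 0 → T v = 0 := by
    rintro _ rfl T D hD
    have hD' : ∀ v, D v = dirVec e (((S.projP e).tangentEquiv u).symm (T v)) := by
      intro v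
      rw [hD]
      obtain ⟨w, hw⟩ := ((S.projP e).tangentEquiv u).surjective (T v)
      rw [← hw, vectorDeriv_affineSection, LinearEquiv.symm_apply_apply]
    refine ⟨?_, fun v => ⟨_, hD' v⟩, fun v hv => ?_⟩
    · refine congrArg (TangentPlane.mk (S.projP e u)) ?_
      ext w
      obtain ⟨w, rfl⟩ := ((S.projP e).tangentEquiv u).surjective w
      constructor
      · rintro ⟨v, hv⟩
        refine ⟨w, ⟨v, ?_⟩, rfl⟩
        rw [hD', hv, LinearEquiv.symm_apply_apply]
        rfl
      · rintro ⟨w', ⟨v, hv⟩, hw'⟩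
        refine ⟨v, ?_⟩
        rw [hD'] at hv
        rw [← hw', ← dirVec_injective e hv]
        exact (LinearEquiv.apply_symm_apply _ _).symm
    · rw [hD', ← map_zero (dirVec e)] at hv
      simpa using dirVec_injective e hv
  exact key _ hn _ _ hd

theorem form_vectorDeriv_affineSection {k : N → S.Proj} {n : N}
    (hk : IsContactIntegralAt (E := E) k n) {e : V ≃ₗ[ℂ] ℂ × ProjModel h}
    (hn : k n ∈ (S.projP e).chart.source) (v : TangentSpace 𝓘(ℂ, E) n) :
    S.form (vectorDeriv E (S.affineSection e ∘ k) n v) (S.affineSection e (k n)) = 0 := by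
  obtain ⟨u, hu⟩ := (S.mem_projP_source e _).1 hn
  have hu' : k n = S.projP e u := hu.symm
  have h1 : S.contactForm e (k n) ∈ S.contactSystem (k n) := by
    have : ∀ x (_ : x = S.projP e u), S.contactForm e x ∈ S.contactSystem x := by
      rintro _ rfl
      rw [contactSystem_projP]
      exact Submodule.mem_span_singleton_self _
    exact this _ hu'
  have h2 := DFunLike.congr_fun (hk.2.2 _ h1) v
  rw [vectorDeriv_comp (by rw [hu']; exact S.contMDiffAt_affineSection e u)
    (hk.1.mdifferentiableAt (by simp)) v]
  exact h2

/-- If `Q(dz, z) = 0` then `Q(dz, dz) = 0`. -/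
theorem form_fderiv_fderiv_eq_zero {ζ : E → V} {y : E} (hζ : ContDiffAt ℂ ω ζ y)
    (h0 : ∀ᶠ y in 𝓝 y, ∀ v, S.form (fderiv ℂ ζ y v) (ζ y) = 0) (v w : E) :
    S.form (fderiv ℂ ζ y v) (fderiv ℂ ζ y w) = 0 := by
  have := S.finiteDimensional
  have h1 : HasFDerivAt ζ (fderiv ℂ ζ y) y :=
    (hζ.differentiableAt (by simp)).hasFDerivAt
  have h2 : HasFDerivAt (fderiv ℂ ζ) (fderiv ℂ (fderiv ℂ ζ) y) y :=
    ((hζ.fderiv_right (m := ω) (by simp)).differentiableAt (by simp)).hasFDerivAt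
  -- Derivative of the identity Q(∂ᵥζ, ζ) = 0 in the direction w.
  have key : ∀ v w, S.form (fderiv ℂ ζ y v) (fderiv ℂ ζ y w) +
      S.form (fderiv ℂ (fderiv ℂ ζ) y w v) (ζ y) = 0 := by
    intro v w
    have h3 := (ContinuousLinearMap.apply ℂ V v).hasFDerivAt.comp y h2
    have h4 := S.formL.hasFDerivAt_of_bilinear h3 h1
    have h5 : (fun y => S.formL (((ContinuousLinearMap.apply ℂ V) v ∘ fderiv ℂ ζ) y) (ζ y))
        =ᶠ[𝓝 y] fun _ => 0 := h0.mono fun y hy => hy v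
    have h6 := h5.fderiv_eq (𝕜 := ℂ)
    rw [h4.fderiv, fderiv_fun_const] at h6
    exact DFunLike.congr_fun h6 w
  have hs : IsSymmSndFDerivAt ℂ ζ y := hζ.isSymmSndFDerivAt (by simp)
  have h3 := key v w
  have h4 := key w v
  rw [hs.eq, S.form_swap] at h4
  -- Exchanging v and w and subtracting, the symmetric second derivative drops out, and skewness of
  -- Q leaves 2 Q(∂ᵥζ, ∂_wζ) = 0.
  have h5 : S.form (fderiv ℂ ζ y v) (fderiv ℂ ζ y w) +
    S.form (fderiv ℂ ζ y v) (fderiv ℂ ζ y w) = 0 := by linear_combination h3 - h4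
  exact self_eq_neg.1 (eq_neg_of_add_eq_zero_left h5)

/-- The lift of a germ of an integral manifold by the section `(1, u)`. -/
theorem eventually_affineSection_comp {k : E → S.Proj} {y : E}
    (hk : ∀ᶠ y in 𝓝 y, IsContactIntegralAt (E := E) k y) {e : V ≃ₗ[ℂ] ℂ × ProjModel h}
    (hy : k y ∈ (S.projP e).chart.source) :
    ∀ᶠ y in 𝓝 y, IsContactIntegralAt (E := E) k y ∧ ContDiffAt ℂ ω (S.affineSection e ∘ k) y ∧
      S.affineSection e (k y) ∈ S.line (k y) ∧
      ∀ v, S.form (fderiv ℂ (S.affineSection e ∘ k) y v) (S.affineSection e (k y)) = 0 := by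
  have h1 : ∀ᶠ y in 𝓝 y, k y ∈ (S.projP e).chart.source :=
    hk.self_of_nhds.1.continuousAt.eventually ((S.projP e).chart.open_source.mem_nhds hy)
  filter_upwards [hk, h1] with y hy hy'
  refine ⟨hy, (contMDiffAt_affineSection_comp hy.1 hy').contDiffAt, ?_, fun v => ?_⟩
  · obtain ⟨u, hu⟩ := (S.mem_projP_source e _).1 hy'
    have hu' : k y = S.projP e u := hu.symm
    rw [hu', affineSection_projP, line_projP]
    exact Submodule.mem_span_singleton_self _
  · rw [← form_vectorDeriv_affineSection hy hy' v]
    have h2 := DFunLike.congr_fun (mfderiv_eq_fderiv (𝕜 := ℂ) (f := S.affineSection e ∘ k) (x := y)) v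
    exact congrArg (fun w => S.form w (S.affineSection e (k y))) h2.symm

/-- For the lift ζ of k to V, the span of ζ and its derivatives is isotropic: Q(dζ, ζ) = 0 is the
contact condition, and Q(dζ, dζ) = 0 is its derivative. -/
theorem canonicalLift_mem_integralElements {k : (Fin h → ℂ) → S.Proj} {y : Fin h → ℂ}
    (hk : ∀ᶠ y in 𝓝 y, IsContactIntegralAt (E := Fin h → ℂ) k y) :
    canonicalLift (E' := Fin h → ℂ) k y ∈ integralElements S.contactSystem h := by
  obtain ⟨e, u, hu, -⟩ := S.exists_projP_eq (k y)
  have hy : k y ∈ (S.projP e).chart.source := by rw [hu]; exact (S.projP e).mem_source u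
  have hev := eventually_affineSection_comp hk hy
  obtain ⟨h1, h2, -, h3⟩ := hev.self_of_nhds
  constructor
  · refine (LinearMap.finrank_range_of_inj h1.2.1).trans ?_
    exact Module.finrank_fin_fun ℂ
  · obtain ⟨h4, h5, -⟩ := canonicalLift_eq_affinePlane h1.1 hu
    have h6 : ∀ v, vectorDeriv (Fin h → ℂ) (S.affineSection e ∘ k) y v =
        fderiv ℂ (S.affineSection e ∘ k) y v := fun v =>
      DFunLike.congr_fun (mfderiv_eq_fderiv (𝕜 := ℂ) (f := S.affineSection e ∘ k) (x := y)) v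
    have hz : S.affineSection e (k y) = affineVec e u := by rw [hu, affineSection_projP]
    rw [h4, isIntegralElement_iff, planeSpan_isotropic_iff]
    constructor
    · rintro v ⟨v', hv'⟩
      have h7 : dirVec e v = fderiv ℂ (S.affineSection e ∘ k) y v' := hv'.symm.trans (h6 v')
      rw [h7, ← hz]
      exact h3 v'
    · rintro v ⟨v', hv'⟩ w ⟨w', hw'⟩
      have h7 : dirVec e v = fderiv ℂ (S.affineSection e ∘ k) y v' := hv'.symm.trans (h6 v')
      have h8 : dirVec e w = fderiv ℂ (S.affineSection e ∘ k) y w' := hw'.symm.trans (h6 w')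
      rw [h7, h8]
      exact form_fderiv_fderiv_eq_zero h2 (hev.mono fun y hy => hy.2.2.2) v' w'

end IntegralGerms

end SymplecticForm

end Lifts

/-! ### The potential of a contact integral manifold -/

section Potential

variable {V : Type*} [NormedAddCommGroup V] [NormedSpace ℂ V] {h : ℕ}

namespace SymplecticForm

variable {S : SymplecticForm V h}

/-- An affine chart of `ℙ(V)` in which the inhomogeneous coordinates have denominator `a₀`. -/
theorem exists_chart_of_frame (c : S.Frame) :
    ∃ e : V ≃ₗ[ℂ] ℂ × ProjModel h, ∀ v, (e v).1 = (c.coord v).1 0 := by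
  have := S.finiteDimensional
  let ψ : ((Fin h → ℂ) × (Fin (h + 1) → ℂ)) ≃ₗ[ℂ] ProjModel h :=
    LinearEquiv.ofFinrankEq _ _ (by simp; omega)
  let l : V →ₗ[ℂ] ℂ × ProjModel h := LinearMap.prod
    (LinearMap.proj 0 ∘ₗ LinearMap.fst ℂ _ _ ∘ₗ c.coord.toLinearMap)
    (ψ.toLinearMap ∘ₗ LinearMap.prod
      (LinearMap.pi fun i => LinearMap.proj i.succ ∘ₗ LinearMap.fst ℂ _ _ ∘ₗ c.coord.toLinearMap)
      (LinearMap.snd ℂ _ _ ∘ₗ c.coord.toLinearMap))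
  have hl : Function.Injective l := by
    intro v w hvw
    have h1 : (c.coord v).1 0 = (c.coord w).1 0 := congrArg Prod.fst hvw
    have h2 := ψ.injective (congrArg Prod.snd hvw)
    have h3 : ∀ i : Fin h, (c.coord v).1 i.succ = (c.coord w).1 i.succ :=
      congrFun (congrArg Prod.fst h2)
    have h4 := congrArg Prod.snd h2
    refine c.coord.injective (Prod.ext ?_ h4)
    ext i
    exact Fin.cases h1 h3 i
  exact ⟨LinearEquiv.ofInjectiveOfFinrankEq l hl (by rw [S.dim]; simp; omega), fun v => rfl⟩

/-- Near a point whose lift lies in the big cell, an integral manifold of the contact system is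
`x ↦ ℂ z_g(x)` in suitable coordinates. -/
theorem exists_potential {k : (Fin h → ℂ) → S.Proj} {y₀ : Fin h → ℂ}
    (hk : ∀ᶠ y in 𝓝 y₀, IsContactIntegralAt (E := Fin h → ℂ) k y) {c : S.Frame}
    {F : S.CompactDual} (hF : F ∈ bigCell c)
    (hFk : S.planeMap F = canonicalLift (E' := Fin h → ℂ) k y₀) :
    ∃ Ψ : OpenPartialHomeomorph (Fin h → ℂ) (Fin h → ℂ), y₀ ∈ Ψ.source ∧
      ContDiffOn ℂ ω Ψ Ψ.source ∧ ContDiffOn ℂ ω Ψ.symm Ψ.target ∧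
      ∃ g : (Fin h → ℂ) → ℂ, AnalyticOnNhd ℂ g Ψ.target ∧
        ∀ y ∈ Ψ.source, legendreVector c g (Ψ y) ∈ S.line (k y) := by
  obtain ⟨e, he⟩ := exists_chart_of_frame c
  obtain ⟨q, rfl⟩ := (mem_bigCell_iff c F).1 hF
  rw [← dualP_apply] at hFk hF
  set u : ProjModel h := (e (dualVec c q)).2 with hu
  have hzq : affineVec e u = dualVec c q := by
    apply e.injective
    rw [coord_affineVec]
    refine Prod.ext ?_ rfl
    rw [he, coord_dualVec]
    rfl
  have hkb : S.lineMap (S.dualP c q) = k y₀ := congrArg TangentPlane.base hFk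
  have hk0 : k y₀ = S.projP e u := by
    rw [← hkb, lineMap_eq_projP_iff, hzq]
    exact dualVec_mem_F3 c q
  have hev := eventually_affineSection_comp hk (e := e) (by rw [hk0]; exact (S.projP e).mem_source u)
  -- The denominator of the chart `e` is a₀, so this lift of k to V is normalized by a₀ = 1.
  set ζ : (Fin h → ℂ) → V := S.affineSection e ∘ k with hζ
  obtain ⟨hk1, hζ0, -, -⟩ := hev.self_of_nhds
  obtain ⟨hpl, hrange, hker⟩ := canonicalLift_eq_affinePlane hk1.1 hk0
  have hvd : ∀ v, vectorDeriv (Fin h → ℂ) ζ y₀ v = fderiv ℂ ζ y₀ v := fun v =>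
    DFunLike.congr_fun (mfderiv_eq_fderiv (𝕜 := ℂ) (f := ζ) (x := y₀)) v
  have ha0 : ∀ y, (c.coord (ζ y)).1 0 = 1 := fun y => by
    rw [← he]
    exact congrArg Prod.fst (coord_affineVec e _)
  let a : V →L[ℂ] (Fin (h + 1) → ℂ) := (ContinuousLinearMap.fst ℂ _ _).comp c.coordL
  let b : V →L[ℂ] (Fin (h + 1) → ℂ) := (ContinuousLinearMap.snd ℂ _ _).comp c.coordL
  let tl : V →L[ℂ] (Fin h → ℂ) := ContinuousLinearMap.pi fun i =>
    (ContinuousLinearMap.proj (R := ℂ) (φ := fun _ : Fin (h + 1) => ℂ) i.succ).comp a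
  have hcoord : ∀ v, c.coord v = (a v, b v) := fun v => rfl
  have hatl : ∀ v, a v = Fin.cons (a v 0) (tl v) := fun v => by
    ext i
    refine Fin.cases rfl (fun i => rfl) i
  have ha1 : ∀ y, a (ζ y) 0 = 1 := ha0
  have hda : ∀ y, DifferentiableAt ℂ ζ y → ∀ v, a (fderiv ℂ ζ y v) 0 = 0 := by
    intro y hy v
    have h1 := ((ContinuousLinearMap.proj (R := ℂ) (φ := fun _ : Fin (h + 1) => ℂ) 0).comp
      a).hasFDerivAt.comp y hy.hasFDerivAt
    have h2 : (((ContinuousLinearMap.proj (R := ℂ) (φ := fun _ : Fin (h + 1) => ℂ) 0).comp a :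
      V → ℂ) ∘ ζ) = fun _ => 1 := funext ha1
    rw [h2] at h1
    exact DFunLike.congr_fun (h1.unique (hasFDerivAt_const (1 : ℂ) y)) v
  have hx : ContDiffAt ℂ ω (fun y => tl (ζ y)) y₀ := tl.contDiff.contDiffAt.comp y₀ hζ0
  have hdx : ∀ y, DifferentiableAt ℂ ζ y →
      HasFDerivAt (fun y => tl (ζ y)) (tl.comp (fderiv ℂ ζ y)) y := fun y hy =>
    tl.hasFDerivAt.comp y hy.hasFDerivAt
  -- If dx(v) = 0, then ∂ᵥζ lies in F² with all its a-coordinates zero, so it vanishes by general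
  -- position of F, and v = 0 because k is an immersion. Thus x is a local coordinate system.
  have hinj : Function.Injective (fderiv ℂ (fun y => tl (ζ y)) y₀) := by
    have hd := hζ0.differentiableAt (by simp)
    rw [(hdx y₀ hd).fderiv]
    refine (injective_iff_map_eq_zero _).2 fun v hv => ?_
    have hv' : tl (fderiv ℂ ζ y₀ v) = 0 := hv
    have h1 : fderiv ℂ ζ y₀ v ∈ (S.dualP c q).F2 := by
      rw [← planeSpan_planeMap, hFk, hpl, planeSpan_affinePlane]
      refine Submodule.mem_sup_right ?_
      obtain ⟨w, hw⟩ := hrange v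
      refine ⟨w, ⟨v, hw⟩, ?_⟩
      exact hw.symm.trans (hvd v)
    have h2 : a (fderiv ℂ ζ y₀ v) = 0 := by
      rw [hatl, hda y₀ hd, hv']
      ext i
      refine Fin.cases rfl (fun i => rfl) i
    have h3 := hF.1 _ h1 h2
    have h4 := hker v ((hvd v).trans h3)
    refine hk1.2.1 (h4.trans ?_)
    exact (map_zero (mfderiv 𝓘(ℂ, Fin h → ℂ) 𝓘(ℂ, ProjModel h) k y₀)).symm
  obtain ⟨Ψ₀, hy₀, hΨ₀, hΨ₁, hΨ₂⟩ := exists_openPartialHomeomorph_of_bijective hx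
    ⟨hinj, LinearMap.surjective_of_injective hinj⟩
  obtain ⟨Ω, hΩ, hΩo, hΩy⟩ := eventually_nhds_iff.1 hev
  let Ψ := Ψ₀.restrOpen Ω hΩo
  have hΨs : ∀ y ∈ Ψ.source, y ∈ Ψ₀.source ∧ y ∈ Ω := fun y hy => hy
  have hΨf : ∀ y, Ψ y = tl (ζ y) := fun y => congrFun hΨ₀ y
  -- Solving b₀ = 2g - ∑ xᵢ bᵢ with a = (1, x) dictates g = ½ ∑ aᵢ bᵢ.
  let G : (Fin h → ℂ) → ℂ := fun y => 2⁻¹ * ∑ i, a (ζ y) i * b (ζ y) i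
  have hGd : ∀ y ∈ Ψ.source, ∀ v, fderiv ℂ G y v =
      ∑ i : Fin h, tl (fderiv ℂ ζ y v) i * b (ζ y) i.succ := by
    intro y hy v
    obtain ⟨-, hζy, -, hQ⟩ := hΩ y (hΨs y hy).2
    have hd := hζy.differentiableAt (by simp)
    have h1 := hasFDerivAt_pi'.1 (a.hasFDerivAt.comp y hd.hasFDerivAt)
    have h2 := hasFDerivAt_pi'.1 (b.hasFDerivAt.comp y hd.hasFDerivAt)
    have h3 := (HasFDerivAt.fun_sum fun i (_ : i ∈ (Finset.univ : Finset (Fin (h + 1)))) =>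
      (h1 i).mul (h2 i)).const_mul (2⁻¹ : ℂ)
    refine (DFunLike.congr_fun h3.fderiv v).trans ?_
    simp only [smul_apply, smul_eq_mul, sum_apply, add_apply, ContinuousLinearMap.comp_apply,
      ContinuousLinearMap.proj_apply, Function.comp_apply, Finset.sum_add_distrib]
    have h4 := hQ v
    change S.form (fderiv ℂ ζ y v) (ζ y) = 0 at h4
    rw [c.form_eq, hcoord, hcoord, Finset.sum_sub_distrib, sub_eq_zero] at h4
    -- The contact condition says a · db = da · b, so the two halves of dG coincide; the term i = 0
    -- disappears because a₀ is constant.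
    have h5 : ∑ i, a (ζ y) i * b (fderiv ℂ ζ y v) i = ∑ i, a (fderiv ℂ ζ y v) i * b (ζ y) i :=
      (Finset.sum_congr rfl fun i _ => mul_comm _ _).trans h4.symm
    have h6 : ∑ i, b (ζ y) i * a (fderiv ℂ ζ y v) i = ∑ i, a (fderiv ℂ ζ y v) i * b (ζ y) i :=
      Finset.sum_congr rfl fun i _ => mul_comm _ _
    rw [h5, h6, ← two_mul, inv_mul_cancel_left₀ two_ne_zero, Fin.sum_univ_succ, hda y hd, zero_mul,
      zero_add]
    rfl
  have hGc : ∀ y ∈ Ψ.source, ContDiffAt ℂ ω G y := by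
    intro y hy
    obtain ⟨-, hζy, -, -⟩ := hΩ y (hΨs y hy).2
    exact contDiffAt_const.mul (ContDiffAt.sum fun i _ =>
      (contDiffAt_pi.1 (a.contDiff.contDiffAt.comp y hζy) i).mul
        (contDiffAt_pi.1 (b.contDiff.contDiffAt.comp y hζy) i))
  have hsymm : ∀ p ∈ Ψ.target, ContDiffAt ℂ ω Ψ.symm p := fun p hp =>
    (hΨ₂.mono inter_subset_left).contDiffAt (Ψ.open_target.mem_nhds hp)
  have hgd : ∀ p ∈ Ψ.target, ∀ v, fderiv ℂ (G ∘ Ψ.symm) p v =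
      ∑ i : Fin h, v i * b (ζ (Ψ.symm p)) i.succ := by
    intro p hp v
    have hy := Ψ.map_target hp
    have h1 := (hsymm p hp).differentiableAt (by simp)
    have hd := (hΩ _ (hΨs _ hy).2).2.1.differentiableAt (by simp)
    rw [fderiv_comp p ((hGc _ hy).differentiableAt (by simp)) h1, ContinuousLinearMap.comp_apply,
      hGd _ hy]
    have h2 : HasFDerivAt (fun p => tl (ζ (Ψ.symm p)))
        ((tl.comp (fderiv ℂ ζ (Ψ.symm p))).comp (fderiv ℂ Ψ.symm p)) p :=
      (hdx _ hd).comp p h1.hasFDerivAt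
    -- In the new coordinates x is the identity; its derivative turns dG = ∑ bᵢ dxᵢ into ∂ᵢg = bᵢ.
    have h3 : (fun p => tl (ζ (Ψ.symm p))) =ᶠ[𝓝 p] id := by
      filter_upwards [Ψ.open_target.mem_nhds hp] with p' hp'
      rw [← hΨf, Ψ.right_inv hp', id]
    have h4 := (h2.congr_of_eventuallyEq h3.symm).unique (hasFDerivAt_id p)
    have h5 : tl (fderiv ℂ ζ (Ψ.symm p) (fderiv ℂ Ψ.symm p v)) = v := DFunLike.congr_fun h4 v
    rw [h5]
  refine ⟨Ψ, ⟨hy₀, hΩy⟩, ?_, hΨ₂.mono inter_subset_left, G ∘ Ψ.symm, ?_, ?_⟩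
  · exact hΨ₁.mono inter_subset_left
  · intro p hp
    exact ((hGc _ (Ψ.map_target hp)).comp p (hsymm p hp)).analyticAt
  · intro y hy
    have hp := Ψ.map_source hy
    have hyy := Ψ.left_inv hy
    have hpart : ∀ i : Fin h, fderiv ℂ (G ∘ Ψ.symm) (Ψ y) (Pi.single i 1) = b (ζ y) i.succ := by
      intro i
      rw [hgd _ hp, hyy]
      simp [Pi.single_apply]
    have hleg : legendreVector c (G ∘ Ψ.symm) (Ψ y) = ζ y := by
      apply c.coord.injective
      rw [coord_legendreVector, hcoord]
      refine Prod.ext ?_ ?_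
      · change Fin.cons 1 (Ψ y) = a (ζ y)
        rw [hatl (ζ y), ha1, hΨf]
      · change legendreDual (G ∘ Ψ.symm) (Ψ y) = b (ζ y)
        ext i
        refine Fin.cases ?_ (fun i => ?_) i
        · simp only [legendreDual, Fin.cons_zero, hpart, Function.comp_apply, hyy, G]
          rw [Fin.sum_univ_succ, ha1, hΨf]
          have h1 : ∀ i : Fin h, a (ζ y) i.succ = tl (ζ y) i := fun i => rfl
          simp only [h1]
          ring
        · simp only [legendreDual, Fin.cons_succ, hpart]
    rw [hleg]
    exact (hΩ y (hΨs y hy).2).2.2.1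

end SymplecticForm

end Potential

/-! ### Local normal form, and the correspondence of integral manifolds -/

section LegendreCharts

variable {V : Type*} [NormedAddCommGroup V] [NormedSpace ℂ V] {h : ℕ}
  {N : Type*} [TopologicalSpace N] [ChartedSpace (Fin h → ℂ) N]

namespace SymplecticForm

variable {S : SymplecticForm V h}

theorem line_eq_span {x : S.Proj} {v : V} (hv : v ∈ S.line x) (hv0 : v ≠ 0) :
    S.line x = Submodule.span ℂ {v} := by
  have := S.finiteDimensional
  refine (Submodule.eq_of_le_of_finrank_eq ?_ ?_).symm
  · rwa [Submodule.span_singleton_le_iff_mem]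
  · rw [finrank_span_singleton hv0]
    exact (Projectivization.finrank_submodule _).symm

theorem legendreVector_ne_zero (c : S.Frame) (g : (Fin h → ℂ) → ℂ) (x : Fin h → ℂ) :
    legendreVector c g x ≠ 0 := by
  intro h0
  have h1 := coord_legendreVector c g x
  rw [h0, map_zero] at h1
  have h2 := congrFun (congrArg Prod.fst h1) 0
  simp at h2

theorem isLiftAt_iff_canonicalLift {f : N → S.CompactDual} {n : N} :
    IsLiftAt (Fin h → ℂ) f n ↔
      Function.Injective (mfderiv 𝓘(ℂ, Fin h → ℂ) 𝓘(ℂ, ProjModel h) (S.lineMap ∘ f) n) ∧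
        S.planeMap (f n) = canonicalLift (E' := Fin h → ℂ) (S.lineMap ∘ f) n := by
  rw [planeMap_eq_canonicalLift_iff]
  exact Iff.rfl

variable [IsManifold 𝓘(ℂ, Fin h → ℂ) ω N]

theorem isContactIntegralAt_comp_symm {k : N → S.Proj}
    (hk : IsIntegralManifold (E := Fin h → ℂ) S.contactSystem k)
    {χ : OpenPartialHomeomorph N (Fin h → ℂ)}
    (hχ : χ ∈ IsManifold.maximalAtlas 𝓘(ℂ, Fin h → ℂ) ω N) {y : Fin h → ℂ} (hy : y ∈ χ.target) :
    IsContactIntegralAt (E := Fin h → ℂ) (k ∘ χ.symm) y := by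
  have h1 := contMDiffAt_symm_of_mem_maximalAtlas hχ hy
  have h2 := mfderiv_comp y ((hk.1 (χ.symm y)).mdifferentiableAt (by simp))
    (h1.mdifferentiableAt (by simp))
  have h3 := (mfderiv_symm_bijective_of_mem_maximalAtlas hχ hy).1
  refine ⟨(hk.1 (χ.symm y)).comp y h1, ?_, fun α hα => ?_⟩
  · intro v w hvw
    refine ((hk.2 (χ.symm y)).1.comp h3) ?_
    exact (DFunLike.congr_fun h2 v).symm.trans (hvw.trans (DFunLike.congr_fun h2 w))
  · ext v
    refine (congrArg α (DFunLike.congr_fun h2 v)).trans ?_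
    exact DFunLike.congr_fun ((hk.2 (χ.symm y)).2 α hα) _

/-- The lift does not change under reparametrization, so the statement can be checked in a chart of
`N`. -/
theorem canonicalLift_mem_integralElements_of_isIntegralManifold {k : N → S.Proj}
    (hk : IsIntegralManifold (E := Fin h → ℂ) S.contactSystem k) (n : N) :
    canonicalLift (E' := Fin h → ℂ) k n ∈ integralElements S.contactSystem h := by
  have hχ := IsManifold.chart_mem_maximalAtlas (I := 𝓘(ℂ, Fin h → ℂ)) (n := ω) n
  have hy := mem_chart_target (Fin h → ℂ) n
  have h1 := canonicalLift_mem_integralElements (k := k ∘ (chartAt (Fin h → ℂ) n).symm)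
    (y := chartAt (Fin h → ℂ) n n) (by
      filter_upwards [(chartAt (Fin h → ℂ) n).open_target.mem_nhds hy] with y hy
      exact isContactIntegralAt_comp_symm hk hχ hy)
  rw [canonicalLift_comp ((hk.1 _).mdifferentiableAt (by simp))
    ((contMDiffAt_symm_of_mem_maximalAtlas hχ hy).mdifferentiableAt (by simp))
    (mfderiv_symm_bijective_of_mem_maximalAtlas hχ hy).2] at h1
  rwa [(chartAt (Fin h → ℂ) n).left_inv (mem_chart_source _ n)] at h1

/-- Locally, the canonical lift of an integral manifold of the contact system is `F_g`, in a
suitable chart. -/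
theorem exists_legendre_chart {k : N → S.Proj}
    (hk : IsIntegralManifold (E := Fin h → ℂ) S.contactSystem k) {n : N} {c : S.Frame}
    {F : S.CompactDual} (hF : F ∈ bigCell c)
    (hFk : S.planeMap F = canonicalLift (E' := Fin h → ℂ) k n) :
    ∃ χ ∈ IsManifold.maximalAtlas 𝓘(ℂ, Fin h → ℂ) ω N, n ∈ χ.source ∧
      ∃ g : (Fin h → ℂ) → ℂ, AnalyticOnNhd ℂ g χ.target ∧ ∀ m ∈ χ.source,
        S.planeMap (legendreFlag c g (χ m)) = canonicalLift (E' := Fin h → ℂ) k m := by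
  obtain ⟨χ₀, hχ, hn⟩ : ∃ χ₀ ∈ IsManifold.maximalAtlas 𝓘(ℂ, Fin h → ℂ) ω N, n ∈ χ₀.source :=
    ⟨_, IsManifold.chart_mem_maximalAtlas n, mem_chart_source (Fin h → ℂ) n⟩
  have hy := χ₀.map_source hn
  obtain ⟨Ψ, hyΨ, hΨ, hΨ', g, hg, hz⟩ := exists_potential (k := k ∘ χ₀.symm)
    (y₀ := χ₀ n) (by
      filter_upwards [χ₀.open_target.mem_nhds hy] with y hy
      exact isContactIntegralAt_comp_symm hk hχ hy) hF (by
      rw [canonicalLift_comp ((hk.1 _).mdifferentiableAt (by simp))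
        ((contMDiffAt_symm_of_mem_maximalAtlas hχ hy).mdifferentiableAt (by simp))
        (mfderiv_symm_bijective_of_mem_maximalAtlas hχ hy).2, χ₀.left_inv hn, hFk])
  have hmem : χ₀.trans Ψ ∈ IsManifold.maximalAtlas 𝓘(ℂ, Fin h → ℂ) ω N := by
    refine OpenPartialHomeomorph.mem_maximalAtlas_of_contMDiffOn _ ?_ ?_
    · exact hΨ.contMDiffOn.comp ((contMDiffOn_of_mem_maximalAtlas hχ).mono (by simp))
        (by simp)
    · exact (contMDiffOn_symm_of_mem_maximalAtlas hχ).comp (hΨ'.contMDiffOn.mono (by simp))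
        (by simp)
  have htg : (χ₀.trans Ψ).target ⊆ Ψ.target := by simp
  -- It suffices to identify the maps to ℙ(V) near each point: F_g is the canonical lift of its own
  -- projection, and canonical lifts depend only on germs.
  have hline : ∀ m ∈ (χ₀.trans Ψ).source,
      S.lineMap (legendreFlag c g ((χ₀.trans Ψ) m)) = k m := by
    intro m hm
    apply S.line_injective
    have hm1 : m ∈ χ₀.source := hm.1
    have h1 := hz (χ₀ m) hm.2
    rw [Function.comp_apply, χ₀.left_inv hm1] at h1
    rw [line_lineMap, line_eq_span h1 (legendreVector_ne_zero c g _)]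
    exact (isLegendreFlag_legendreFlag c (hg _ (htg ((χ₀.trans Ψ).map_source hm)))).1
  refine ⟨χ₀.trans Ψ, hmem, ⟨hn, hyΨ⟩, g, hg.mono htg, fun m hm => ?_⟩
  have hgm := hg _ (htg ((χ₀.trans Ψ).map_source hm))
  have h1 := IsLiftAt.comp ((contMDiffAt_legendreFlag c hgm).mdifferentiableAt (by simp))
    (isLiftAt_legendreFlag c hgm)
    ((contMDiffAt_of_mem_maximalAtlas hmem hm).mdifferentiableAt (by simp))
    (mfderiv_bijective_of_mem_maximalAtlas hmem hm)
  refine (isLiftAt_iff_canonicalLift.1 h1).2.trans (canonicalLift_congr ?_)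
  filter_upwards [(χ₀.trans Ψ).open_source.mem_nhds hm] with m' hm'
  exact hline m' hm'

/-- Locally, a holomorphic lift of an integral manifold of the contact system is `F_g`, in a
suitable chart. -/
theorem exists_isLegendreFlag_chart {f : N → S.CompactDual}
    (hk : IsIntegralManifold (E := Fin h → ℂ) S.contactSystem (S.lineMap ∘ f))
    (hf : ∀ n, S.planeMap (f n) = canonicalLift (E' := Fin h → ℂ) (S.lineMap ∘ f) n) {n : N}
    {c : S.Frame} (hn : f n ∈ bigCell c) :
    ∃ χ ∈ IsManifold.maximalAtlas 𝓘(ℂ, Fin h → ℂ) ω N, n ∈ χ.source ∧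
      ∃ g : (Fin h → ℂ) → ℂ, AnalyticOnNhd ℂ g χ.target ∧
        ∀ m ∈ χ.source, f m = legendreFlag c g (χ m) := by
  obtain ⟨χ, hχ, hnχ, g, hg, hz⟩ := exists_legendre_chart hk hn (hf n)
  exact ⟨χ, hχ, hnχ, g, hg, fun m hm => S.planeMap_injective ((hf m).trans (hz m hm).symm)⟩

/-- An integral manifold of the contact system has a unique lift, which is holomorphic. -/
theorem exists_lift {k : N → S.Proj}
    (hk : IsIntegralManifold (E := Fin h → ℂ) S.contactSystem k) :
    ∃ f : N → S.CompactDual, ContMDiff 𝓘(ℂ, Fin h → ℂ) 𝓘(ℂ, DualModel h) ω f ∧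
      S.lineMap ∘ f = k ∧
      ∀ n, S.planeMap (f n) = canonicalLift (E' := Fin h → ℂ) (S.lineMap ∘ f) n := by
  have h1 : ∀ n, ∃ F, S.planeMap F = canonicalLift (E' := Fin h → ℂ) k n := fun n => by
    have := canonicalLift_mem_integralElements_of_isIntegralManifold hk n
    rwa [← range_planeMap] at this
  choose f hf using h1
  have hfk : S.lineMap ∘ f = k := funext fun n => congrArg TangentPlane.base (hf n)
  subst hfk
  refine ⟨f, fun n => ?_, rfl, hf⟩
  -- The lift was chosen point by point. Its holomorphy follows because near n it equals F_g in a
  -- chart, for a frame in general position to `f n`.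
  obtain ⟨c, hc⟩ := exists_frame_mem_bigCell (f n)
  obtain ⟨χ, hχ, hnχ, g, hg, hz⟩ := exists_isLegendreFlag_chart hk hf hc
  refine ContMDiffAt.congr_of_eventuallyEq (f := legendreFlag c g ∘ χ) ?_ ?_
  · exact (contMDiffAt_legendreFlag c (hg _ (χ.map_source hnχ))).comp n
      (contMDiffAt_of_mem_maximalAtlas hχ hnχ)
  · filter_upwards [χ.open_source.mem_nhds hnχ] with m hm
    exact hz m hm

variable (S N) in
theorem bijOn_lineMap_comp :
    BijOn (fun f : N → S.CompactDual => S.lineMap ∘ f)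
      {f | IsIntegralManifold (E := Fin h → ℂ) S.periodRelation f ∧
        IsCalabiYauType (E := Fin h → ℂ) f}
      {k | IsIntegralManifold (E := Fin h → ℂ) S.contactSystem k} := by
  have key : ∀ f : N → S.CompactDual, IsIntegralManifold (E := Fin h → ℂ) S.periodRelation f ∧
      IsCalabiYauType (E := Fin h → ℂ) f →
      IsIntegralManifold (E := Fin h → ℂ) S.contactSystem (S.lineMap ∘ f) ∧
        ∀ n, S.planeMap (f n) = canonicalLift (E' := Fin h → ℂ) (S.lineMap ∘ f) n := fun f hf =>
    (isIntegralManifold_lineMap_comp_iff hf.1.1).2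
      ((isIntegralManifold_and_isCalabiYauType_iff hf.1.1).1 hf)
  refine ⟨fun f hf => (key f hf).1, fun f hf f' hf' hff => ?_, fun k hk => ?_⟩
  · ext1 n
    -- The plane of `f n` is the canonical lift of π ∘ f at n, so f is determined by π ∘ f.
    apply S.planeMap_injective
    rw [(key f hf).2, (key f' hf').2]
    exact congrArg (fun k => canonicalLift (E' := Fin h → ℂ) k n) hff
  · obtain ⟨f, hf, rfl, hl⟩ := exists_lift hk
    exact ⟨f, (isIntegralManifold_and_isCalabiYauType_iff hf).2
      ((isIntegralManifold_lineMap_comp_iff hf).1 ⟨hk, hl⟩), rfl⟩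

/-- The holomorphic functions `g` give integral manifolds of Calabi–Yau type. -/
theorem exists_isIntegralManifold_of_potential (c : S.Frame)
    (U : TopologicalSpace.Opens (Fin h → ℂ)) {g : (Fin h → ℂ) → ℂ} (hg : AnalyticOnNhd ℂ g U) :
    ∃ f : U → S.CompactDual, (∀ x : U, IsLegendreFlag c g x (f x)) ∧
      IsIntegralManifold (E := Fin h → ℂ) S.periodRelation f ∧
      IsCalabiYauType (E := Fin h → ℂ) f := by
  refine ⟨legendreFlag c g ∘ Subtype.val, fun x => isLegendreFlag_legendreFlag c (hg x x.2), ?_⟩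
  have hval : ContMDiff 𝓘(ℂ, Fin h → ℂ) 𝓘(ℂ, Fin h → ℂ) ω (Subtype.val : U → Fin h → ℂ) :=
    contMDiff_subtype_val
  have hb : ∀ x : U, Function.Bijective
      (mfderiv 𝓘(ℂ, Fin h → ℂ) 𝓘(ℂ, Fin h → ℂ) (Subtype.val : U → Fin h → ℂ) x) := fun x =>
    mfderiv_bijective_of_mem_maximalAtlas
      (IsManifold.chart_mem_maximalAtlas (I := 𝓘(ℂ, Fin h → ℂ)) (n := ω) x)
      (mem_chart_source (Fin h → ℂ) x)
  refine (isIntegralManifold_and_isCalabiYauType_iff ?_).2 fun x => ?_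
  · exact fun x => (contMDiffAt_legendreFlag c (hg x x.2)).comp x (hval x)
  · exact IsLiftAt.comp ((contMDiffAt_legendreFlag c (hg x x.2)).mdifferentiableAt (by simp))
      (isLiftAt_legendreFlag c (hg x x.2)) ((hval x).mdifferentiableAt (by simp)) (hb x)

end SymplecticForm

end LegendreCharts

/-! ### Openness of the period domain -/

section PeriodDomain

/-- Each alternative is open in (x, y), so compactness of K gives a neighbourhood of x that works
for all y at once. -/
theorem eventually_forall_ne_zero_or_pos {X Y : Type*} [TopologicalSpace X] [TopologicalSpace Y]
    {K : Set Y} (hK : IsCompact K) {f : X × Y → ℂ} {g : X × Y → ℝ} (hf : Continuous f)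
    (hg : Continuous g) {x : X} (hx : ∀ y ∈ K, f (x, y) ≠ 0 ∨ 0 < g (x, y)) :
    ∀ᶠ x' in 𝓝 x, ∀ y ∈ K, f (x', y) ≠ 0 ∨ 0 < g (x', y) := by
  refine hK.eventually_forall_of_forall_eventually fun y hy => ?_
  rcases hx y hy with h0 | h0
  · exact (hf.continuousAt.eventually_ne h0).mono fun p hp => Or.inl hp
  · exact (continuousAt_const.eventually_lt hg.continuousAt h0).mono fun p hp => Or.inr hp

variable {H : Type*} [AddCommGroup H] [Module ℚ H]

namespace Complexification

theorem conj_conj (v : Complexification H) : conj (conj v) = v := by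
  have key : ∀ v : ℂ ⊗[ℚ] H, LinearMap.rTensor H (Complex.conjAe.toLinearMap.restrictScalars ℚ)
      (LinearMap.rTensor H (Complex.conjAe.toLinearMap.restrictScalars ℚ) v) = v := by
    intro v
    induction v using TensorProduct.induction_on with
    | zero => simp
    | tmul z a => simp
    | add v w hv hw => rw [map_add, map_add, hv, hw]
  exact key v

theorem conj_injective : Function.Injective (conj : Complexification H → Complexification H) :=
  fun v w hvw => by rw [← conj_conj v, hvw, conj_conj]

theorem continuous_conj [FiniteDimensional ℚ H] :
    Continuous (conj : Complexification H → Complexification H) := by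
  let l : Complexification H →ₗ[ℝ] Complexification H :=
    { toFun := conj
      map_add' := map_add _
      map_smul' := fun r v => by
        rw [← Complex.coe_smul, LinearMap.map_smulₛₗ, Complex.conj_ofReal, Complex.coe_smul]
        rfl }
  exact l.continuous_of_finiteDimensional

/-- Conjugation is a semilinear bijection, and twisting scalars by an automorphism preserves
dimension. -/
theorem finrank_comap_conj (L : Submodule ℂ (Complexification H)) :
    finrank ℂ (L.comap conj) = finrank ℂ L := by
  let j : L.comap conj ≃+ L :=
    { toFun := fun v => ⟨conj v, v.2⟩
      invFun := fun v => ⟨conj v, by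
        change conj (conj (v : Complexification H)) ∈ L
        rw [conj_conj]
        exact v.2⟩
      left_inv := fun v => Subtype.ext (conj_conj _)
      right_inv := fun v => Subtype.ext (conj_conj _)
      map_add' := fun v w => Subtype.ext (map_add _ _ _) }
  have := rank_eq_of_equiv_equiv (starRingEnd ℂ) j 
    ⟨(starRingEnd ℂ).injective, fun z => ⟨starRingEnd ℂ z, Complex.conj_conj z⟩⟩
    (fun r m => Subtype.ext (LinearMap.map_smulₛₗ conj r (m : Complexification H)))
  exact congrArg Cardinal.toNat this

end Complexification

namespace SymplecticForm.CompactDual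

variable {V : Type*} [AddCommGroup V] [Module ℂ V] {h : ℕ} {S : SymplecticForm V h}

theorem filtration_antitone (F : S.CompactDual) : Antitone F.filtration := by
  refine antitone_nat_of_succ_le fun n => ?_
  match n with
  | 0 => exact le_top
  | 1 => exact F.F2_le_F1
  | 2 => exact F.F3_le_F2
  | 3 => exact bot_le
  | n + 4 => exact le_rfl

theorem form_filtration (F : S.CompactDual) {i j : ℕ} (hij : i + j = 4) {v w : V}
    (hv : v ∈ F.filtration i) (hw : w ∈ F.filtration j) : S.form v w = 0 := by
  have h13 : ∀ v ∈ F.F1, ∀ w ∈ F.F3, S.form w v = 0 := by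
    intro v hv w hw
    rw [F.F1_eq, LinearMap.BilinForm.mem_orthogonal_iff] at hv
    exact hv w hw
  obtain rfl : j = 4 - i := by omega
  have hi : i ≤ 4 := by omega
  interval_cases i
  · rw [(Submodule.mem_bot ℂ).1 hw, map_zero]
  · rw [← S.alt.neg_eq, h13 v hv w hw, neg_zero]
  · have h22 := hw
    change w ∈ F.F2 at h22
    rw [F.F2_eq, LinearMap.BilinForm.mem_orthogonal_iff] at h22
    exact h22 v hv
  · exact h13 w hw v hv
  · rw [(Submodule.mem_bot ℂ).1 hv, map_zero, LinearMap.zero_apply]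

theorem mem_F1_iff (F : S.CompactDual) {z : V} (hz : F.F3 = Submodule.span ℂ {z}) (v : V) :
    v ∈ F.F1 ↔ S.form z v = 0 := by
  rw [F.F1_eq, LinearMap.BilinForm.mem_orthogonal_iff, hz]
  refine ⟨fun hv => hv z (Submodule.mem_span_singleton_self z), fun hv w hw => ?_⟩
  obtain ⟨t, rfl⟩ := Submodule.mem_span_singleton.1 hw
  change S.form (t • z) v = 0
  rw [map_smul, LinearMap.smul_apply, hv, smul_zero]

end SymplecticForm.CompactDual

namespace PolarizationForm

open Complexification

variable [FiniteDimensional ℚ H] {h : ℕ} (Q : PolarizationForm H h)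

theorem form_conj_conj (v w : Complexification H) :
    Q.complexify.form (conj v) (conj w) = starRingEnd ℂ (Q.complexify.form v w) := by
  have key : ∀ v w : ℂ ⊗[ℚ] H, LinearMap.BilinForm.baseChange ℂ Q.form
      (LinearMap.rTensor H (Complex.conjAe.toLinearMap.restrictScalars ℚ) v)
      (LinearMap.rTensor H (Complex.conjAe.toLinearMap.restrictScalars ℚ) w) =
        starRingEnd ℂ (LinearMap.BilinForm.baseChange ℂ Q.form v w) := by
    intro v w
    induction v using TensorProduct.induction_on with
    | zero => simp
    | add v v' h1 h2 => rw [map_add, map_add, map_add, LinearMap.add_apply, LinearMap.add_apply,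
        map_add, h1, h2]
    | tmul z a =>
      induction w using TensorProduct.induction_on with
      | zero => simp
      | add w w' h1 h2 => rw [map_add, map_add, map_add, map_add, h1, h2]
      | tmul z' b =>
        simp [LinearMap.BilinForm.baseChange_tmul, Algebra.smul_def]
  exact key v w

/-- The quadratic form `i Q(v, conj v)` takes real values. -/
theorem exists_ofReal_form_conj (v : Complexification H) :
    ∃ r : ℝ, Q.complexify.form v (conj v) = -Complex.I * r := by
  have h1 := Q.form_conj_conj v (conj v)
  rw [conj_conj, ← Q.complexify.alt.neg_eq] at h1
  refine ⟨-(Q.complexify.form v (conj v)).im, ?_⟩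
  have h2 : (Q.complexify.form v (conj v)).re = 0 := by
    have := congrArg Complex.re h1
    rw [Complex.neg_re, Complex.conj_re] at this
    linarith
  apply Complex.ext
  · simp [h2]
  · simp

/-- The Hermitian form `i Q(v, conj v)`. -/
noncomputable def hermitian (v : Complexification H) : ℝ :=
  (Complex.I * Q.complexify.form v (conj v)).re

theorem form_conj_eq (v : Complexification H) :
    Q.complexify.form v (conj v) = -Complex.I * Q.hermitian v := by
  obtain ⟨r, hr⟩ := Q.exists_ofReal_form_conj v
  have : Q.hermitian v = r := by
    rw [hermitian, hr, ← mul_assoc, mul_neg, Complex.I_mul_I, neg_neg, one_mul, Complex.ofReal_re]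
  rw [hr, this]

theorem hermitian_conj (v : Complexification H) : Q.hermitian (conj v) = -Q.hermitian v := by
  rw [hermitian, hermitian, conj_conj, ← Q.complexify.alt.neg_eq, mul_neg, Complex.neg_re]

theorem hermitian_zero : Q.hermitian 0 = 0 := by simp [hermitian]

variable {Q} in
-- For p > q one has v ∈ Fᵖ and conj w ∈ F^{3-q} ⊆ F^{4-p}, and these are orthogonal. The other case
-- follows by conjugation.
theorem form_hodge_of_ne (F : Q.complexify.CompactDual) {p q : ℕ} (hp : p ≤ 3) (hq : q ≤ 3)
    (hpq : p ≠ q) {v w : Complexification H} (hv : v ∈ Q.hodge F p) (hw : w ∈ Q.hodge F q) :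
    Q.complexify.form v (conj w) = 0 := by
  have key : ∀ p q, p ≤ 3 → q < p → ∀ v w, v ∈ Q.hodge F p → w ∈ Q.hodge F q →
      Q.complexify.form v (conj w) = 0 := by
    intro p q hp hqp v w hv hw
    exact F.form_filtration (show p + (4 - p) = 4 by omega) hv.1
      (F.filtration_antitone (by omega) hw.2)
  rcases lt_or_gt_of_ne hpq with hlt | hlt
  · have h1 := key q p hq hlt w v hw hv
    have h2 := Q.form_conj_conj w (conj v)
    rw [h1, conj_conj, map_zero, ← Q.complexify.alt.neg_eq, neg_eq_zero] at h2
    exact h2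
  · exact key p q hp hlt v w hv hw

theorem I_zpow_mul (p : ℕ) :
    Complex.I ^ (2 * (p : ℤ) - 3) * -Complex.I = (-1) ^ p := by
  rw [zpow_sub₀ Complex.I_ne_zero, zpow_mul, zpow_natCast]
  have h2 : Complex.I ^ (2 : ℤ) = -1 := by
    rw [show (2 : ℤ) = ((2 : ℕ) : ℤ) from rfl, zpow_natCast, Complex.I_sq]
  have h3 : Complex.I ^ (3 : ℤ) = -Complex.I := by
    rw [show (3 : ℤ) = ((3 : ℕ) : ℤ) from rfl, zpow_natCast, Complex.I_pow_three]
  rw [h2, h3, div_mul_cancel₀ _ (neg_ne_zero.2 Complex.I_ne_zero)]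

variable {Q} in
/-- The value `Q(C u, conj u)` on the sum of the components `u p` of type `(p, 3 - p)`. -/
theorem form_weil (F : Q.complexify.CompactDual) (u : Fin 4 → Complexification H)
    (hu : ∀ p : Fin 4, u p ∈ Q.hodge F p) :
    Q.complexify.form (∑ p : Fin 4, Complex.I ^ (2 * ((p : ℕ) : ℤ) - 3) • u p)
      (conj (∑ p, u p)) = ((∑ p : Fin 4, (-1) ^ (p : ℕ) * Q.hermitian (u p) : ℝ) : ℂ) := by
  rw [map_sum, LinearMap.sum_apply, Complex.ofReal_sum]
  refine Finset.sum_congr rfl fun p _ => ?_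
  rw [map_smul, LinearMap.smul_apply, map_sum, map_sum, Finset.sum_eq_single p, form_conj_eq,
    smul_eq_mul, ← mul_assoc, I_zpow_mul]
  · push_cast
    rfl
  · intro q _ hqp
    exact form_hodge_of_ne F (by omega) (by omega) (fun h => hqp (Fin.ext h.symm)) (hu p) (hu q)
  · simp

variable {Q} in
-- By `form_weil`, positivity means that (-1)ᵖ i Q(v, conj v) > 0 on each H^{p,3-p}. Conjugation
-- exchanges p with 3 - p and reverses the sign of the form, so p = 3 and p = 2 suffice. The direct
-- sum conditions are then consequences of definiteness and dimensions.
theorem mem_periodDomain_iff (F : Q.complexify.CompactDual) : F ∈ Q.periodDomain ↔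
    (∀ v ∈ F.F3, v ≠ 0 → Q.hermitian v < 0) ∧
      ∀ v ∈ F.F2, conj v ∈ F.F1 → v ≠ 0 → 0 < Q.hermitian v := by
  constructor
  · rintro ⟨-, hpos⟩
    have key : ∀ (p : Fin 4), ∀ v ∈ Q.hodge F p, v ≠ 0 → 0 < (-1) ^ (p : ℕ) * Q.hermitian v := by
      intro p v hv hv0
      have hu : ∀ q : Fin 4, (Pi.single p v : Fin 4 → Complexification H) q ∈ Q.hodge F q := by
        intro q
        rcases eq_or_ne q p with rfl | hqp
        · rwa [Pi.single_eq_same]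
        · rw [Pi.single_eq_of_ne hqp]
          exact Submodule.zero_mem _
      have hsum : ∑ q, (Pi.single p v : Fin 4 → Complexification H) q = v := by simp
      obtain ⟨r, hr, hr'⟩ := hpos _ hu (by rwa [hsum])
      rw [form_weil F _ hu, Finset.sum_eq_single p, Pi.single_eq_same] at hr'
      · rwa [Complex.ofReal_inj.1 hr']
      · intro q _ hqp
        rw [Pi.single_eq_of_ne hqp, hermitian_zero, mul_zero]
      · simp
    refine ⟨fun v hv hv0 => ?_, fun v hv hv1 hv0 => ?_⟩
    · have := key 3 v ⟨hv, trivial⟩ hv0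
      norm_num at this
      exact this
    · have := key 2 v ⟨hv, hv1⟩ hv0
      norm_num at this
      exact this
  · rintro ⟨h3, h2⟩
    -- A vector of Fᵖ whose conjugate lies in F^{4-p} is null for i Q(v, conj v) by orthogonality,
    -- so definiteness kills it.
    have hH3 : ∀ v ∈ F.F3, conj v ∈ F.F1 → v = 0 := by
      intro v hv hv1
      by_contra hv0
      have h4 := h3 v hv hv0
      have h5 := F.form_filtration (show 3 + 1 = 4 from rfl) hv hv1
      rw [hermitian, h5, mul_zero, Complex.zero_re] at h4
      exact lt_irrefl _ h4
    have hH2 : ∀ v ∈ F.F2, conj v ∈ F.F2 → v = 0 := by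
      intro v hv hv2
      by_contra hv0
      have h4 := h2 v hv (F.F2_le_F1 hv2) hv0
      have h5 := F.form_filtration (show 2 + 2 = 4 from rfl) hv hv2
      rw [hermitian, h5, mul_zero, Complex.zero_re] at h4
      exact lt_irrefl _ h4
    constructor
    · have hcompl : ∀ L L' : Submodule ℂ (Complexification H),
          finrank ℂ L + finrank ℂ L' = 2 * h + 2 → (∀ v ∈ L, conj v ∈ L' → v = 0) →
          IsCompl L (L'.comap conj) := by
        intro L L' hd h0
        refine (Submodule.isCompl_iff_disjoint _ _ ?_).2 (Submodule.disjoint_def.2 h0)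
        rw [finrank_comap_conj, hd, Q.complexify.dim]
      have hd1 := F.finrank_F1
      have hd2 := F.finrank_F2
      have hd3 := F.finrank_F3
      intro p hp
      interval_cases p
      · refine hcompl ⊤ ⊥ (by rw [finrank_top, finrank_bot, Q.complexify.dim]) fun v _ hv => ?_
        exact conj_injective (((Submodule.mem_bot ℂ).1 hv).trans (map_zero _).symm)
      · refine hcompl F.F1 F.F3 (by omega) fun v hv hv3 => ?_
        exact conj_injective ((hH3 _ hv3 (by rwa [conj_conj])).trans (map_zero _).symm)
      · exact hcompl F.F2 F.F2 (by omega) hH2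
      · exact hcompl F.F3 F.F1 (by omega) hH3
      · refine hcompl ⊥ ⊤ (by rw [finrank_top, finrank_bot, Q.complexify.dim, zero_add]) fun v hv _ => ?_
        exact (Submodule.mem_bot ℂ).1 hv
    · intro u hu hu0
      -- For p = 0 and p = 1 the hypotheses are applied to the conjugate of `u p`, which has type
      -- (3, 0) or (2, 1).
      have hterm : ∀ p : Fin 4, u p ≠ 0 → 0 < (-1) ^ (p : ℕ) * Q.hermitian (u p) := by
        intro p hp
        have hc0 : conj (u p) ≠ 0 := fun h0 => hp (conj_injective (h0.trans (map_zero _).symm))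
        have hup := hu p
        fin_cases p
        · have h4 := h3 _ hup.2 hc0
          rw [hermitian_conj] at h4
          simpa using h4
        · have h4 := h2 _ hup.2 (by rw [conj_conj]; exact hup.1) hc0
          rw [hermitian_conj] at h4
          simpa using h4
        · have h4 := h2 _ hup.1 hup.2 hp
          simpa using h4
        · have h4 := h3 _ hup.1 hp
          norm_num
          exact h4
      refine ⟨_, ?_, form_weil F u hu⟩
      obtain ⟨p, -, hp⟩ := Finset.exists_ne_zero_of_sum_ne_zero hu0
      refine Finset.sum_pos' (fun q _ => ?_) ⟨p, Finset.mem_univ p, hterm p hp⟩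
      rcases eq_or_ne (u q) 0 with h0 | h0
      · rw [h0, hermitian_zero, mul_zero]
      · exact (hterm q h0).le

theorem hermitian_smul (t : ℂ) (v : Complexification H) :
    Q.hermitian (t • v) = Complex.normSq t * Q.hermitian v := by
  have h1 : Q.complexify.form (t • v) (conj (t • v)) =
      (Complex.normSq t : ℂ) * Q.complexify.form v (conj v) := by
    rw [LinearMap.map_smulₛₗ conj, map_smul, map_smul, LinearMap.smul_apply, smul_eq_mul,
      smul_eq_mul, ← mul_assoc, mul_comm _ t, Complex.mul_conj]
  rw [hermitian, h1, mul_left_comm, Complex.re_ofReal_mul, hermitian]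

theorem continuous_hermitian : Continuous Q.hermitian := by
  have h1 : Continuous fun v => Q.complexify.formL v (conj v) :=
    Q.complexify.formL.continuous.clm_apply continuous_conj
  exact Complex.continuous_re.comp (continuous_const.mul h1)

/-- The spaces H^{2,1} vary with F, so positivity there is restated on all of F² = {U a}: either U a
violates the equation Q(z, conj(U a)) = 0, or the form is positive on it. Both alternatives are
open, and homogeneity confines a to the compact unit sphere. -/
theorem isOpen_periodDomain : IsOpen Q.periodDomain := by
  rw [isOpen_iff_eventually]
  intro F hF
  obtain ⟨c, u, rfl, -⟩ := Q.complexify.exists_dualP_eq F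
  rw [HolParam.eventually_iff]
  have hz : Continuous (SymplecticForm.dualVec c) := (SymplecticForm.contDiff_dualVec c).continuous
  have hU : Continuous fun p : DualModel h × (Fin (h + 1) → ℂ) =>
      SymplecticForm.graphVec c p.1.2 p.2 := by
    have h1 : Continuous fun p : DualModel h × (Fin (h + 1) → ℂ) =>
        c.symmL (p.2, symOpL (h + 1) p.1.2 p.2) := by fun_prop
    exact h1
  have hmem : ∀ u, SymplecticForm.dualParam _ c u ∈ Q.periodDomain ↔
      Q.hermitian (SymplecticForm.dualVec c u) < 0 ∧
      ∀ a ∈ Metric.sphere (0 : Fin (h + 1) → ℂ) 1,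
        Q.complexify.formL (SymplecticForm.dualVec c u)
          (conj (SymplecticForm.graphVec c u.2 a)) ≠ 0 ∨
        0 < Q.hermitian (SymplecticForm.graphVec c u.2 a) := by
    intro u
    have hz3 : (Q.complexify.dualParam c u).F3 = Submodule.span ℂ {SymplecticForm.dualVec c u} :=
      SymplecticForm.dualP_F3 c u
    have hF2 : (Q.complexify.dualParam c u).F2 = LinearMap.range (SymplecticForm.graphVec c u.2) :=
      SymplecticForm.dualParam_F2 c u
    have hF1 := (Q.complexify.dualParam c u).mem_F1_iff hz3
    rw [mem_periodDomain_iff]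
    constructor
    · rintro ⟨h3, h2⟩
      refine ⟨h3 _ ?_ (SymplecticForm.dualVec_ne_zero c u), fun a ha => ?_⟩
      · rw [hz3]
        exact Submodule.mem_span_singleton_self _
      · refine or_iff_not_imp_left.2 fun h0 => h2 _ ?_ ((hF1 _).2 (not_not.1 h0)) fun h4 => ?_
        · rw [hF2]
          exact LinearMap.mem_range_self _ a
        · have h5 : a = 0 := SymplecticForm.graphVec_injective c u.2 (h4.trans (map_zero _).symm)
          rw [h5] at ha
          simp at ha
    · rintro ⟨h3, h2⟩
      constructor
      · intro v hv hv0
        rw [hz3] at hv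
        obtain ⟨t, rfl⟩ := Submodule.mem_span_singleton.1 hv
        rw [hermitian_smul]
        refine mul_neg_of_pos_of_neg (Complex.normSq_pos.2 ?_) h3
        rintro rfl
        exact hv0 (zero_smul _ _)
      · intro v hv hv1 hv0
        rw [hF2] at hv
        obtain ⟨a, rfl⟩ := hv
        have ha : a ≠ 0 := by
          rintro rfl
          exact hv0 (map_zero _)
        -- Rescaling to the unit sphere multiplies the form by a nonnegative factor and preserves
        -- the linear condition.
        have h4 := h2 ((‖a‖⁻¹ : ℂ) • a) (by
          rw [mem_sphere_zero_iff_norm, norm_smul, norm_inv, Complex.norm_real, norm_norm,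
            inv_mul_cancel₀ (norm_ne_zero_iff.2 ha)])
        rw [map_smul, LinearMap.map_smulₛₗ conj, map_smul, hermitian_smul,
          SymplecticForm.formL_apply, (hF1 _).1 hv1, smul_zero] at h4
        exact pos_of_mul_pos_right (h4.resolve_left fun h => h rfl) (Complex.normSq_nonneg _)
  change ∀ᶠ u' in 𝓝 u, Q.complexify.dualParam c u' ∈ Q.periodDomain
  simp only [hmem]
  obtain ⟨h3, h2⟩ := (hmem u).1 hF
  refine Filter.Eventually.and ?_ ?_
  · exact ((Q.continuous_hermitian.comp hz).continuousAt.eventually_lt continuousAt_const h3)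
  · have h1 : Continuous fun p : DualModel h × (Fin (h + 1) → ℂ) =>
        Q.complexify.formL (SymplecticForm.dualVec c p.1)
          (conj (SymplecticForm.graphVec c p.1.2 p.2)) :=
      (Q.complexify.formL.continuous.comp (hz.comp continuous_fst)).clm_apply
        (continuous_conj.comp hU)
    exact eventually_forall_ne_zero_or_pos (isCompact_sphere _ _) h1
      (Q.continuous_hermitian.comp hU) h2

end PolarizationForm

end PeriodDomain

/-! ### Assembly of the proposition -/

theorem proposition3p17 {H : Type*} [AddCommGroup H] [Module ℚ H] [FiniteDimensional ℚ H] {h : ℕ}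
    (Q : PolarizationForm H h) :
    -- `D` is open in `Ď`, so that everything below applies to `D`
    IsOpen Q.periodDomain ∧
    -- `I` is a Pfaffian system on `Ď`, and the system on `ℙ(H_ℂ)` is a contact system
    IsPfaffianSystem Q.complexify.periodRelation (h + 1) ∧
    IsContactSystem Q.complexify.contactSystem h ∧
    -- `(Ď, I)` is the first prolongation of the contact system
    IsFirstProlongation h Q.complexify.contactSystem Q.complexify.periodRelation
      Q.complexify.planeMap ∧
    -- the integral manifolds of Calabi–Yau type correspond to those of the contact system
    (∀ (N : Type*) [TopologicalSpace N] [ChartedSpace (Fin h → ℂ) N]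
      [IsManifold 𝓘(ℂ, Fin h → ℂ) ω N],
      (∀ f : N → Q.complexify.CompactDual,
        ContMDiff 𝓘(ℂ, Fin h → ℂ) 𝓘(ℂ, DualModel h) ω f →
        (IsIntegralManifold (E := Fin h → ℂ) Q.complexify.periodRelation f ∧
            SymplecticForm.IsCalabiYauType (E := Fin h → ℂ) f ↔
          IsIntegralManifold (E := Fin h → ℂ) Q.complexify.contactSystem
              (Q.complexify.lineMap ∘ f) ∧
            ∀ n, Q.complexify.planeMap (f n) =
              canonicalLift (E' := Fin h → ℂ) (Q.complexify.lineMap ∘ f) n)) ∧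
      BijOn (fun f : N → Q.complexify.CompactDual => Q.complexify.lineMap ∘ f)
        {f | IsIntegralManifold (E := Fin h → ℂ) Q.complexify.periodRelation f ∧
          SymplecticForm.IsCalabiYauType (E := Fin h → ℂ) f}
        {k | IsIntegralManifold (E := Fin h → ℂ) Q.complexify.contactSystem k}) ∧
    -- locally, they depend on one arbitrary holomorphic function `g` of `h` variables
    (∀ F : Q.complexify.CompactDual, ∃ e : Q.complexify.Frame, F ∈ SymplecticForm.bigCell e) ∧
    ∀ e : Q.complexify.Frame,
      IsOpen (SymplecticForm.bigCell e) ∧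
      (∀ F ∈ SymplecticForm.bigCell e, ∃ g x, AnalyticOnNhd ℂ g univ ∧
        SymplecticForm.IsLegendreFlag e g x F) ∧
      (∀ (U : TopologicalSpace.Opens (Fin h → ℂ)) (g : (Fin h → ℂ) → ℂ), AnalyticOnNhd ℂ g U →
        ∃ f : U → Q.complexify.CompactDual,
          (∀ x : U, SymplecticForm.IsLegendreFlag e g x (f x)) ∧
          IsIntegralManifold (E := Fin h → ℂ) Q.complexify.periodRelation f ∧
          SymplecticForm.IsCalabiYauType (E := Fin h → ℂ) f) ∧
      (∀ (N : Type*) [TopologicalSpace N] [ChartedSpace (Fin h → ℂ) N]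
        [IsManifold 𝓘(ℂ, Fin h → ℂ) ω N] (f : N → Q.complexify.CompactDual),
        IsIntegralManifold (E := Fin h → ℂ) Q.complexify.periodRelation f →
        SymplecticForm.IsCalabiYauType (E := Fin h → ℂ) f →
        ∀ n, f n ∈ SymplecticForm.bigCell e →
          ∃ χ ∈ IsManifold.maximalAtlas 𝓘(ℂ, Fin h → ℂ) ω N, n ∈ χ.source ∧
            ∃ g : (Fin h → ℂ) → ℂ, AnalyticOnNhd ℂ g χ.target ∧
              ∀ m ∈ χ.source, SymplecticForm.IsLegendreFlag e g (χ m) (f m)) ∧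
      (∀ g g' x x' F, SymplecticForm.IsLegendreFlag e g x F →
        SymplecticForm.IsLegendreFlag e g' x' F → x = x' ∧ g x = g' x') := by
  refine ⟨Q.isOpen_periodDomain, Q.complexify.isPfaffianSystem_periodRelation,
    Q.complexify.isContactSystem_contactSystem, Q.complexify.isFirstProlongation_planeMap,
    fun N _ _ _ => ⟨fun f hf => ?_, Q.complexify.bijOn_lineMap_comp N⟩,
    SymplecticForm.exists_frame_mem_bigCell, fun e => ⟨SymplecticForm.isOpen_bigCell e,
      fun F hF => SymplecticForm.exists_isLegendreFlag e hF,
      fun U g hg => SymplecticForm.exists_isIntegralManifold_of_potential e U hg,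
      fun N _ _ _ f hf hcy n hn => ?_, fun g g' x x' F hF hF' => hF.unique hF'⟩⟩
  -- Both sides are equivalent to `IsLiftAt` at every point.
  · rw [SymplecticForm.isIntegralManifold_and_isCalabiYauType_iff hf,
      SymplecticForm.isIntegralManifold_lineMap_comp_iff hf]
  · obtain ⟨hk, hl⟩ := (SymplecticForm.isIntegralManifold_lineMap_comp_iff hf.1).2
      ((SymplecticForm.isIntegralManifold_and_isCalabiYauType_iff hf.1).1 ⟨hf, hcy⟩)
    obtain ⟨χ, hχ, hnχ, g, hg, hz⟩ := SymplecticForm.exists_isLegendreFlag_chart hk hl hn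
    refine ⟨χ, hχ, hnχ, g, hg, fun m hm => ?_⟩
    rw [hz m hm]
    exact SymplecticForm.isLegendreFlag_legendreFlag e (hg _ (χ.map_source hm))
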